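/- Let $a,c\in\mathbb R$ with $a^2,c^2>0$, let $0<R<\infty$, $k\in\mathbb Z\setminus\{0\}$, and put $s_+=\sqrt{24a^2c^2}/(4c^2)$, so that $\tfrac23 s_+^2=a^2/c^2$. Let $$S=\Big\{(u,v):(0,R]\to\mathbb R^2 \;\Big|\; \sqrt r\,u',\ \sqrt r\,v',\ \tfrac{u}{\sqrt r},\ \sqrt r\,v\in L^2(0,R),\ u(R)=\tfrac{s_+}{\sqrt2},\ v(R)=-\tfrac{s_+}{\sqrt6}\Big\}$$ (with $u,v$ absolutely continuous on $[\varepsilon,R]$ for every $0<\varepsilon<R$), and let $$\mathcal E_0(u,v)=\int_0^R\tfrac12\Big((u')^2+(v')^2+\tfrac{k^2}{r^2}u^2\Big)r\,dr\quad\text{if } u^2+v^2=\tfrac{a^2}{c^2}\text{ on }(0,R),\qquad \mathcal E_0(u,v)=\infty\text{ otherwise.}$$ A pair $(u,v)\in S$ with $\mathcal E_0(u,v)<\infty$ is called a critical point of $\mathcal E_0$ over $S$ if for all smooth $\xi,\eta:\mathbb R\to\mathbb R$ with $\xi(0)=\xi(R)=\eta(R)=0$ the function $t\mapsto \mathcal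 E_0\big(\tfrac ac\,\tfrac{(u+t\xi,\,v+t\eta)}{|(u+t\xi,\,v+t\eta)|}\big)$ has derivative $0$ at $t=0$ (here $\tfrac ac$ stands for $\sqrt{a^2/c^2}$). **Theorem.** $\mathcal E_0$ has exactly two critical points over $S$ (pairs being identified if they agree on $(0,R]$). They are $(u_-,v_-)$ and $(u_+,v_+)$, where $$u_-(r)=2\sqrt2\,s_+\frac{R^{|k|}r^{|k|}}{r^{2|k|}+3R^{2|k|}},\quad v_-(r)=\sqrt{\tfrac23}\,s_+\frac{r^{2|k|}-3R^{2|k|}}{r^{2|k|}+3R^{2|k|}},$$ $$u_+(r)=2\sqrt2\,s_+\frac{R^{|k|}r^{|k|}}{3r^{2|k|}+R^{2|k|}},\quad v_+(r)=\sqrt{\tfrac23}\,s_+\frac{R^{2|k|}-3r^{2|k|}}{3r^{2|k|}+R^{2|k|}}.$$ Let $\mathcal S_0$ be the set of real symmetric traceless $3\times3$ matrices, $|Q|^2=\operatorname{tr}(Q^2)$, and $B_R\subset\mathbb R^2$ the open disk of radius $R$ centred at $0$. Write $n(\varphi)=(\cos\frac{k\varphi}2,\sin\frac{k\varphi}2,0)$,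 $Q_k(\varphi)=n(\varphi)\otimes n(\varphi)-\frac13I$, $F_n(\varphi)=\sqrt2\,\big(n(\varphi)\otimes n(\varphi)-\frac12(e_1\otimes e_1+e_2\otimes e_2)\big)$, $F_3=\sqrt{\tfrac32}\,\big(e_3\otimes e_3-\frac13I\big)$, and, in polar coordinates, $Y_\pm(r,\varphi)=u_\pm(r)F_n(\varphi)+v_\pm(r)F_3$. Then $Y_-$ and $Y_+$ are critical points of the harmonic map problem $$\min\Big\{\int_{B_R}\tfrac12|\nabla Q|^2\;\Big|\;Q\in H^1(B_R,\mathcal S_0),\ Q(R,\varphi)=s_+Q_k(\varphi)\text{ on }\partial B_R\text{ in the sense of traces},\ |Q|^2=\tfrac23s_+^2\text{ a.e. in }B_R\Big\},$$ that is, they are admissible and, for $Q=Y_\pm$ and every $P\in C_c^\infty(B_R,\mathcal S_0)$, the Dirichlet energy of $\sqrt{\tfrac23}\,s_+\,\frac{Q+tP}{|Q+tP|}$ has derivative $0$ at $t=0$. Moreover $Y_-$ is the unique (up to equality a.e.) global minimiser of this problem. -/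

import Mathlib

open MeasureTheory Set Filter Topology
open scoped ENNReal ContDiff Matrix

noncomputable section

namespace QDefect

/-! ## Q-tensors and the ansatz -/

/-- Q-tensors: real symmetric traceless `3 × 3` matrices. -/
def S0 : Set (Matrix (Fin 3) (Fin 3) ℝ) := {Q | Qᵀ = Q ∧ Q.trace = 0}

/-- `|Q|² = tr (Q²)`. -/
def normSq (Q : Matrix (Fin 3) (Fin 3) ℝ) : ℝ := (Q * Q).trace

/-- The constant `s₊` for the material parameters `a², b², c²`. -/
def sPlus (a b c : ℝ) : ℝ := (b ^ 2 + √(b ^ 4 + 24 * a ^ 2 * c ^ 2)) / (4 * c ^ 2)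

/-- `n(φ) = (cos (kφ/2), sin (kφ/2), 0)`. -/
def director (k : ℤ) (φ : ℝ) : Fin 3 → ℝ :=
  ![Real.cos ((k : ℝ) / 2 * φ), Real.sin ((k : ℝ) / 2 * φ), 0]

/-- `Q_k(φ) = n(φ) ⊗ n(φ) - I / 3`. -/
def Qk (k : ℤ) (φ : ℝ) : Matrix (Fin 3) (Fin 3) ℝ :=
  Matrix.vecMulVec (director k φ) (director k φ) - (1 / 3 : ℝ) • (1 : Matrix (Fin 3) (Fin 3) ℝ)

/-- `F_n(φ) = √2 (n(φ) ⊗ n(φ) - I₂ / 2)` with `I₂ = e₁ ⊗ e₁ + e₂ ⊗ e₂`. -/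
def Fn (k : ℤ) (φ : ℝ) : Matrix (Fin 3) (Fin 3) ℝ :=
  √2 • (Matrix.vecMulVec (director k φ) (director k φ)
    - (1 / 2 : ℝ) • Matrix.diagonal ![(1 : ℝ), 1, 0])

/-- `F₃ = √(3/2) (e₃ ⊗ e₃ - I / 3)`. -/
def F3 : Matrix (Fin 3) (Fin 3) ℝ :=
  √(3 / 2) • (Matrix.vecMulVec ![(0 : ℝ), 0, 1] ![(0 : ℝ), 0, 1]
    - (1 / 3 : ℝ) • (1 : Matrix (Fin 3) (Fin 3) ℝ))

/-- The map `Y = u(r) F_n(φ) + v(r) F₃` on the plane. The plane is `ℂ`, the point `r e^{iφ}` having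
polar coordinates `(r, φ)`; since `k` is an integer, `F_n` is `2π`-periodic. -/
def ansatz (k : ℤ) (u v : ℝ → ℝ) (z : ℂ) : Matrix (Fin 3) (Fin 3) ℝ :=
  u ‖z‖ • Fn k z.arg + v ‖z‖ • F3

/-! ## The explicit profiles -/

def uMinus (R s : ℝ) (k : ℤ) (r : ℝ) : ℝ :=
  2 * √2 * s * (R ^ k.natAbs * r ^ k.natAbs / (r ^ (2 * k.natAbs) + 3 * R ^ (2 * k.natAbs)))

def vMinus (R s : ℝ) (k : ℤ) (r : ℝ) : ℝ :=
  √(2 / 3) * s * ((r ^ (2 * k.natAbs) - 3 * R ^ (2 * k.natAbs)) /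
    (r ^ (2 * k.natAbs) + 3 * R ^ (2 * k.natAbs)))

def uPlus (R s : ℝ) (k : ℤ) (r : ℝ) : ℝ :=
  2 * √2 * s * (R ^ k.natAbs * r ^ k.natAbs / (3 * r ^ (2 * k.natAbs) + R ^ (2 * k.natAbs)))

def vPlus (R s : ℝ) (k : ℤ) (r : ℝ) : ℝ :=
  √(2 / 3) * s * ((R ^ (2 * k.natAbs) - 3 * r ^ (2 * k.natAbs)) /
    (3 * r ^ (2 * k.natAbs) + R ^ (2 * k.natAbs)))

/-! ## The one-dimensional problem -/

/-- The admissible set `S`. A function on `(0, R]` with a locally integrable weak derivative is, for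
its continuous representative, absolutely continuous on every `[ε, R]`, `0 < ε < R`, and its weak
derivative is the classical one, which exists almost everywhere. Only values on `(0, R]` matter. -/
structure MemS (R s : ℝ) (u v : ℝ → ℝ) : Prop where
  ac_u : ∀ ε ∈ Ioo 0 R, AbsolutelyContinuousOnInterval u ε R
  ac_v : ∀ ε ∈ Ioo 0 R, AbsolutelyContinuousOnInterval v ε R
  deriv_u : MemLp (fun r => √r * deriv u r) 2 (volume.restrict (Ioo 0 R))
  deriv_v : MemLp (fun r => √r * deriv v r) 2 (volume.restrict (Ioo 0 R))
  val_u : MemLp (fun r => u r / √r) 2 (volume.restrict (Ioo 0 R))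
  val_v : MemLp (fun r => √r * v r) 2 (volume.restrict (Ioo 0 R))
  bdry_u : u R = s / √2
  bdry_v : v R = -(s / √6)

open Classical in
/-- The limiting energy: `∫₀ᴿ ½ (u'² + v'² + k² u² / r²) r dr` if `u² + v² = a² / c²`, and `∞`
otherwise. -/
def E0 (a c R : ℝ) (k : ℤ) (u v : ℝ → ℝ) : ℝ≥0∞ :=
  if ∀ r ∈ Ioo 0 R, u r ^ 2 + v r ^ 2 = a ^ 2 / c ^ 2 then
    ∫⁻ r in Ioo 0 R, ENNReal.ofReal
      (1 / 2 * (deriv u r ^ 2 + deriv v r ^ 2 + (k : ℝ) ^ 2 / r ^ 2 * u r ^ 2) * r)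
  else ⊤

/-- The factor that brings the vector `(x, y) ≠ 0` to the circle of radius `ρ`. -/
def scale (ρ x y : ℝ) : ℝ := ρ / √(x ^ 2 + y ^ 2)

/-- `(u, v)` is a critical point of `E0` over `S`: it lies in `S` and has finite energy (so that
`u² + v² = a² / c²`), and the energy is stationary along every variation
`t ↦ ρ (u + tξ, v + tη) / |(u + tξ, v + tη)|`, `ρ² = a² / c²`, in a smooth direction `(ξ, η)` which
keeps the boundary values at `R`, and for which `ξ(0) = 0`, that is, `ξ / √r ∈ L²`. These variations
stay, for small `t`, in `S` and in the set where `E0` is finite. -/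
structure IsCriticalE0 (a c R : ℝ) (k : ℤ) (u v : ℝ → ℝ) : Prop where
  mem : MemS R (sPlus a 0 c) u v
  finite : E0 a c R k u v ≠ ⊤
  stationary : ∀ ξ η : ℝ → ℝ, ContDiff ℝ ∞ ξ → ContDiff ℝ ∞ η → ξ 0 = 0 → ξ R = 0 → η R = 0 →
    HasDerivAt (fun t : ℝ => (E0 a c R k
      (fun r => scale √(a ^ 2 / c ^ 2) (u r + t * ξ r) (v r + t * η r) * (u r + t * ξ r))
      (fun r => scale √(a ^ 2 / c ^ 2) (u r + t * ξ r) (v r + t * η r) * (v r + t * η r))).toReal)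
      0 0

/-! ## Sobolev functions on the disk -/

/-- The coordinate directions of the plane `ℂ`. -/
def dir : Fin 2 → ℂ := ![1, Complex.I]

/-- `p 0` and `p 1` are the weak partial derivatives of `q` on the open set `Ω`. -/
def HasWeakGradient (Ω : Set ℂ) (q : ℂ → ℝ) (p : Fin 2 → ℂ → ℝ) : Prop :=
  LocallyIntegrableOn q Ω ∧ (∀ l, LocallyIntegrableOn (p l) Ω) ∧
  ∀ θ : ℂ → ℝ, ContDiff ℝ ∞ θ → HasCompactSupport θ → tsupport θ ⊆ Ω →
    ∀ l, ∫ z in Ω, q z * fderiv ℝ θ z (dir l) = -∫ z in Ω, p l z * θ z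

/-- `q ∈ H¹(Ω)`. -/
def MemH1 (Ω : Set ℂ) (q : ℂ → ℝ) : Prop :=
  MemLp q 2 (volume.restrict Ω) ∧
    ∃ p, HasWeakGradient Ω q p ∧ ∀ l, MemLp (p l) 2 (volume.restrict Ω)

/-- `q ∈ H¹(B_R)` has boundary trace `g`, a function of the polar angle: `q` is the limit in
`H¹(B_R)` of functions smooth up to the boundary, whose restrictions to the circle converge to `g`
in `L²(∂B_R)`. -/
def HasTrace (R : ℝ) (q : ℂ → ℝ) (g : ℝ → ℝ) : Prop :=
  ∃ p, HasWeakGradient (Metric.ball 0 R) q p ∧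
    ∃ f : ℕ → ℂ → ℝ, (∀ m, ContDiff ℝ ∞ (f m)) ∧
      Tendsto (fun m => eLpNorm (fun z => f m z - q z) 2
        (volume.restrict (Metric.ball 0 R))) atTop (𝓝 0) ∧
      (∀ l, Tendsto (fun m => eLpNorm (fun z => fderiv ℝ (f m) z (dir l) - p l z) 2
        (volume.restrict (Metric.ball 0 R))) atTop (𝓝 0)) ∧
      Tendsto (fun m => eLpNorm (fun θ : ℝ => f m (circleMap 0 R θ) - g θ) 2
        (volume.restrict (Ioo 0 (2 * Real.pi)))) atTop (𝓝 0)

/-! ## The harmonic map problem -/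

/-- The Dirichlet energy `∫_{B_R} ½ |∇Q|²`, with `∇Q` the weak gradient. The weak gradient is unique
almost everywhere, so the infimum is over equal numbers; it is `∞` if there is no weak gradient. -/
def dirichletEnergy (R : ℝ) (Q : ℂ → Matrix (Fin 3) (Fin 3) ℝ) : ℝ≥0∞ :=
  ⨅ (G : Fin 2 → ℂ → Matrix (Fin 3) (Fin 3) ℝ)
    (_ : ∀ i j, HasWeakGradient (Metric.ball 0 R) (fun z => Q z i j) (fun l z => G l z i j)),
    ∫⁻ z in Metric.ball (0 : ℂ) R, ENNReal.ofReal (1 / 2 * ∑ l, ∑ i, ∑ j, G l z i j ^ 2)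

/-- The competitors: `Q ∈ H¹(B_R; S₀)`, `|Q|² = (2/3) s²` almost everywhere in `B_R`, and
`Q = s Q_k` on `∂B_R`. -/
structure IsAdmissible (R s : ℝ) (k : ℤ) (Q : ℂ → Matrix (Fin 3) (Fin 3) ℝ) : Prop where
  mem_S0 : ∀ᵐ z ∂(volume.restrict (Metric.ball (0 : ℂ) R)), Q z ∈ S0
  norm_eq : ∀ᵐ z ∂(volume.restrict (Metric.ball (0 : ℂ) R)), normSq (Q z) = 2 / 3 * s ^ 2
  mem_H1 : ∀ i j, MemH1 (Metric.ball 0 R) (fun z => Q z i j)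
  bdry : ∀ i j, HasTrace R (fun z => Q z i j) (fun φ => s * Qk k φ i j)

/-- `Q` is a critical point of the harmonic map problem: it is admissible, and the Dirichlet energy is
stationary along every variation `t ↦ ρ (Q + tP) / |Q + tP|`, `ρ² = (2/3) s²`, `P ∈ C_c^∞(B_R; S₀)`. -/
structure IsCriticalHarmonic (R s : ℝ) (k : ℤ) (Q : ℂ → Matrix (Fin 3) (Fin 3) ℝ) : Prop where
  admissible : IsAdmissible R s k Q
  stationary : ∀ P : ℂ → Matrix (Fin 3) (Fin 3) ℝ, (∀ z, P z ∈ S0) →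
    (∀ i j, ContDiff ℝ ∞ (fun z => P z i j)) →
    (∀ i j, HasCompactSupport (fun z => P z i j)) →
    (∀ i j, tsupport (fun z => P z i j) ⊆ Metric.ball 0 R) →
    HasDerivAt (fun t : ℝ => (dirichletEnergy R (fun z =>
      (√(2 / 3 * s ^ 2) / √(normSq (Q z + t • P z))) • (Q z + t • P z))).toReal) 0 0

/-- `Q` is the unique global minimiser of the harmonic map problem, maps which agree almost everywhere
in `B_R` being identified. -/
structure IsUniqueMinimiser (R s : ℝ) (k : ℤ) (Q : ℂ → Matrix (Fin 3) (Fin 3) ℝ) : Prop where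
  admissible : IsAdmissible R s k Q
  le : ∀ Q', IsAdmissible R s k Q' → dirichletEnergy R Q ≤ dirichletEnergy R Q'
  unique : ∀ Q', IsAdmissible R s k Q' → dirichletEnergy R Q' = dirichletEnergy R Q →
    Q' =ᵐ[volume.restrict (Metric.ball (0 : ℂ) R)] Q

end QDefect

end

open MeasureTheory Set Filter Topology
open scoped ENNReal ContDiff Matrix

noncomputable section

namespace QDefect

/-! Put ρ = √(2/3) s₊ and K = |k|. With x = lam r^K, both explicit pairs have the form u = 2ρx/(1 +
x²), v = σρ(x² - 1)/(1 + x²): σ = 1 and x(R) = 1/√3 for the minus pair, σ = -1 and x(R) = √3 for the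
plus pair. The matrices `tensorCos`, `tensorSin`, `F3` are orthonormal, and in these coordinates Y₋
and Y₊ are, up to reflections and the factor ρ, inverse stereographic projections of the holomorphic
function lam z^K. They are therefore harmonic maps into a round two-sphere, and all their entries
solve one linear equation Δf = -V f (`solvesSchrodinger_ansatz`).

Minimality. If Q and Y take values in the same sphere, then 2 Y·(Q - Y) = -|Q - Y|². With equal
boundary values, Green's identity turns the energy difference into one half of ∫ |∇(Q - Y)|² - V |Q
- Y|² (`energy_difference`). This quadratic form is nonnegative as soon as Δφ = -V φ has a positive
solution. For Y₋ the negative of its own third coordinate is one, with values between 1/2 and 1 on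
the disk (`exists_pos_solvesSchrodinger`). A small perturbation of the field ∇φ/φ makes the form
strictly coercive (`SolvesSchrodinger.stability`), so that minimality and uniqueness come together
(`dirichletEnergy_coercive`). The same identity applied to projected variations, which differ from Y
by O(t), shows that the energy changes by O(t²). This needs no positivity, and gives criticality of
both maps (`isCriticalHarmonic_of_solves`).

The one-dimensional problem. The weak Euler-Lagrange equations make the momentum W = r(uv' - vu')
regular (`exists_momentum`). In the variable log r the system for (u, v, W) is autonomous, with
first integral W² - k²ρ²u². Finite energy makes this constant integrable against dr/r, hence it is
zero, and W = ±Kρu on all of (0, R] (`hasDerivAt_of_stationary`). For each sign the remaining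
first-order system says that the stereographic coordinate u/(ρ - σv) is a multiple of r^K, and the
data at R determine the multiple (`eqOn_prof_of_system`). Conversely, along these profiles the
density of the first variation is an exact derivative (`isCriticalE0_prof`). -/

/-! ### Polar coordinates and the divergence theorem on a disk -/

lemma setIntegral_ball_eq_polar {R : ℝ} (hR : 0 < R) {F : ℂ → ℝ} (hF : Continuous F) :
    ∫ z in Metric.ball (0 : ℂ) R, F z =
      ∫ r in (0 : ℝ)..R, ∫ θ in (-Real.pi)..Real.pi,
        r * F (Complex.polarCoord.symm (r, θ)) := by
  have hsymm : Continuous fun p : ℝ × ℝ => Complex.polarCoord.symm p := by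
    simp only [Complex.polarCoord_symm_apply]; fun_prop
  have hcont : Continuous fun p : ℝ × ℝ => p.1 * F (Complex.polarCoord.symm p) := by fun_prop
  rw [← integral_indicator Metric.isOpen_ball.measurableSet,
    ← Complex.integral_comp_polarCoord_symm]
  have h1 : ∫ p in polarCoord.target, p.1 • (Metric.ball (0 : ℂ) R).indicator F
        (Complex.polarCoord.symm p)
      = ∫ p in polarCoord.target, (Ioo 0 R ×ˢ Ioo (-Real.pi) Real.pi).indicator
          (fun p : ℝ × ℝ => p.1 * F (Complex.polarCoord.symm p)) p := by
    refine setIntegral_congr_fun polarCoord.open_target.measurableSet fun p hp => ?_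
    rw [polarCoord_target] at hp
    have hp1 : (0 : ℝ) < p.1 := hp.1
    have : Complex.polarCoord.symm p ∈ Metric.ball (0 : ℂ) R ↔
        p ∈ Ioo 0 R ×ˢ Ioo (-Real.pi) Real.pi := by
      rw [mem_ball_zero_iff, Complex.norm_polarCoord_symm, abs_of_pos hp1]
      exact ⟨fun h => ⟨⟨hp1, h⟩, hp.2⟩, fun h => h.1.2⟩
    by_cases h : p ∈ Ioo 0 R ×ˢ Ioo (-Real.pi) Real.pi
    · simp only [indicator_of_mem h, indicator_of_mem (this.2 h), smul_eq_mul]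
    · simp only [indicator_of_notMem h, indicator_of_notMem (mt this.1 h), smul_zero]
  rw [h1, setIntegral_indicator (measurableSet_Ioo.prod measurableSet_Ioo),
    inter_eq_self_of_subset_right, Measure.volume_eq_prod,
    setIntegral_prod]
  · rw [intervalIntegral.integral_of_le hR.le, integral_Ioc_eq_integral_Ioo]
    refine setIntegral_congr_fun measurableSet_Ioo fun r _ => ?_
    simp only
    rw [intervalIntegral.integral_of_le (by linarith [Real.pi_pos]), integral_Ioc_eq_integral_Ioo]
  · exact (hcont.continuousOn.integrableOn_compact (isCompact_Icc.prod isCompact_Icc)).mono_set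
      (prod_mono Ioo_subset_Icc_self Ioo_subset_Icc_self)
  · rw [polarCoord_target]
    exact prod_mono Ioo_subset_Ioi_self subset_rfl

/-- The divergence theorem on a disk. -/
theorem integral_ball_divergence {R : ℝ} (hR : 0 < R) {X : Fin 2 → ℂ → ℝ}
    (hX : ∀ l, ContDiff ℝ 1 (X l)) :
    ∫ z in Metric.ball (0 : ℂ) R, ∑ l, fderiv ℝ (X l) z (dir l) =
      R * ∫ θ in (0 : ℝ)..2 * Real.pi,
        (X 0 (circleMap 0 R θ) * Real.cos θ + X 1 (circleMap 0 R θ) * Real.sin θ) := by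
  have hd : ∀ l, Continuous (fderiv ℝ (X l)) := fun l => (hX l).continuous_fderiv one_ne_zero
  have hc : ∀ l, Continuous (X l) := fun l => (hX l).continuous
  rw [setIntegral_ball_eq_polar hR (by fun_prop)]
  -- polar coordinates and the two components of the field
  set Z : ℝ × ℝ → ℂ := fun p => p.1 * (Real.cos p.2 + Real.sin p.2 * Complex.I) with hZ
  let Z' : ℝ × ℝ → ℝ × ℝ →L[ℝ] ℂ := fun p =>
    (ContinuousLinearMap.fst ℝ ℝ ℝ).smulRight ((Real.cos p.2 : ℂ) + Real.sin p.2 * Complex.I)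
    + (ContinuousLinearMap.snd ℝ ℝ ℝ).smulRight
      ((p.1 : ℂ) * (-Real.sin p.2 + Real.cos p.2 * Complex.I))
  have hZc : Continuous Z := by rw [hZ]; fun_prop
  have hZd : ∀ p, HasFDerivAt Z (Z' p) p := by
    intro p
    have h1 : HasFDerivAt (fun p : ℝ × ℝ => (p.1 : ℂ))
        (Complex.ofRealCLM.comp (ContinuousLinearMap.fst ℝ ℝ ℝ)) p :=
      Complex.ofRealCLM.hasFDerivAt.comp p hasFDerivAt_fst
    have h2 : HasFDerivAt (fun p : ℝ × ℝ => ((Real.cos p.2 : ℝ) : ℂ))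
        (Complex.ofRealCLM.comp (-Real.sin p.2 • ContinuousLinearMap.snd ℝ ℝ ℝ)) p :=
      Complex.ofRealCLM.hasFDerivAt.comp p (hasFDerivAt_snd.cos)
    have h3 : HasFDerivAt (fun p : ℝ × ℝ => ((Real.sin p.2 : ℝ) : ℂ))
        (Complex.ofRealCLM.comp (Real.cos p.2 • ContinuousLinearMap.snd ℝ ℝ ℝ)) p :=
      Complex.ofRealCLM.hasFDerivAt.comp p (hasFDerivAt_snd.sin)
    refine (h1.mul (h2.add (h3.mul_const Complex.I))).congr_fderiv ?_
    ext <;> simp [Z'] <;> ring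
  have hsplit : ∀ l p, fderiv ℝ (X l) (Z p) (Z' p (1, 0)) =
      Real.cos p.2 * fderiv ℝ (X l) (Z p) (dir 0) + Real.sin p.2 * fderiv ℝ (X l) (Z p) (dir 1) := by
    intro l p
    have : Z' p (1, 0) = Real.cos p.2 • dir 0 + Real.sin p.2 • dir 1 := by
      simp [Z', dir]
    rw [this, map_add, map_smul, map_smul]; simp
  have hsplit' : ∀ l p, fderiv ℝ (X l) (Z p) (Z' p (0, 1)) =
      p.1 * (-Real.sin p.2 * fderiv ℝ (X l) (Z p) (dir 0)
        + Real.cos p.2 * fderiv ℝ (X l) (Z p) (dir 1)) := by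
    intro l p
    have : Z' p (0, 1) = p.1 • (-Real.sin p.2 • dir 0 + Real.cos p.2 • dir 1) := by
      simp [Z', dir, mul_add]
    rw [this, map_smul, map_add, map_smul, map_smul]; simp
  have hXd : ∀ l p, HasFDerivAt (fun p => X l (Z p)) ((fderiv ℝ (X l) (Z p)).comp (Z' p)) p :=
    fun l p => (((hX l).differentiable one_ne_zero) _).hasFDerivAt.comp p (hZd p)
  have hcos : ∀ p : ℝ × ℝ, HasFDerivAt (fun p : ℝ × ℝ => Real.cos p.2)
      (-Real.sin p.2 • ContinuousLinearMap.snd ℝ ℝ ℝ) p := fun p => hasFDerivAt_snd.cos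
  have hsin : ∀ p : ℝ × ℝ, HasFDerivAt (fun p : ℝ × ℝ => Real.sin p.2)
      (Real.cos p.2 • ContinuousLinearMap.snd ℝ ℝ ℝ) p := fun p => hasFDerivAt_snd.sin
  -- The fields are r X_r and X_θ. Of their derivatives only one partial each enters the divergence,
  -- so the rest is hidden behind an existential.
  obtain ⟨f', hf', hf1⟩ : ∃ f' : ℝ × ℝ → ℝ × ℝ →L[ℝ] ℝ, (∀ p, HasFDerivAt (fun p : ℝ × ℝ =>
      p.1 * (X 0 (Z p) * Real.cos p.2 + X 1 (Z p) * Real.sin p.2)) (f' p) p) ∧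
      ∀ p, f' p (1, 0) = X 0 (Z p) * Real.cos p.2 + X 1 (Z p) * Real.sin p.2 + p.1 *
        (Real.cos p.2 * fderiv ℝ (X 0) (Z p) (Z' p (1, 0)) +
          Real.sin p.2 * fderiv ℝ (X 1) (Z p) (Z' p (1, 0))) :=
    ⟨_, fun p => hasFDerivAt_fst.mul (((hXd 0 p).mul (hcos p)).add ((hXd 1 p).mul (hsin p))),
      fun p => by simp; ring⟩
  obtain ⟨g', hg', hg1⟩ : ∃ g' : ℝ × ℝ → ℝ × ℝ →L[ℝ] ℝ, (∀ p, HasFDerivAt (fun p : ℝ × ℝ =>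
      X 1 (Z p) * Real.cos p.2 - X 0 (Z p) * Real.sin p.2) (g' p) p) ∧
      ∀ p, g' p (0, 1) = -(X 0 (Z p) * Real.cos p.2 + X 1 (Z p) * Real.sin p.2) +
        (Real.cos p.2 * fderiv ℝ (X 1) (Z p) (Z' p (0, 1)) -
          Real.sin p.2 * fderiv ℝ (X 0) (Z p) (Z' p (0, 1))) :=
    ⟨_, fun p => ((hXd 1 p).mul (hcos p)).sub ((hXd 0 p).mul (hsin p)),
      fun p => by simp; ring⟩
  -- In polar coordinates r div X = ∂_r(r X_r) + ∂_θ X_θ, which is a divergence on the rectangle [0,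
  -- R] × [-π, π]. The side r = 0 contributes nothing because of the factor r, and the sides θ = ±π
  -- cancel by periodicity.
  have key := integral2_divergence_prod_of_hasFDerivAt
    (fun p => p.1 * (X 0 (Z p) * Real.cos p.2 + X 1 (Z p) * Real.sin p.2))
    (fun p => X 1 (Z p) * Real.cos p.2 - X 0 (Z p) * Real.sin p.2) f' g' 0 (-Real.pi) R Real.pi
    (by fun_prop) (by fun_prop) (fun p _ => hf' p) (fun p _ => hg' p)
  have hdiv : ∀ p : ℝ × ℝ, f' p (1, 0) + g' p (0, 1)
      = p.1 * ∑ l, fderiv ℝ (X l) (Z p) (dir l) := by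
    intro p
    simp only [hf1, hg1, hsplit, hsplit', Fin.sum_univ_two]
    linear_combination p.1 * (fderiv ℝ (X 0) (Z p) (dir 0) + fderiv ℝ (X 1) (Z p) (dir 1))
      * Real.sin_sq_add_cos_sq p.2
  simp only [hdiv] at key
  have hZeq : ∀ r θ : ℝ, Complex.polarCoord.symm (r, θ) = Z (r, θ) := fun r θ => by
    rw [Complex.polarCoord_symm_apply]
  simp only [hZeq]
  rw [key (Continuous.continuousOn (by fun_prop) |>.integrableOn_compact
    (isCompact_uIcc.prod isCompact_uIcc))]
  have hcirc : ∀ θ : ℝ, Z (R, θ) = circleMap 0 R θ := fun θ => by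
    simp [hZ, circleMap, Complex.exp_mul_I]
  have hper : ∀ r : ℝ, Z (r, -Real.pi) = Z (r, Real.pi) := fun r => by simp [hZ]
  simp only [hper, Real.cos_neg, Real.sin_neg, Real.sin_pi, hcirc, zero_mul, neg_zero,
    intervalIntegral.integral_const_mul, sub_self, zero_add, intervalIntegral.integral_zero, sub_zero]
  congr 1
  have hp : Function.Periodic (fun θ : ℝ => X 0 (circleMap 0 R θ) * Real.cos θ
      + X 1 (circleMap 0 R θ) * Real.sin θ) (2 * Real.pi) := fun θ => by
    simp only [periodic_circleMap 0 R θ, Real.cos_add_two_pi, Real.sin_add_two_pi]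
  have := hp.intervalIntegral_add_eq (-Real.pi) 0
  rw [zero_add, show -Real.pi + 2 * Real.pi = Real.pi by ring] at this
  exact this

/-! ### Weak gradients, the Dirichlet energy and limits in L² -/

lemma setIntegral_mul_eq_integral_of_tsupport_subset {E : Type*} [TopologicalSpace E]
    [MeasurableSpace E] {μ : Measure E} {Ω : Set E} {f θ : E → ℝ} (hθ : tsupport θ ⊆ Ω) :
    ∫ z in Ω, f z * θ z ∂μ = ∫ z, f z * θ z ∂μ :=
  setIntegral_eq_integral_of_forall_compl_eq_zero fun z hz => by
    rw [image_eq_zero_of_notMem_tsupport fun h => hz (hθ h), mul_zero]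

lemma integrable_mul_of_tsupport_subset {E : Type*} [TopologicalSpace E] [T2Space E]
    [MeasurableSpace E] [OpensMeasurableSpace E] {μ : Measure E} {Ω : Set E}
    {f θ : E → ℝ} (hf : LocallyIntegrableOn f Ω μ) (hc : Continuous θ) (hs : HasCompactSupport θ)
    (hθ : tsupport θ ⊆ Ω) : Integrable (fun z => f z * θ z) μ := by
  have h1 : IntegrableOn (fun z => f z * θ z) (tsupport θ) μ :=
    (hf.integrableOn_compact_subset hθ hs).mul_continuousOn hc.continuousOn hs
  refine (integrableOn_iff_integrable_of_support_subset ?_).1 h1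
  exact (Function.support_mul_subset_right f θ).trans subset_closure

/-- The difference of two weak gradients integrates to zero against every test function, so the
fundamental lemma of the calculus of variations applies. Consequently any single weak gradient
computes the infimum in `dirichletEnergy`. -/
lemma HasWeakGradient.ae_eq {Ω : Set ℂ} (hΩ : IsOpen Ω) {q : ℂ → ℝ} {p p' : Fin 2 → ℂ → ℝ}
    (h : HasWeakGradient Ω q p) (h' : HasWeakGradient Ω q p') (l : Fin 2) :
    p l =ᵐ[volume.restrict Ω] p' l := by
  have key := hΩ.ae_eq_zero_of_integral_contDiff_smul_eq_zero (μ := volume)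
    ((h.2.1 l).sub (h'.2.1 l)) fun g hg hgc hgs => by
      have e := (h.2.2 g hg hgc hgs l).symm.trans (h'.2.2 g hg hgc hgs l)
      rw [setIntegral_mul_eq_integral_of_tsupport_subset hgs,
        setIntegral_mul_eq_integral_of_tsupport_subset hgs, neg_inj] at e
      simp only [Pi.sub_apply, smul_eq_mul, mul_sub]
      simp only [mul_comm (g _)]
      rw [integral_sub (integrable_mul_of_tsupport_subset (h.2.1 l) hg.continuous hgc hgs)
        (integrable_mul_of_tsupport_subset (h'.2.1 l) hg.continuous hgc hgs), e, sub_self]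
  refine (ae_restrict_iff' hΩ.measurableSet).2 ?_
  filter_upwards [key] with z hz hzΩ
  exact sub_eq_zero.1 (hz hzΩ)

lemma hasWeakGradient_of_contDiff {Ω : Set ℂ} {f : ℂ → ℝ} (hf : ContDiff ℝ ∞ f) :
    HasWeakGradient Ω f (fun l z => fderiv ℝ f z (dir l)) := by
  have hd : ∀ l, Continuous fun z => fderiv ℝ f z (dir l) := fun l =>
    (hf.continuous_fderiv (by simp)).clm_apply continuous_const
  refine ⟨hf.continuous.locallyIntegrable.locallyIntegrableOn _,
    fun l => (hd l).locallyIntegrable.locallyIntegrableOn _, fun θ hθ hc hs l => ?_⟩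
  have hθd : Continuous fun z => fderiv ℝ θ z (dir l) :=
    (hθ.continuous_fderiv (by simp)).clm_apply continuous_const
  have hθs : HasCompactSupport fun z => fderiv ℝ θ z (dir l) := hc.fderiv_apply ℝ (dir l)
  have hss : tsupport (fun z => fderiv ℝ θ z (dir l)) ⊆ Ω :=
    (tsupport_fderiv_apply_subset ℝ (dir l)).trans hs
  rw [setIntegral_mul_eq_integral_of_tsupport_subset hss,
    setIntegral_mul_eq_integral_of_tsupport_subset hs]
  exact integral_mul_fderiv_eq_neg_fderiv_mul_of_integrable
    (((hd l).mul hθ.continuous).integrable_of_hasCompactSupport hc.mul_left)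
    ((hf.continuous.mul hθd).integrable_of_hasCompactSupport hθs.mul_left)
    ((hf.continuous.mul hθ.continuous).integrable_of_hasCompactSupport hc.mul_left)
    (fun z _ => hf.differentiable (by simp) z) (fun z _ => hθ.differentiable (by simp) z)

lemma dirichletEnergy_eq_lintegral {R : ℝ} {Q : ℂ → Matrix (Fin 3) (Fin 3) ℝ}
    {G : Fin 2 → ℂ → Matrix (Fin 3) (Fin 3) ℝ}
    (hG : ∀ i j, HasWeakGradient (Metric.ball 0 R) (fun z => Q z i j) (fun l z => G l z i j)) :
    dirichletEnergy R Q = ∫⁻ z in Metric.ball (0 : ℂ) R,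
      ENNReal.ofReal (1 / 2 * ∑ l, ∑ i, ∑ j, G l z i j ^ 2) := by
  refine le_antisymm (iInf₂_le G hG) (le_iInf₂ fun G' hG' => le_of_eq ?_)
  refine lintegral_congr_ae ?_
  have : ∀ l i j, ∀ᵐ z ∂(volume.restrict (Metric.ball (0 : ℂ) R)), G l z i j = G' l z i j :=
    fun l i j => (hG i j).ae_eq Metric.isOpen_ball (hG' i j) l
  simp only [← ae_all_iff] at this
  filter_upwards [this] with z hz
  simp only [hz]

lemma dirichletEnergy_eq_ofReal {R : ℝ} {Q : ℂ → Matrix (Fin 3) (Fin 3) ℝ}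
    {G : Fin 2 → ℂ → Matrix (Fin 3) (Fin 3) ℝ}
    (hG : ∀ i j, HasWeakGradient (Metric.ball 0 R) (fun z => Q z i j) (fun l z => G l z i j))
    (hG2 : ∀ l i j, MemLp (fun z => G l z i j) 2 (volume.restrict (Metric.ball 0 R))) :
    dirichletEnergy R Q = ENNReal.ofReal (1 / 2 * ∑ i, ∑ j, ∑ l,
      ∫ z in Metric.ball (0 : ℂ) R, G l z i j ^ 2) := by
  have hI : ∀ l i j, Integrable (fun z => G l z i j ^ 2) (volume.restrict (Metric.ball 0 R)) :=
    fun l i j => (hG2 l i j).integrable_sq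
  rw [dirichletEnergy_eq_lintegral hG, ← ofReal_integral_eq_lintegral_ofReal]
  · rw [integral_const_mul, integral_finsetSum _ fun l _ => integrable_finsetSum _ fun i _ =>
      integrable_finsetSum _ fun j _ => hI l i j]
    simp_rw [integral_finsetSum _ fun i _ => integrable_finsetSum _ fun j _ => hI _ i j]
    simp_rw [integral_finsetSum _ fun j _ => hI _ _ j]
    rw [Finset.sum_comm]
    simp_rw [Finset.sum_comm (s := (Finset.univ : Finset (Fin 2)))]
  · exact (integrable_finsetSum _ fun l _ => integrable_finsetSum _ fun i _ =>
      integrable_finsetSum _ fun j _ => hI l i j).const_mul _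
  · exact Eventually.of_forall fun z => by positivity

lemma _root_.Continuous.memLp_two_ball {R : ℝ} {f : ℂ → ℝ} (hf : Continuous f) :
    MemLp f 2 (volume.restrict (Metric.ball (0 : ℂ) R)) := by
  have : IsFiniteMeasure (volume.restrict (Metric.ball (0 : ℂ) R)) :=
    ⟨by rw [Measure.restrict_apply_univ]; exact measure_ball_lt_top⟩
  obtain ⟨C, hC⟩ := (isCompact_closedBall (0 : ℂ) R).exists_bound_of_continuousOn hf.continuousOn
  exact MemLp.of_bound hf.aestronglyMeasurable C
    ((ae_restrict_iff' Metric.isOpen_ball.measurableSet).2 (Eventually.of_forall fun z hz =>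
      hC z (Metric.ball_subset_closedBall hz)))

/-- Continuity of the inner product of L². It carries Green's identity and the stability inequality
from smooth approximations to H¹ competitors. -/
lemma tendsto_integral_mul_of_tendsto_eLpNorm {α : Type*} [MeasurableSpace α] {μ : Measure α}
    {f g : ℕ → α → ℝ} {f₀ g₀ : α → ℝ} (hf : ∀ m, MemLp (f m) 2 μ) (hg : ∀ m, MemLp (g m) 2 μ)
    (hf₀ : MemLp f₀ 2 μ) (hg₀ : MemLp g₀ 2 μ)
    (hff : Tendsto (fun m => eLpNorm (fun z => f m z - f₀ z) 2 μ) atTop (𝓝 0))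
    (hgg : Tendsto (fun m => eLpNorm (fun z => g m z - g₀ z) 2 μ) atTop (𝓝 0)) :
    Tendsto (fun m => ∫ z, f m z * g m z ∂μ) atTop (𝓝 (∫ z, f₀ z * g₀ z ∂μ)) := by
  have h1 : Tendsto (fun m => (hf m).toLp (f m)) atTop (𝓝 (hf₀.toLp f₀)) :=
    (Lp.tendsto_Lp_iff_tendsto_eLpNorm'' f hf f₀ hf₀).2 hff
  have h2 : Tendsto (fun m => (hg m).toLp (g m)) atTop (𝓝 (hg₀.toLp g₀)) :=
    (Lp.tendsto_Lp_iff_tendsto_eLpNorm'' g hg g₀ hg₀).2 hgg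
  have h3 := h1.inner (𝕜 := ℝ) h2
  have e : ∀ {a b : α → ℝ} (ha : MemLp a 2 μ) (hb : MemLp b 2 μ),
      inner ℝ (ha.toLp a) (hb.toLp b) = ∫ z, a z * b z ∂μ := fun {a b} ha hb => by
    rw [L2.inner_def]
    refine integral_congr_ae ?_
    filter_upwards [ha.coeFn_toLp, hb.coeFn_toLp] with z hz hz'
    rw [hz, hz']; simp [mul_comm]
  simpa only [e] using h3

lemma tendsto_eLpNorm_mul_of_bound {α : Type*} [MeasurableSpace α] {μ : Measure α}
    {f : ℕ → α → ℝ} {f₀ h : α → ℝ} {C : ℝ} (hC : ∀ᵐ z ∂μ, |h z| ≤ C)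
    (hff : Tendsto (fun m => eLpNorm (fun z => f m z - f₀ z) 2 μ) atTop (𝓝 0)) :
    Tendsto (fun m => eLpNorm (fun z => h z * f m z - h z * f₀ z) 2 μ) atTop (𝓝 0) := by
  have h0 : Tendsto (fun m => ENNReal.ofReal C * eLpNorm (fun z => f m z - f₀ z) 2 μ) atTop (𝓝 0) := by
    simpa using ENNReal.Tendsto.const_mul (a := ENNReal.ofReal C) hff (Or.inr ENNReal.ofReal_ne_top)
  refine tendsto_of_tendsto_of_tendsto_of_le_of_le tendsto_const_nhds h0 (fun _ => zero_le) fun m => ?_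
  refine eLpNorm_le_mul_eLpNorm_of_ae_le_mul ?_ 2
  filter_upwards [hC] with z hz
  rw [← mul_sub, norm_mul]
  exact mul_le_mul_of_nonneg_right hz (norm_nonneg _)

/-! ### The equation Δf = -V f: Green's identity and strict stability -/

/-- `f` is smooth and solves `Δ f = - V f` on `Ω`. -/
structure SolvesSchrodinger (Ω : Set ℂ) (V f : ℂ → ℝ) : Prop where
  contDiff : ContDiff ℝ ∞ f
  eqn : ∀ z ∈ Ω, ∑ l, fderiv ℝ (fun w => fderiv ℝ f w (dir l)) z (dir l) = -(V z * f z)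

lemma contDiff_fderiv_dir {f : ℂ → ℝ} (hf : ContDiff ℝ ∞ f) (l : Fin 2) :
    ContDiff ℝ ∞ fun z => fderiv ℝ f z (dir l) :=
  (hf.fderiv_right (m := ∞) (by simp)).clm_apply contDiff_const

lemma integrableOn_ball_of_continuous {R : ℝ} {f : ℂ → ℝ} (hf : Continuous f) :
    Integrable f (volume.restrict (Metric.ball (0 : ℂ) R)) :=
  (hf.continuousOn.integrableOn_compact (isCompact_closedBall (0 : ℂ) R)).mono_set
    Metric.ball_subset_closedBall

/-- Green's identity on a disk. -/
lemma SolvesSchrodinger.integral_fderiv_mul {R : ℝ} (hR : 0 < R) {V Y g : ℂ → ℝ}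
    (hV : Continuous V) (hY : SolvesSchrodinger (Metric.ball 0 R) V Y) (hg : ContDiff ℝ ∞ g) :
    ∫ z in Metric.ball (0 : ℂ) R, ∑ l, fderiv ℝ Y z (dir l) * fderiv ℝ g z (dir l) =
      (∫ z in Metric.ball (0 : ℂ) R, V z * Y z * g z) + R * ∫ θ in (0 : ℝ)..2 * Real.pi,
        (fderiv ℝ Y (circleMap 0 R θ) (dir 0) * Real.cos θ +
          fderiv ℝ Y (circleMap 0 R θ) (dir 1) * Real.sin θ) * g (circleMap 0 R θ) := by
  have hYl := contDiff_fderiv_dir hY.contDiff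
  have hgl := contDiff_fderiv_dir hg
  have key := integral_ball_divergence hR (X := fun l z => fderiv ℝ Y z (dir l) * g z)
    fun l => ((hYl l).mul hg).of_le (by simp)
  have hd : ∀ z ∈ Metric.ball (0 : ℂ) R,
      ∑ l, fderiv ℝ (fun z => fderiv ℝ Y z (dir l) * g z) z (dir l) =
        ∑ l, fderiv ℝ Y z (dir l) * fderiv ℝ g z (dir l) - V z * Y z * g z := by
    intro z hz
    have : ∀ l, fderiv ℝ (fun z => fderiv ℝ Y z (dir l) * g z) z (dir l) =
        fderiv ℝ Y z (dir l) * fderiv ℝ g z (dir l) +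
          g z * fderiv ℝ (fun w => fderiv ℝ Y w (dir l)) z (dir l) := fun l => by
      rw [fderiv_fun_mul ((hYl l).differentiable (by simp) z) (hg.differentiable (by simp) z)]
      simp
    simp only [this, Finset.sum_add_distrib, ← Finset.mul_sum, hY.eqn z hz]
    ring
  rw [setIntegral_congr_fun Metric.isOpen_ball.measurableSet hd, integral_sub] at key
  · rw [sub_eq_iff_eq_add'.1 key]
    congr 3; ext θ; ring
  · have hc1 := fun l => (hYl l).continuous
    have hc2 := fun l => (hgl l).continuous
    exact integrableOn_ball_of_continuous (by fun_prop)
  · exact integrableOn_ball_of_continuous ((hV.mul hY.contDiff.continuous).mul hg.continuous)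

lemma _root_.HasFDerivAt.real_div {E : Type*} [NormedAddCommGroup E] [NormedSpace ℝ E]
    {f g : E → ℝ} {f' g' : E →L[ℝ] ℝ} {x : E} (hf : HasFDerivAt f f' x) (hg : HasFDerivAt g g' x)
    (h : g x ≠ 0) :
    HasFDerivAt (fun y => f y / g y) ((g x)⁻¹ • f' - (f x / g x ^ 2) • g') x := by
  have h1 : HasFDerivAt (fun y => (g y)⁻¹) _ x := (hasDerivAt_inv h).comp_hasFDerivAt x hg
  simp only [div_eq_mul_inv]
  refine (hf.mul h1).congr_fderiv ?_
  ext v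
  simp
  ring

/-- The coordinates of the plane. -/
def coord : Fin 2 → ℂ →L[ℝ] ℝ := ![Complex.reCLM, Complex.imCLM]

lemma coord_dir (l : Fin 2) : coord l (dir l) = 1 := by
  fin_cases l <;> simp [coord, dir]

lemma sum_coord_sq (z : ℂ) : ∑ l, coord l z ^ 2 = ‖z‖ ^ 2 := by
  rw [← Complex.normSq_eq_norm_sq, Complex.normSq_apply]
  simp [coord, sq]

/-- The vector field `∇φ / φ - δ x / φ²`. -/
def stabilityField (δ : ℝ) (φ : ℂ → ℝ) (l : Fin 2) (z : ℂ) : ℝ :=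
  fderiv ℝ φ z (dir l) / φ z - δ * coord l z / φ z ^ 2

lemma contDiff_stabilityField {φ : ℂ → ℝ} (hφ : ContDiff ℝ ∞ φ) (hpos : ∀ z, 0 < φ z) (δ : ℝ)
    (l : Fin 2) : ContDiff ℝ ∞ (stabilityField δ φ l) :=
  ((contDiff_fderiv_dir hφ l).div hφ fun z => (hpos z).ne').sub
    ((contDiff_const.mul (coord l).contDiff).div (hφ.pow 2) fun z => pow_ne_zero 2 (hpos z).ne')

/-- Write X for the field. Summing over l and adding |X|², the terms in |∇φ|² and in x·∇φ cancel;
this is why the correction carries the power φ⁻². If Δφ = -V φ, what remains is div X + |X|² = -V -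
2δ/φ² + δ²|x|²/φ⁴. -/
lemma fderiv_stabilityField {φ : ℂ → ℝ} (hφ : ContDiff ℝ ∞ φ) (hpos : ∀ z, 0 < φ z) (δ : ℝ)
    (l : Fin 2) (z : ℂ) : fderiv ℝ (stabilityField δ φ l) z (dir l) =
      fderiv ℝ (fun w => fderiv ℝ φ w (dir l)) z (dir l) / φ z
        - fderiv ℝ φ z (dir l) ^ 2 / φ z ^ 2 - δ / φ z ^ 2
        + 2 * δ * (coord l z * fderiv ℝ φ z (dir l)) / φ z ^ 3 := by
  have h0 := (hpos z).ne'
  have h1 : HasFDerivAt (fun w => fderiv ℝ φ w (dir l))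
      (fderiv ℝ (fun w => fderiv ℝ φ w (dir l)) z) z :=
    ((contDiff_fderiv_dir hφ l).differentiable (by simp) z).hasFDerivAt
  have h2 : HasFDerivAt φ (fderiv ℝ φ z) z := (hφ.differentiable (by simp) z).hasFDerivAt
  have h3 := (h1.real_div h2 h0).sub ((((coord l).hasFDerivAt (x := z)).const_mul δ).real_div
    (h2.pow 2) (pow_ne_zero 2 h0))
  have h4 : fderiv ℝ (stabilityField δ φ l) z = _ := h3.fderiv
  rw [h4]
  simp [coord_dir]
  field_simp
  ring

/-- Strict stability: a positive solution of `Δφ = - V φ` makes the quadratic form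
`∫ |∇g|² - V g²` coercive, up to boundary terms. -/
lemma SolvesSchrodinger.stability {R : ℝ} (hR : 0 < R) {V φ g : ℂ → ℝ}
    (hV : Continuous V) (hφ : SolvesSchrodinger (Metric.ball 0 R) V φ) (hpos : ∀ z, 0 < φ z)
    (hb : ∀ z ∈ Metric.ball (0 : ℂ) R, 1 / 2 ≤ φ z ∧ φ z ≤ 1) (hg : ContDiff ℝ ∞ g) :
    1 / (4 * R ^ 2) * (∫ z in Metric.ball (0 : ℂ) R, g z ^ 2) + R * ∫ θ in (0 : ℝ)..2 * Real.pi,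
        (stabilityField (1 / (4 * R ^ 2)) φ 0 (circleMap 0 R θ) * Real.cos θ +
          stabilityField (1 / (4 * R ^ 2)) φ 1 (circleMap 0 R θ) * Real.sin θ)
            * g (circleMap 0 R θ) ^ 2 ≤
      (∑ l, ∫ z in Metric.ball (0 : ℂ) R, fderiv ℝ g z (dir l) ^ 2) -
        ∫ z in Metric.ball (0 : ℂ) R, V z * g z ^ 2 := by
  set δ : ℝ := 1 / (4 * R ^ 2) with hδ
  have hδ0 : 0 < δ := by positivity
  have hΨ := contDiff_stabilityField hφ.contDiff hpos δ
  have hgl := contDiff_fderiv_dir hg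
  have hc2 := fun l => (hgl l).continuous
  have hgc := hg.continuous
  have key := integral_ball_divergence hR (X := fun l z => stabilityField δ φ l z * g z ^ 2)
    fun l => ((hΨ l).mul (hg.pow 2)).of_le (by simp)
  have hcd : Continuous fun z =>
      ∑ l, fderiv ℝ (fun z => stabilityField δ φ l z * g z ^ 2) z (dir l) := by
    have := fun l => (contDiff_fderiv_dir ((hΨ l).mul (hg.pow 2)) l).continuous
    fun_prop
  have hle : ∫ z in Metric.ball (0 : ℂ) R,
      ∑ l, fderiv ℝ (fun z => stabilityField δ φ l z * g z ^ 2) z (dir l) ≤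
      ∫ z in Metric.ball (0 : ℂ) R,
        ((∑ l, fderiv ℝ g z (dir l) ^ 2) - V z * g z ^ 2 - δ * g z ^ 2) := by
    refine setIntegral_mono_on (integrableOn_ball_of_continuous hcd)
      (integrableOn_ball_of_continuous (by fun_prop)) Metric.isOpen_ball.measurableSet
      fun z hz => ?_
    have h1 : ∀ l, fderiv ℝ (fun z => stabilityField δ φ l z * g z ^ 2) z (dir l) =
        stabilityField δ φ l z * (2 * g z * fderiv ℝ g z (dir l)) +
          g z ^ 2 * fderiv ℝ (stabilityField δ φ l) z (dir l) := fun l => by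
      have := (((hΨ l).differentiable (by simp) z).hasFDerivAt.mul
        ((hg.differentiable (by simp) z).hasFDerivAt.pow 2)).fderiv
      rw [show (fun z => stabilityField δ φ l z * g z ^ 2)
        = (stabilityField δ φ l * fun z => g z ^ 2) from rfl, this]
      simp
    simp only [h1, fderiv_stabilityField hφ.contDiff hpos]
    have he := hφ.eqn z hz
    have hx := sum_coord_sq z
    have hzR : ‖z‖ ^ 2 ≤ R ^ 2 := by
      have := mem_ball_zero_iff.1 hz
      gcongr
    simp only [Fin.sum_univ_two, stabilityField] at he hx ⊢
    generalize fderiv ℝ (fun w => fderiv ℝ φ w (dir 0)) z (dir 0) = s0 at *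
    generalize fderiv ℝ (fun w => fderiv ℝ φ w (dir 1)) z (dir 1) = s1 at *
    generalize fderiv ℝ φ z (dir 0) = a0 at *
    generalize fderiv ℝ φ z (dir 1) = a1 at *
    generalize fderiv ℝ g z (dir 0) = g0 at *
    generalize fderiv ℝ g z (dir 1) = g1 at *
    generalize coord 0 z = x0 at *
    generalize coord 1 z = x1 at *
    obtain ⟨hb1, hb2⟩ := hb z hz
    have hp := hpos z
    generalize φ z = f at *
    have hs : s0 = -(V z * f) - s1 := by linarith
    -- The choice δ = 1/(4R²) gives δ|x|² ≤ 1/4 ≤ φ², so the quadratic term in δ absorbs at most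
    -- half of 2δ/φ². Since φ ≤ 1, the other half is at least δ.
    have h2 : δ ^ 2 * (x0 ^ 2 + x1 ^ 2) / f ^ 4 ≤ δ / f ^ 2 := by
      rw [div_le_div_iff₀ (by positivity) (by positivity)]
      have : δ * (x0 ^ 2 + x1 ^ 2) ≤ f ^ 2 := by
        calc δ * (x0 ^ 2 + x1 ^ 2) ≤ δ * R ^ 2 := by rw [hx]; gcongr
          _ = (1 / 2) ^ 2 := by rw [hδ]; field_simp; norm_num
          _ ≤ f ^ 2 := by gcongr
      nlinarith [mul_le_mul_of_nonneg_left this (by positivity : 0 ≤ δ * f ^ 2)]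
    have h3 : δ ≤ δ / f ^ 2 := by
      rw [le_div_iff₀ (by positivity)]
      nlinarith [mul_le_mul_of_nonneg_left (pow_le_one₀ hp.le hb2 : f ^ 2 ≤ 1) hδ0.le]
    have h4 : 0 ≤ g z ^ 2 * (2 * (δ / f ^ 2) - δ ^ 2 * (x0 ^ 2 + x1 ^ 2) / f ^ 4 - δ) :=
      mul_nonneg (sq_nonneg _) (by linarith)
    have h5 := sq_nonneg (g0 - g z * (a0 / f - δ * x0 / f ^ 2))
    have h6 := sq_nonneg (g1 - g z * (a1 / f - δ * x1 / f ^ 2))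
    -- Completing the square: |∇g|² - V g² - div(g² X) = |∇g - gX|² + g² (2δ/φ² - δ²|x|²/φ⁴), where
    -- X is the stability field.
    have h7 : g0 ^ 2 + g1 ^ 2 - V z * g z ^ 2 - δ * g z ^ 2 -
      ((a0 / f - δ * x0 / f ^ 2) * (2 * g z * g0) +
          g z ^ 2 * (s0 / f - a0 ^ 2 / f ^ 2 - δ / f ^ 2 + 2 * δ * (x0 * a0) / f ^ 3) +
        ((a1 / f - δ * x1 / f ^ 2) * (2 * g z * g1) +
          g z ^ 2 * (s1 / f - a1 ^ 2 / f ^ 2 - δ / f ^ 2 + 2 * δ * (x1 * a1) / f ^ 3))) =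
      (g0 - g z * (a0 / f - δ * x0 / f ^ 2)) ^ 2 + (g1 - g z * (a1 / f - δ * x1 / f ^ 2)) ^ 2
      + g z ^ 2 * (2 * (δ / f ^ 2) - δ ^ 2 * (x0 ^ 2 + x1 ^ 2) / f ^ 4 - δ) := by
      rw [hs]; field_simp; ring
    linarith
  rw [key, integral_sub, integral_sub, integral_finsetSum, integral_const_mul] at hle
  · have e : ∀ θ : ℝ, stabilityField δ φ 0 (circleMap 0 R θ) * g (circleMap 0 R θ) ^ 2 * Real.cos θ
        + stabilityField δ φ 1 (circleMap 0 R θ) * g (circleMap 0 R θ) ^ 2 * Real.sin θ =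
        (stabilityField δ φ 0 (circleMap 0 R θ) * Real.cos θ +
          stabilityField δ φ 1 (circleMap 0 R θ) * Real.sin θ) * g (circleMap 0 R θ) ^ 2 :=
      fun θ => by ring
    simp only [e] at hle
    linarith
  all_goals first
    | exact integrableOn_ball_of_continuous (by fun_prop)
    | exact fun l _ => integrableOn_ball_of_continuous (by fun_prop)

lemma _root_.Continuous.memLp_two_Ioo {a b : ℝ} {f : ℝ → ℝ} (hf : Continuous f) :
    MemLp f 2 (volume.restrict (Ioo a b)) := by
  obtain ⟨C, hC⟩ := (isCompact_Icc (a := a) (b := b)).exists_bound_of_continuousOn hf.continuousOn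
  exact MemLp.of_bound hf.aestronglyMeasurable C
    ((ae_restrict_iff' measurableSet_Ioo).2 (Eventually.of_forall fun z hz =>
      hC z (Ioo_subset_Icc_self hz)))

lemma ae_ball_abs_le_of_continuous {R : ℝ} {f : ℂ → ℝ} (hf : Continuous f) :
    ∃ C, ∀ᵐ z ∂(volume.restrict (Metric.ball (0 : ℂ) R)), |f z| ≤ C := by
  obtain ⟨C, hC⟩ := (isCompact_closedBall (0 : ℂ) R).exists_bound_of_continuousOn hf.continuousOn
  exact ⟨C, (ae_restrict_iff' Metric.isOpen_ball.measurableSet).2 (Eventually.of_forall fun z hz =>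
      hC z (Metric.ball_subset_closedBall hz))⟩

lemma memLp_of_tendsto_eLpNorm {α : Type*} [MeasurableSpace α] {μ : Measure α}
    {f : ℕ → α → ℝ} {f₀ : α → ℝ} (hf : ∀ m, MemLp (f m) 2 μ) (hf₀ : AEStronglyMeasurable f₀ μ)
    (hff : Tendsto (fun m => eLpNorm (fun z => f m z - f₀ z) 2 μ) atTop (𝓝 0)) :
    MemLp f₀ 2 μ := by
  obtain ⟨m, hm⟩ := ((tendsto_order.1 hff).2 1 one_pos).exists
  have h1 : MemLp (fun z => f m z - f₀ z) 2 μ :=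
    ⟨(hf m).1.sub hf₀, hm.trans ENNReal.one_lt_top⟩
  refine ((hf m).sub h1).ae_eq (Eventually.of_forall fun z => ?_)
  simp

lemma tendsto_integral_circle {R : ℝ} {w : ℝ → ℝ} (hw : Continuous w)
    {g : ℕ → ℂ → ℝ} (hg : ∀ m, Continuous (g m))
    (hgt : Tendsto (fun m => eLpNorm (fun θ : ℝ => g m (circleMap 0 R θ)) 2
        (volume.restrict (Ioo 0 (2 * Real.pi)))) atTop (𝓝 0)) :
    Tendsto (fun m => ∫ θ in (0 : ℝ)..2 * Real.pi, w θ * g m (circleMap 0 R θ)) atTop (𝓝 0) ∧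
    Tendsto (fun m => ∫ θ in (0 : ℝ)..2 * Real.pi, w θ * g m (circleMap 0 R θ) ^ 2)
      atTop (𝓝 0) := by
  have hpi : (0 : ℝ) ≤ 2 * Real.pi := by positivity
  simp only [intervalIntegral.integral_of_le hpi, integral_Ioc_eq_integral_Ioo]
  have hgc : ∀ m, Continuous fun θ : ℝ => g m (circleMap 0 R θ) := fun m =>
    (hg m).comp (continuous_circleMap 0 R)
  have ht : Tendsto (fun m => eLpNorm (fun θ : ℝ => g m (circleMap 0 R θ) - (fun _ => (0 : ℝ)) θ) 2
        (volume.restrict (Ioo 0 (2 * Real.pi)))) atTop (𝓝 0) := by simpa using hgt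
  have hc : Tendsto (fun _ : ℕ => eLpNorm (fun θ : ℝ => w θ - w θ) 2
        (volume.restrict (Ioo 0 (2 * Real.pi)))) atTop (𝓝 0) := by simp
  obtain ⟨C, hC⟩ := (isCompact_Icc (a := 0) (b := 2 * Real.pi)).exists_bound_of_continuousOn
    hw.continuousOn
  have hC' : ∀ᵐ θ ∂(volume.restrict (Ioo 0 (2 * Real.pi))), |w θ| ≤ C :=
    (ae_restrict_iff' measurableSet_Ioo).2 (Eventually.of_forall fun z hz =>
      hC z (Ioo_subset_Icc_self hz))
  constructor
  · simpa using tendsto_integral_mul_of_tendsto_eLpNorm (fun _ => hw.memLp_two_Ioo)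
      (fun m => (hgc m).memLp_two_Ioo) hw.memLp_two_Ioo (MemLp.zero' (p := 2)) hc ht
  · have := tendsto_integral_mul_of_tendsto_eLpNorm (fun m => (hw.mul (hgc m)).memLp_two_Ioo)
      (fun m => (hgc m).memLp_two_Ioo) (by simp)
      (MemLp.zero' (p := 2)) (tendsto_eLpNorm_mul_of_bound hC' ht) ht
    simpa [sq, mul_assoc] using this

/-- Green's identity and coercivity for `q - Y`, where `q ∈ H¹` has the same trace as the smooth
solution `Y`. -/
lemma exists_weakGradient_of_hasTrace {R : ℝ} (hR : 0 < R) {V φ Y q : ℂ → ℝ} {γ : ℝ → ℝ}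
    (hV : Continuous V) (hφ : SolvesSchrodinger (Metric.ball 0 R) V φ) (hpos : ∀ z, 0 < φ z)
    (hb : ∀ z ∈ Metric.ball (0 : ℂ) R, 1 / 2 ≤ φ z ∧ φ z ≤ 1)
    (hY : SolvesSchrodinger (Metric.ball 0 R) V Y) (hYγ : ∀ θ, Y (circleMap 0 R θ) = γ θ)
    (hq : MemLp q 2 (volume.restrict (Metric.ball (0 : ℂ) R))) (ht : HasTrace R q γ) :
    ∃ p, HasWeakGradient (Metric.ball 0 R) q p ∧
      (∀ l, MemLp (p l) 2 (volume.restrict (Metric.ball (0 : ℂ) R))) ∧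
      (∑ l, ∫ z in Metric.ball (0 : ℂ) R, fderiv ℝ Y z (dir l) * (p l z - fderiv ℝ Y z (dir l)))
        = ∫ z in Metric.ball (0 : ℂ) R, V z * Y z * (q z - Y z) ∧
      1 / (4 * R ^ 2) * (∫ z in Metric.ball (0 : ℂ) R, (q z - Y z) ^ 2) ≤
        (∑ l, ∫ z in Metric.ball (0 : ℂ) R, (p l z - fderiv ℝ Y z (dir l)) ^ 2) -
          ∫ z in Metric.ball (0 : ℂ) R, V z * (q z - Y z) ^ 2 := by
  obtain ⟨p, hp, f, hf, hfq, hfp, hfγ⟩ := ht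
  set μ := volume.restrict (Metric.ball (0 : ℂ) R) with hμ
  have hYl := fun l => (contDiff_fderiv_dir hY.contDiff l).continuous
  have hpm : ∀ l, MemLp (p l) 2 μ := fun l => memLp_of_tendsto_eLpNorm
    (fun m => (contDiff_fderiv_dir (hf m) l).continuous.memLp_two_ball)
    (hp.2.1 l).aestronglyMeasurable (hfp l)
  refine ⟨p, hp, hpm, ?_⟩
  -- The smooth statements are applied to the approximations of q minus Y. Their values on the
  -- circle tend to zero in L², while the weights in the boundary integrals are fixed continuous
  -- functions, so the boundary terms disappear in the limit.
  set g : ℕ → ℂ → ℝ := fun m z => f m z - Y z with hg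
  have hgs : ∀ m, ContDiff ℝ ∞ (g m) := fun m => (hf m).sub hY.contDiff
  have hgd : ∀ m z l, fderiv ℝ (g m) z (dir l) =
      fderiv ℝ (f m) z (dir l) - fderiv ℝ Y z (dir l) := fun m z l => by
    rw [hg, fderiv_fun_sub ((hf m).differentiable (by simp) z)
      (hY.contDiff.differentiable (by simp) z)]; simp
  have hgl := fun m l => (contDiff_fderiv_dir (hgs m) l).continuous.memLp_two_ball (R := R)
  have hW : MemLp (fun z => q z - Y z) 2 μ := hq.sub hY.contDiff.continuous.memLp_two_ball
  have hDW : ∀ l, MemLp (fun z => p l z - fderiv ℝ Y z (dir l)) 2 μ := fun l =>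
    (hpm l).sub (hYl l).memLp_two_ball
  have tg : Tendsto (fun m => eLpNorm (fun z => g m z - (q z - Y z)) 2 μ) atTop (𝓝 0) := by
    simpa [hg] using hfq
  have tDg : ∀ l, Tendsto (fun m => eLpNorm (fun z => fderiv ℝ (g m) z (dir l) -
      (p l z - fderiv ℝ Y z (dir l))) 2 μ) atTop (𝓝 0) := fun l => by
    simpa [hgd] using hfp l
  have tγ : Tendsto (fun m => eLpNorm (fun θ : ℝ => g m (circleMap 0 R θ)) 2
        (volume.restrict (Ioo 0 (2 * Real.pi)))) atTop (𝓝 0) := by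
    simpa [hg, hYγ] using hfγ
  have tconst : ∀ w : ℂ → ℝ, Tendsto (fun _ : ℕ => eLpNorm (fun z => w z - w z) 2 μ)
    atTop (𝓝 0) := fun w => by simp
  have hVY := hV.mul hY.contDiff.continuous
  constructor
  · have t1 : Tendsto (fun m => ∑ l, ∫ z, fderiv ℝ Y z (dir l) * fderiv ℝ (g m) z (dir l) ∂μ) atTop
        (𝓝 (∑ l, ∫ z, fderiv ℝ Y z (dir l) * (p l z - fderiv ℝ Y z (dir l)) ∂μ)) :=
      tendsto_finsetSum _ fun l _ => tendsto_integral_mul_of_tendsto_eLpNorm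
        (fun _ => (hYl l).memLp_two_ball) (fun m => hgl m l) (hYl l).memLp_two_ball (hDW l)
        (tconst _) (tDg l)
    have t2 : Tendsto (fun m => ∫ z, V z * Y z * g m z ∂μ) atTop
        (𝓝 (∫ z, V z * Y z * (q z - Y z) ∂μ)) :=
      tendsto_integral_mul_of_tendsto_eLpNorm
        (fun _ => hVY.memLp_two_ball) (fun m => (hgs m).continuous.memLp_two_ball)
        hVY.memLp_two_ball hW (tconst _) tg
    have hcm := continuous_circleMap 0 R
    have t3 := (tendsto_integral_circle (w := fun θ =>
        fderiv ℝ Y (circleMap 0 R θ) (dir 0) * Real.cos θ +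
          fderiv ℝ Y (circleMap 0 R θ) (dir 1) * Real.sin θ)
        (((hYl 0).comp hcm).mul Real.continuous_cos |>.add
          (((hYl 1).comp hcm).mul Real.continuous_sin))
        (fun m => (hgs m).continuous) tγ).1
    have t4 := t2.add (t3.const_mul R)
    rw [mul_zero, add_zero] at t4
    refine tendsto_nhds_unique t1 (t4.congr fun m => ?_)
    rw [← hY.integral_fderiv_mul hR hV (hgs m), integral_finsetSum]
    exact fun l _ => integrableOn_ball_of_continuous
      ((hYl l).mul (contDiff_fderiv_dir (hgs m) l).continuous)
  · have t1 : Tendsto (fun m => ∑ l, ∫ z, fderiv ℝ (g m) z (dir l) ^ 2 ∂μ) atTop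
        (𝓝 (∑ l, ∫ z, (p l z - fderiv ℝ Y z (dir l)) ^ 2 ∂μ)) :=
      tendsto_finsetSum _ fun l _ => by
        simpa only [sq] using tendsto_integral_mul_of_tendsto_eLpNorm
          (fun m => hgl m l) (fun m => hgl m l) (hDW l) (hDW l) (tDg l) (tDg l)
    obtain ⟨C, hC⟩ := ae_ball_abs_le_of_continuous (R := R) hV
    have hVW : MemLp (fun z => V z * (q z - Y z)) 2 μ :=
      hW.of_le_mul (hV.aestronglyMeasurable.mul hW.1) (c := C) (by
        filter_upwards [hC] with z hz
        rw [norm_mul]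
        exact mul_le_mul_of_nonneg_right hz (norm_nonneg _))
    have t2 : Tendsto (fun m => ∫ z, V z * g m z ^ 2 ∂μ) atTop
        (𝓝 (∫ z, V z * (q z - Y z) ^ 2 ∂μ)) := by
      have := tendsto_integral_mul_of_tendsto_eLpNorm
        (fun m => (hV.mul (hgs m).continuous).memLp_two_ball)
        (fun m => (hgs m).continuous.memLp_two_ball) hVW hW
        (tendsto_eLpNorm_mul_of_bound hC tg) tg
      simpa only [sq, mul_assoc, Pi.mul_apply] using this
    have t0 : Tendsto (fun m => ∫ z, g m z ^ 2 ∂μ) atTop (𝓝 (∫ z, (q z - Y z) ^ 2 ∂μ)) := by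
      simpa only [sq] using tendsto_integral_mul_of_tendsto_eLpNorm
          (fun m => (hgs m).continuous.memLp_two_ball)
          (fun m => (hgs m).continuous.memLp_two_ball) hW hW tg tg
    have hcm := continuous_circleMap 0 R
    have hΨ := fun l => (contDiff_stabilityField hφ.contDiff hpos (1 / (4 * R ^ 2)) l).continuous
    have t3 := (tendsto_integral_circle (w := fun θ =>
        stabilityField (1 / (4 * R ^ 2)) φ 0 (circleMap 0 R θ) * Real.cos θ +
          stabilityField (1 / (4 * R ^ 2)) φ 1 (circleMap 0 R θ) * Real.sin θ)
        (((hΨ 0).comp hcm).mul Real.continuous_cos |>.add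
          (((hΨ 1).comp hcm).mul Real.continuous_sin))
        (fun m => (hgs m).continuous) tγ).2
    have t4 := (t0.const_mul (1 / (4 * R ^ 2))).add (t3.const_mul R)
    rw [mul_zero, add_zero] at t4
    exact le_of_tendsto_of_tendsto' t4 (t1.sub t2) fun m =>
      hφ.stability hR hV hpos hb (hgs m)

/-! ### Comparing the energies of two maps into a sphere -/

lemma normSq_eq_sum {Q : Matrix (Fin 3) (Fin 3) ℝ} (hQ : Q ∈ S0) :
    normSq Q = ∑ i, ∑ j, Q i j ^ 2 := by
  simp only [normSq, Matrix.trace, Matrix.diag, Matrix.mul_apply]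
  refine Finset.sum_congr rfl fun i _ => Finset.sum_congr rfl fun j _ => ?_
  have := congr_fun (congr_fun hQ.1 i) j
  rw [Matrix.transpose_apply] at this
  rw [this, sq]

/-- Two maps into the same sphere: the energy difference is the second variation evaluated on the
difference of the maps, provided that the first variation is as in Green's identity. -/
lemma energy_difference {α : Type*} [MeasurableSpace α] {μ : Measure α} {V : α → ℝ} {c C : ℝ}
    {Y Q : α → Matrix (Fin 3) (Fin 3) ℝ} {y p : Fin 3 → Fin 3 → Fin 2 → α → ℝ}
    (hVm : AEStronglyMeasurable V μ) (hV : ∀ᵐ z ∂μ, |V z| ≤ C)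
    (hY : ∀ i j, MemLp (fun z => Y z i j) 2 μ) (hQ : ∀ i j, MemLp (fun z => Q z i j) 2 μ)
    (hy : ∀ i j l, MemLp (y i j l) 2 μ) (hp : ∀ i j l, MemLp (p i j l) 2 μ)
    (hYn : ∀ᵐ z ∂μ, ∑ i, ∑ j, Y z i j ^ 2 = c) (hQn : ∀ᵐ z ∂μ, ∑ i, ∑ j, Q z i j ^ 2 = c)
    (h1 : ∀ i j, ∑ l, ∫ z, y i j l z * (p i j l z - y i j l z) ∂μ =
      ∫ z, V z * Y z i j * (Q z i j - Y z i j) ∂μ) :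
    (1 / 2 * ∑ i, ∑ j, ∑ l, ∫ z, p i j l z ^ 2 ∂μ) - 1 / 2 * ∑ i, ∑ j, ∑ l, ∫ z, y i j l z ^ 2 ∂μ =
      1 / 2 * ∑ i, ∑ j, ((∑ l, ∫ z, (p i j l z - y i j l z) ^ 2 ∂μ) -
        ∫ z, V z * (Q z i j - Y z i j) ^ 2 ∂μ) := by
  have hVYQ : ∀ i j, Integrable (fun z => V z * Y z i j * (Q z i j - Y z i j)) μ := fun i j => by
    have := ((hY i j).integrable_mul ((hQ i j).sub (hY i j))).bdd_mul hVm (c := C) hV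
    simpa [mul_assoc] using this
  have hVQ : ∀ i j, Integrable (fun z => V z * (Q z i j - Y z i j) ^ 2) μ := fun i j =>
    ((hQ i j).sub (hY i j)).integrable_sq.bdd_mul hVm (c := C) hV
  have e1 : ∀ i j l, ∫ z, p i j l z ^ 2 ∂μ = ∫ z, y i j l z ^ 2 ∂μ +
      ∫ z, (p i j l z - y i j l z) ^ 2 ∂μ + 2 * ∫ z, y i j l z * (p i j l z - y i j l z) ∂μ := by
    intro i j l
    rw [← integral_const_mul, ← integral_add, ← integral_add]
    · exact integral_congr_ae (Eventually.of_forall fun z => by simp only; ring)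
    · exact (hy i j l).integrable_sq.add ((hp i j l).sub (hy i j l)).integrable_sq
    · exact ((hy i j l).integrable_mul ((hp i j l).sub (hy i j l))).const_mul 2
    · exact (hy i j l).integrable_sq
    · exact ((hp i j l).sub (hy i j l)).integrable_sq
  -- Since |Q| = |Y| pointwise, 2 Y·(Q - Y) = -|Q - Y|². The term linear in Q - Y thus becomes
  -- quadratic.
  have e2 : 2 * ∑ i, ∑ j, ∫ z, V z * Y z i j * (Q z i j - Y z i j) ∂μ =
      -∑ i, ∑ j, ∫ z, V z * (Q z i j - Y z i j) ^ 2 ∂μ := by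
    simp only [← integral_finsetSum _ fun j _ => hVYQ _ j,
      ← integral_finsetSum _ fun j _ => hVQ _ j]
    rw [← integral_finsetSum _ fun i _ => integrable_finsetSum _ fun j _ => hVYQ i j,
      ← integral_finsetSum _ fun i _ => integrable_finsetSum _ fun j _ => hVQ i j,
      ← integral_const_mul, ← integral_neg]
    refine integral_congr_ae ?_
    filter_upwards [hYn, hQn] with z hz hz'
    have : ∑ i, ∑ j, (2 * (V z * Y z i j * (Q z i j - Y z i j)) +
        V z * (Q z i j - Y z i j) ^ 2) = V z * (∑ i, ∑ j, Q z i j ^ 2 - ∑ i, ∑ j, Y z i j ^ 2) := by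
      simp only [← Finset.sum_sub_distrib, Finset.mul_sum]
      refine Finset.sum_congr rfl fun i _ => Finset.sum_congr rfl fun j _ => by ring
    rw [hz, hz', sub_self, mul_zero] at this
    rw [eq_neg_iff_add_eq_zero, ← this]
    simp only [Finset.sum_add_distrib, Finset.mul_sum]
  simp only [e1, Finset.sum_add_distrib, ← Finset.mul_sum, h1, Finset.sum_sub_distrib]
  linarith

/-- If all entries of the smooth map `Y` into a sphere solve `Δ f = - V f`, and if `Δ φ = - V φ`
with `φ` positive, then the Dirichlet energy of `Y` is minimal, in a strict quantitative sense. -/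
theorem dirichletEnergy_coercive {R s : ℝ} (hR : 0 < R) {k : ℤ} {V φ : ℂ → ℝ}
    {Y Q : ℂ → Matrix (Fin 3) (Fin 3) ℝ}
    (hV : Continuous V) (hφ : SolvesSchrodinger (Metric.ball 0 R) V φ) (hpos : ∀ z, 0 < φ z)
    (hb : ∀ z ∈ Metric.ball (0 : ℂ) R, 1 / 2 ≤ φ z ∧ φ z ≤ 1)
    (hY : ∀ i j, SolvesSchrodinger (Metric.ball 0 R) V (fun z => Y z i j))
    (hYγ : ∀ i j θ, Y (circleMap 0 R θ) i j = s * Qk k θ i j)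
    (hYn : ∀ z, ∑ i, ∑ j, Y z i j ^ 2 = 2 / 3 * s ^ 2)
    (hQ : IsAdmissible R s k Q) :
    ∃ eQ eY : ℝ, 0 ≤ eQ ∧ 0 ≤ eY ∧ dirichletEnergy R Q = ENNReal.ofReal eQ ∧
      dirichletEnergy R Y = ENNReal.ofReal eY ∧
      1 / (8 * R ^ 2) * (∑ i, ∑ j, ∫ z in Metric.ball (0 : ℂ) R, (Q z i j - Y z i j) ^ 2)
        ≤ eQ - eY := by
  choose p hp hp2 h1 h2 using fun i j => exists_weakGradient_of_hasTrace hR hV hφ hpos hb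
    (hY i j) (hYγ i j) (hQ.mem_H1 i j).1 (hQ.bdry i j)
  set μ := volume.restrict (Metric.ball (0 : ℂ) R) with hμ
  have hYl := fun i j l => (contDiff_fderiv_dir (hY i j).contDiff l).continuous
  have hYl2 : ∀ i j l, MemLp (fun z => fderiv ℝ (fun w => Y w i j) z (dir l)) 2 μ :=
    fun i j l => (hYl i j l).memLp_two_ball
  obtain ⟨C, hC⟩ := ae_ball_abs_le_of_continuous (R := R) hV
  refine ⟨_, _, ?_, ?_, dirichletEnergy_eq_ofReal (G := fun l z i j => p i j l z) hp
    (fun l i j => hp2 i j l), dirichletEnergy_eq_ofReal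
      (G := fun l z i j => fderiv ℝ (fun w => Y w i j) z (dir l))
      (fun i j => hasWeakGradient_of_contDiff (hY i j).contDiff) (fun l i j => hYl2 i j l), ?_⟩
  · exact mul_nonneg (by norm_num) (Finset.sum_nonneg fun i _ => Finset.sum_nonneg fun j _ =>
      Finset.sum_nonneg fun l _ => integral_nonneg fun z => sq_nonneg _)
  · exact mul_nonneg (by norm_num) (Finset.sum_nonneg fun i _ => Finset.sum_nonneg fun j _ =>
      Finset.sum_nonneg fun l _ => integral_nonneg fun z => sq_nonneg _)
  · rw [energy_difference (μ := μ) (V := V) (Y := Y) (Q := Q) hV.aestronglyMeasurable hC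
      (fun i j => (hY i j).contDiff.continuous.memLp_two_ball) (fun i j => (hQ.mem_H1 i j).1) hYl2 hp2
      (Eventually.of_forall hYn) (by
        filter_upwards [hQ.mem_S0, hQ.norm_eq] with z hz hz'
        rw [← normSq_eq_sum hz, hz']) h1,
      show 1 / (8 * R ^ 2) = 1 / 2 * (1 / (4 * R ^ 2)) by field_simp; norm_num, mul_assoc]
    simp only [Finset.mul_sum (a := 1 / (4 * R ^ 2))]
    gcongr with i _ j _
    exact h2 i j

/-! ### Rules for partial derivatives -/

/-- The partial derivative in the direction `dir l`. -/
def pd (l : Fin 2) (f : ℂ → ℝ) (z : ℂ) : ℝ := fderiv ℝ f z (dir l)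

lemma contDiff_pd {f : ℂ → ℝ} (hf : ContDiff ℝ ∞ f) (l : Fin 2) : ContDiff ℝ ∞ (pd l f) :=
  contDiff_fderiv_dir hf l

lemma hasFDerivAt_of_contDiff {f : ℂ → ℝ} (hf : ContDiff ℝ ∞ f) (z : ℂ) :
    HasFDerivAt f (fderiv ℝ f z) z := (hf.differentiable (by simp) z).hasFDerivAt

lemma pd_add {f g : ℂ → ℝ} (hf : ContDiff ℝ ∞ f) (hg : ContDiff ℝ ∞ g) (l : Fin 2) :
    pd l (fun z => f z + g z) = fun z => pd l f z + pd l g z := by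
  ext z
  rw [pd, ((hasFDerivAt_of_contDiff hf z).fun_add (hasFDerivAt_of_contDiff hg z)).fderiv]
  simp [pd]

lemma pd_const (c : ℝ) (l : Fin 2) : pd l (fun _ => c) = fun _ => 0 := by
  ext z; simp [pd]

lemma pd_mul {f g : ℂ → ℝ} (hf : ContDiff ℝ ∞ f) (hg : ContDiff ℝ ∞ g) (l : Fin 2) :
    pd l (fun z => f z * g z) = fun z => pd l f z * g z + f z * pd l g z := by
  ext z
  rw [pd, ((hasFDerivAt_of_contDiff hf z).fun_mul (hasFDerivAt_of_contDiff hg z)).fderiv]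
  simp [pd]; ring

lemma pd_div {f g : ℂ → ℝ} (hf : ContDiff ℝ ∞ f) (hg : ContDiff ℝ ∞ g) (h0 : ∀ z, g z ≠ 0)
    (l : Fin 2) :
    pd l (fun z => f z / g z) = fun z => (pd l f z * g z - f z * pd l g z) / (g z * g z) := by
  ext z
  rw [pd, ((hasFDerivAt_of_contDiff hf z).real_div (hasFDerivAt_of_contDiff hg z) (h0 z)).fderiv]
  have := h0 z
  simp [pd]; field_simp

lemma SolvesSchrodinger.of_pd {Ω : Set ℂ} {V f : ℂ → ℝ} (hf : ContDiff ℝ ∞ f)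
    (h : ∀ z ∈ Ω, pd 0 (pd 0 f) z + pd 1 (pd 1 f) z = -(V z * f z)) : SolvesSchrodinger Ω V f :=
  ⟨hf, fun z hz => by rw [Fin.sum_univ_two]; exact h z hz⟩

lemma SolvesSchrodinger.pd_eqn {Ω : Set ℂ} {V f : ℂ → ℝ} (h : SolvesSchrodinger Ω V f) {z : ℂ}
    (hz : z ∈ Ω) : pd 0 (pd 0 f) z + pd 1 (pd 1 f) z = -(V z * f z) := by
  have := h.eqn z hz
  rwa [Fin.sum_univ_two] at this

lemma SolvesSchrodinger.mono {Ω Ω' : Set ℂ} {V f : ℂ → ℝ} (h : SolvesSchrodinger Ω V f)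
    (hΩ : Ω' ⊆ Ω) : SolvesSchrodinger Ω' V f := ⟨h.1, fun z hz => h.2 z (hΩ hz)⟩

lemma SolvesSchrodinger.const_mul {Ω : Set ℂ} {V f : ℂ → ℝ} (hf : SolvesSchrodinger Ω V f)
    (c : ℝ) : SolvesSchrodinger Ω V (fun z => c * f z) := by
  refine .of_pd (contDiff_const.mul hf.contDiff) fun z hz => ?_
  have h1 : ∀ l, pd l (pd l fun z => c * f z) = fun z => c * pd l (pd l f) z := fun l => by
    rw [pd_mul contDiff_const hf.contDiff, pd_const]
    simp only [zero_mul, zero_add]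
    rw [pd_mul contDiff_const (contDiff_pd hf.contDiff l), pd_const]
    simp
  rw [h1, h1]
  linear_combination c * hf.pd_eqn hz

lemma SolvesSchrodinger.add {Ω : Set ℂ} {V f g : ℂ → ℝ} (hf : SolvesSchrodinger Ω V f)
    (hg : SolvesSchrodinger Ω V g) : SolvesSchrodinger Ω V (fun z => f z + g z) := by
  refine .of_pd (hf.contDiff.add hg.contDiff) fun z hz => ?_
  have h1 : ∀ l, pd l (pd l fun z => f z + g z) = fun z => pd l (pd l f) z + pd l (pd l g) z :=
    fun l => by
      rw [pd_add hf.contDiff hg.contDiff,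
        pd_add (contDiff_pd hf.contDiff l) (contDiff_pd hg.contDiff l)]
  rw [h1, h1]
  linear_combination hf.pd_eqn hz + hg.pd_eqn hz

lemma pd_pd_div {n N : ℂ → ℝ} (hn : ContDiff ℝ ∞ n) (hN : ContDiff ℝ ∞ N) (h0 : ∀ z, N z ≠ 0)
    (l : Fin 2) (z : ℂ) : pd l (pd l fun z => n z / N z) z =
      pd l (pd l n) z / N z - 2 * pd l n z * pd l N z / N z ^ 2 - n z * pd l (pd l N) z / N z ^ 2
        + 2 * n z * pd l N z ^ 2 / N z ^ 3 := by
  have hnl := contDiff_pd hn l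
  have hNl := contDiff_pd hN l
  rw [pd_div hn hN h0]
  have e : ∀ w, (pd l n w * N w - n w * pd l N w) / (N w * N w) =
      (pd l n w * N w + (-1) * (n w * pd l N w)) / (N w * N w) := fun w => by ring
  simp only [e]
  rw [pd_div (by fun_prop) (by fun_prop) (fun z => mul_ne_zero (h0 z) (h0 z)), pd_mul hN hN,
    pd_add (by fun_prop) (by fun_prop), pd_mul hnl hN, pd_mul contDiff_const (by fun_prop),
    pd_mul hn hNl, pd_const]
  have := h0 z
  simp only
  field_simp
  ring

/-! ### Harmonic maps into the two-sphere by inverse stereographic projection -/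

/-- A conjugate pair of harmonic functions, with gradients of squared length `G`. -/
structure ConformalPair (a b G : ℂ → ℝ) : Prop where
  contDiff_fst : ContDiff ℝ ∞ a
  contDiff_snd : ContDiff ℝ ∞ b
  lap_fst : ∀ z, pd 0 (pd 0 a) z + pd 1 (pd 1 a) z = 0
  lap_snd : ∀ z, pd 0 (pd 0 b) z + pd 1 (pd 1 b) z = 0
  norm_fst : ∀ z, pd 0 a z ^ 2 + pd 1 a z ^ 2 = G z
  norm_snd : ∀ z, pd 0 b z ^ 2 + pd 1 b z ^ 2 = G z
  orth : ∀ z, pd 0 a z * pd 0 b z + pd 1 a z * pd 1 b z = 0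

lemma ConformalPair.symm {a b G : ℂ → ℝ} (h : ConformalPair a b G) : ConformalPair b a G :=
  ⟨h.2, h.1, h.4, h.3, h.6, h.5, fun z => by linarith [h.7 z]⟩

/-- The denominator of the inverse stereographic projection of `(a, b)`. -/
def stereoDenom (a b : ℂ → ℝ) (z : ℂ) : ℝ := 1 + a z * a z + b z * b z

lemma stereoDenom_pos (a b : ℂ → ℝ) (z : ℂ) : 0 < stereoDenom a b z := by
  unfold stereoDenom
  nlinarith [mul_self_nonneg (a z), mul_self_nonneg (b z)]

/-- The potential of the harmonic map with stereographic coordinates `(a, b)`. -/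
def stereoPotential (a b G : ℂ → ℝ) (z : ℂ) : ℝ := 8 * G z / stereoDenom a b z ^ 2

lemma stereoDenom_comm (a b : ℂ → ℝ) : stereoDenom a b = stereoDenom b a := by
  ext z; unfold stereoDenom; ring

lemma ConformalPair.contDiff_stereoDenom {a b G : ℂ → ℝ} (h : ConformalPair a b G) :
    ContDiff ℝ ∞ (stereoDenom a b) :=
  (contDiff_const.add (h.1.mul h.1)).add (h.2.mul h.2)

lemma ConformalPair.pd_stereoDenom {a b G : ℂ → ℝ} (h : ConformalPair a b G) (l : Fin 2) :
    pd l (stereoDenom a b) = fun z => 2 * (a z * pd l a z + b z * pd l b z) := by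
  have ha := h.1
  have hb := h.2
  unfold stereoDenom
  rw [pd_add (contDiff_const.add (ha.mul ha)) (hb.mul hb), pd_add contDiff_const (ha.mul ha),
    pd_mul ha ha, pd_mul hb hb, pd_const]
  ext z
  ring

lemma ConformalPair.pd_pd_stereoDenom {a b G : ℂ → ℝ} (h : ConformalPair a b G) (l : Fin 2) :
    pd l (pd l (stereoDenom a b)) = fun z => 2 * (pd l a z ^ 2 + pd l b z ^ 2 +
      a z * pd l (pd l a) z + b z * pd l (pd l b) z) := by
  have ha := h.1
  have hb := h.2
  have hal := contDiff_pd ha l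
  have hbl := contDiff_pd hb l
  rw [h.pd_stereoDenom, pd_mul contDiff_const (by fun_prop), pd_add (by fun_prop) (by fun_prop),
    pd_mul ha hal, pd_mul hb hbl, pd_const]
  ext z
  ring

/-- For harmonic a one has Δ(a²) = 2|∇a|², and likewise for b. -/
lemma ConformalPair.lap_stereoDenom {a b G : ℂ → ℝ} (h : ConformalPair a b G) (z : ℂ) :
    pd 0 (pd 0 (stereoDenom a b)) z + pd 1 (pd 1 (stereoDenom a b)) z = 4 * G z := by
  rw [h.pd_pd_stereoDenom, h.pd_pd_stereoDenom]
  linear_combination 2 * h.norm_fst z + 2 * h.norm_snd z + 2 * a z * h.lap_fst z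
    + 2 * b z * h.lap_snd z

/-- The mixed term 8ab ∇a·∇b drops out because the gradients are orthogonal, and a² + b² is the
denominator minus 1. -/
lemma ConformalPair.norm_stereoDenom {a b G : ℂ → ℝ} (h : ConformalPair a b G) (z : ℂ) :
    pd 0 (stereoDenom a b) z ^ 2 + pd 1 (stereoDenom a b) z ^ 2 =
      4 * (stereoDenom a b z - 1) * G z := by
  rw [h.pd_stereoDenom, h.pd_stereoDenom, stereoDenom]
  linear_combination 4 * a z ^ 2 * h.norm_fst z + 4 * b z ^ 2 * h.norm_snd z
    + 8 * a z * b z * h.orth z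

/-- Inverse stereographic projection of a conformal map is harmonic into the unit sphere, so its
three coordinates satisfy Δf = -|∇Y|² f with a common potential. Here this is the quotient rule
together with ΔN = 4G, |∇N|² = 4(N - 1)G and ∇a·∇N = 2aG for the denominator N. -/
lemma ConformalPair.solves_fst {a b G : ℂ → ℝ} (h : ConformalPair a b G) (Ω : Set ℂ) :
    SolvesSchrodinger Ω (stereoPotential a b G) (fun z => 2 * a z / stereoDenom a b z) := by
  have h2a : ContDiff ℝ ∞ fun z => 2 * a z := contDiff_const.mul h.1
  have hN0 := fun z => (stereoDenom_pos a b z).ne'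
  refine .of_pd (h2a.div h.contDiff_stereoDenom hN0) fun z _ => ?_
  have e1 : ∀ l, pd l (fun z => 2 * a z) = fun z => 2 * pd l a z := fun l => by
    rw [pd_mul contDiff_const h.1, pd_const]; simp
  have e2 : ∀ l, pd l (fun z => 2 * pd l a z) = fun z => 2 * pd l (pd l a) z := fun l => by
    rw [pd_mul contDiff_const (contDiff_pd h.1 l), pd_const]; simp
  rw [pd_pd_div h2a h.contDiff_stereoDenom hN0, pd_pd_div h2a h.contDiff_stereoDenom hN0]
  simp only [e1, e2, stereoPotential]
  have e3 : pd 0 a z * pd 0 (stereoDenom a b) z + pd 1 a z * pd 1 (stereoDenom a b) z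
      = 2 * a z * G z := by
    rw [h.pd_stereoDenom, h.pd_stereoDenom]
    linear_combination 2 * a z * h.norm_fst z + 2 * b z * h.orth z
  have hN := hN0 z
  set N := stereoDenom a b with hNdef
  trans 2 * (pd 0 (pd 0 a) z + pd 1 (pd 1 a) z) / N z
    - 4 * (pd 0 a z * pd 0 N z + pd 1 a z * pd 1 N z) / N z ^ 2
    - 2 * a z * (pd 0 (pd 0 N) z + pd 1 (pd 1 N) z) / N z ^ 2
    + 4 * a z * (pd 0 N z ^ 2 + pd 1 N z ^ 2) / N z ^ 3
  · ring
  rw [h.lap_fst, e3, h.lap_stereoDenom, h.norm_stereoDenom]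
  simp only [← hNdef]
  field_simp
  ring

lemma ConformalPair.solves_snd {a b G : ℂ → ℝ} (h : ConformalPair a b G) (Ω : Set ℂ) :
    SolvesSchrodinger Ω (stereoPotential a b G) (fun z => 2 * b z / stereoDenom a b z) := by
  have := h.symm.solves_fst Ω
  have e : stereoPotential b a G = stereoPotential a b G := by
    ext z; rw [stereoPotential, stereoDenom_comm, stereoPotential]
  rwa [e, stereoDenom_comm] at this

lemma ConformalPair.solves_trd {a b G : ℂ → ℝ} (h : ConformalPair a b G) (Ω : Set ℂ) :
    SolvesSchrodinger Ω (stereoPotential a b G)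
      -- The third coordinate is 1 - 2/N; the numerator is spelled as a sum so that `pd_add` applies
      -- to it.
      (fun z => (stereoDenom a b z + -2) / stereoDenom a b z) := by
  have hN := h.contDiff_stereoDenom
  have h2a : ContDiff ℝ ∞ fun z => stereoDenom a b z + -2 := hN.add contDiff_const
  have hN0 := fun z => (stereoDenom_pos a b z).ne'
  refine .of_pd (h2a.div hN hN0) fun z _ => ?_
  have e1 : ∀ l, pd l (fun z => stereoDenom a b z + -2) = pd l (stereoDenom a b) := fun l => by
    rw [pd_add hN contDiff_const, pd_const]; simp
  rw [pd_pd_div h2a hN hN0, pd_pd_div h2a hN hN0]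
  simp only [e1, stereoPotential]
  have hN := hN0 z
  set N := stereoDenom a b with hNdef
  trans 2 * (pd 0 (pd 0 N) z + pd 1 (pd 1 N) z) / N z ^ 2
    - 4 * (pd 0 N z ^ 2 + pd 1 N z ^ 2) / N z ^ 3
  · field_simp
    ring
  rw [h.lap_stereoDenom, h.norm_stereoDenom]
  simp only [← hNdef]
  field_simp
  ring

/-- The real and imaginary parts of a holomorphic function. -/
lemma conformalPair_re_im {f f' f'' : ℂ → ℂ} (h : ∀ z, HasDerivAt f (f' z) z)
    (h' : ∀ z, HasDerivAt f' (f'' z) z) :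
    ConformalPair (fun z => (f z).re) (fun z => (f z).im) (fun z => ‖f' z‖ ^ 2) := by
  have key : ∀ {g g' : ℂ → ℂ}, (∀ z, HasDerivAt g (g' z) z) →
      ContDiff ℝ ∞ (fun z => (g z).re) ∧ ContDiff ℝ ∞ (fun z => (g z).im) ∧
      (∀ l, pd l (fun z => (g z).re) = fun z => (g' z * dir l).re) ∧
      (∀ l, pd l (fun z => (g z).im) = fun z => (g' z * dir l).im) := by
    intro g g' hg
    have hd : Differentiable ℂ g := fun z => (hg z).differentiableAt
    have hc : ContDiff ℝ ∞ g := hd.contDiff.restrict_scalars ℝ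
    have hf : ∀ z, HasFDerivAt g
        (((ContinuousLinearMap.toSpanSingleton ℂ (g' z))).restrictScalars ℝ) z :=
      fun z => (hg z).hasFDerivAt.restrictScalars ℝ
    refine ⟨Complex.reCLM.contDiff.comp hc, Complex.imCLM.contDiff.comp hc, fun l => ?_, fun l => ?_⟩
    · ext z
      have : HasFDerivAt (fun z => (g z).re) _ z := Complex.reCLM.hasFDerivAt.comp z (hf z)
      rw [pd, this.fderiv]
      simp [mul_comm]
    · ext z
      have : HasFDerivAt (fun z => (g z).im) _ z := Complex.imCLM.hasFDerivAt.comp z (hf z)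
      rw [pd, this.fderiv]
      simp [mul_comm]
  obtain ⟨c1, c2, d1, d2⟩ := key h
  -- Each real derivative in the direction `dir l` multiplies the complex derivative by `dir l`. Two
  -- of them give the factors 1² and i², which cancel in the Laplacian.
  have d3 : ∀ l, pd l (pd l fun z => (f z).re) = fun z => (f'' z * dir l * dir l).re := fun l => by
    rw [d1]; exact (key fun z => (h' z).mul_const (dir l)).2.2.1 l
  have d4 : ∀ l, pd l (pd l fun z => (f z).im) = fun z => (f'' z * dir l * dir l).im := fun l => by
    rw [d2]; exact (key fun z => (h' z).mul_const (dir l)).2.2.2 l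
  refine ⟨c1, c2, fun z => ?_, fun z => ?_, fun z => ?_, fun z => ?_, fun z => ?_⟩
  · simp [d3, dir]
  · simp [d4, dir]
  · simp [d1, dir, ← Complex.normSq_eq_norm_sq, Complex.normSq_apply]; ring
  · simp [d2, dir, ← Complex.normSq_eq_norm_sq, Complex.normSq_apply]; ring
  · simp [d1, d2, dir]; ring

/-! ## The profiles in stereographic coordinates -/

/-- The profile `u` of the map with stereographic coordinate `lam z ^ K`. -/
def profU (ρ lam : ℝ) (K : ℕ) (r : ℝ) : ℝ := ρ * (2 * (lam * r ^ K) / (1 + (lam * r ^ K) ^ 2))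

/-- The profile `v` of the map with stereographic coordinate `lam z ^ K`. -/
def profV (σ ρ lam : ℝ) (K : ℕ) (r : ℝ) : ℝ :=
  σ * ρ * (((lam * r ^ K) ^ 2 - 1) / (1 + (lam * r ^ K) ^ 2))

lemma sqrt_two_mul_eq : 2 * √2 = √(2 / 3) * (2 * √3) := by
  rw [Real.sqrt_div (by norm_num)]
  field_simp

/-- The parameter is fixed by lam R^K = 1/√3. For the plus profiles it is lam R^K = √3, the
reciprocal value, together with σ = -1. -/
lemma uMinus_eq {R : ℝ} (hR : 0 < R) (s : ℝ) (k : ℤ) :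
    uMinus R s k = profU (√(2 / 3) * s) (1 / (√3 * R ^ k.natAbs)) k.natAbs := by
  ext r
  have h3 : √3 ^ 2 = 3 := Real.sq_sqrt (by norm_num)
  have : 0 < √3 := by positivity
  have h1 : 0 ≤ (r ^ k.natAbs) ^ 2 := sq_nonneg _
  have h2 : 0 < R ^ k.natAbs := by positivity
  rw [uMinus, profU, sqrt_two_mul_eq, mul_comm 2 k.natAbs, pow_mul, pow_mul]
  generalize r ^ k.natAbs = x at *
  generalize R ^ k.natAbs = y at *
  field_simp
  rw [h3]
  ring

lemma vMinus_eq {R : ℝ} (hR : 0 < R) (s : ℝ) (k : ℤ) :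
    vMinus R s k = profV 1 (√(2 / 3) * s) (1 / (√3 * R ^ k.natAbs)) k.natAbs := by
  ext r
  have h3 : √3 ^ 2 = 3 := Real.sq_sqrt (by norm_num)
  have : 0 < √3 := by positivity
  have h1 : 0 ≤ (r ^ k.natAbs) ^ 2 := sq_nonneg _
  have h2 : 0 < R ^ k.natAbs := by positivity
  rw [vMinus, profV, mul_comm 2 k.natAbs, pow_mul, pow_mul]
  generalize r ^ k.natAbs = x at *
  generalize R ^ k.natAbs = y at *
  field_simp
  rw [h3]
  ring

lemma uPlus_eq {R : ℝ} (hR : 0 < R) (s : ℝ) (k : ℤ) :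
    uPlus R s k = profU (√(2 / 3) * s) (√3 / R ^ k.natAbs) k.natAbs := by
  ext r
  have h3 : √3 ^ 2 = 3 := Real.sq_sqrt (by norm_num)
  have : 0 < √3 := by positivity
  have h1 : 0 ≤ (r ^ k.natAbs) ^ 2 := sq_nonneg _
  have h2 : 0 < R ^ k.natAbs := by positivity
  rw [uPlus, profU, sqrt_two_mul_eq, mul_comm 2 k.natAbs, pow_mul, pow_mul]
  generalize r ^ k.natAbs = x at *
  generalize R ^ k.natAbs = y at *
  field_simp
  rw [h3]
  ring

lemma vPlus_eq {R : ℝ} (hR : 0 < R) (s : ℝ) (k : ℤ) :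
    vPlus R s k = profV (-1) (√(2 / 3) * s) (√3 / R ^ k.natAbs) k.natAbs := by
  ext r
  have h3 : √3 ^ 2 = 3 := Real.sq_sqrt (by norm_num)
  have : 0 < √3 := by positivity
  have h1 : 0 ≤ (r ^ k.natAbs) ^ 2 := sq_nonneg _
  have h2 : 0 < R ^ k.natAbs := by positivity
  rw [vPlus, profV, mul_comm 2 k.natAbs, pow_mul, pow_mul]
  generalize r ^ k.natAbs = x at *
  generalize R ^ k.natAbs = y at *
  field_simp
  rw [h3]
  ring

/-! ## The harmonic maps -/

/-- The factor (√2)⁻¹ makes this matrix, `tensorSin` and `F3` orthonormal for the entrywise inner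
product (`sum_sq_tensor`). -/
def tensorCos : Matrix (Fin 3) (Fin 3) ℝ := (√2)⁻¹ • !![1, 0, 0; 0, -1, 0; 0, 0, 0]

def tensorSin : Matrix (Fin 3) (Fin 3) ℝ := (√2)⁻¹ • !![0, 1, 0; 1, 0, 0; 0, 0, 0]

lemma F3_eq : F3 = (√6)⁻¹ • !![-1, 0, 0; 0, -1, 0; 0, 0, 2] := by
  have h : √(3 / 2) = 3 * (√6)⁻¹ := by
    rw [Real.sqrt_eq_iff_mul_self_eq (by norm_num) (by positivity)]
    have : √6 * √6 = 6 := Real.mul_self_sqrt (by norm_num)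
    field_simp
    nlinarith
  rw [F3, h]
  ext i j
  fin_cases i <;> fin_cases j <;> simp [Matrix.vecMulVec] <;> ring

/-- The director turns by the half angle kφ/2, but its tensor square depends only on the double
angle. Hence there is no jump across the cut of the argument, even for odd k. -/
lemma Fn_eq (k : ℤ) (φ : ℝ) :
    Fn k φ = Real.cos (k * φ) • tensorCos + Real.sin (k * φ) • tensorSin := by
  have h : √2 = 2 * (√2)⁻¹ := by
    have : √2 * √2 = 2 := Real.mul_self_sqrt (by norm_num)
    field_simp
    linarith
  have e : (k : ℝ) * φ = 2 * (k / 2 * φ) := by ring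
  rw [Fn, h, e, Real.cos_two_mul, Real.sin_two_mul]
  have hs := Real.sin_sq_add_cos_sq ((k : ℝ) / 2 * φ)
  have hs' : Real.sin ((k : ℝ) / 2 * φ) ^ 2 = 1 - Real.cos ((k : ℝ) / 2 * φ) ^ 2 := by linarith
  ext i j
  fin_cases i <;> fin_cases j <;>
    simp [Matrix.vecMulVec, director, tensorCos, tensorSin, ← sq, hs'] <;> ring

lemma Qk_eq (s : ℝ) (k : ℤ) (φ : ℝ) : s • Qk k φ = (s / √2) • Fn k φ + (-(s / √6)) • F3 := by
  have h2 : √2 * √2 = 2 := Real.mul_self_sqrt (by norm_num)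
  have h6 : √6 * √6 = 6 := Real.mul_self_sqrt (by norm_num)
  rw [F3_eq, Fn, smul_smul, smul_smul, Qk]
  have e1 : s / √2 * √2 = s := by field_simp
  have e2 : -(s / √6) * (√6)⁻¹ = -(s / 6) := by field_simp; rw [sq, h6]
  rw [e1, e2]
  ext i j
  fin_cases i <;> fin_cases j <;> simp [Matrix.vecMulVec] <;> ring

/-- The power of z must be nonnegative, so for k < 0 the orientation is restored by the sign of k in
front of the imaginary part. -/
lemma pow_mul_cos_arg (k : ℤ) (r θ : ℝ) :
    (((r : ℂ) * Complex.exp (θ * Complex.I)) ^ k.natAbs).re = r ^ k.natAbs * Real.cos (k * θ) ∧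
    k.sign * (((r : ℂ) * Complex.exp (θ * Complex.I)) ^ k.natAbs).im =
      r ^ k.natAbs * Real.sin (k * θ) := by
  have e : ((r : ℂ) * Complex.exp (θ * Complex.I)) ^ k.natAbs =
      ((r ^ k.natAbs : ℝ) : ℂ) * Complex.exp (((k.natAbs * θ : ℝ) : ℂ) * Complex.I) := by
    rw [mul_pow, ← Complex.exp_nat_mul]; push_cast; ring_nf
  rw [e, Complex.re_ofReal_mul, Complex.im_ofReal_mul, Complex.exp_ofReal_mul_I_re,
    Complex.exp_ofReal_mul_I_im]
  rcases lt_trichotomy k 0 with h | h | h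
  · have h1 : (k : ℝ) = -(k.natAbs : ℝ) := by
      have : k = -(k.natAbs : ℤ) := by omega
      exact_mod_cast this
    rw [h1, Int.sign_eq_neg_one_of_neg h]
    simp
  · subst h; simp
  · have h1 : (k : ℝ) = (k.natAbs : ℝ) := by
      have : (k.natAbs : ℤ) = k := by omega
      rw [← Int.cast_natCast, this]
    rw [h1, Int.sign_eq_one_of_pos h]
    simp

/-- The stereographic coordinate `lam z ^ K`, real part. -/
def stereoRe (lam : ℝ) (K : ℕ) (z : ℂ) : ℝ := ((lam : ℂ) * z ^ K).re

/-- The stereographic coordinate `lam z ^ K`, imaginary part. -/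
def stereoIm (lam : ℝ) (K : ℕ) (z : ℂ) : ℝ := ((lam : ℂ) * z ^ K).im

lemma conformalPair_stereo (lam : ℝ) (K : ℕ) : ConformalPair (stereoRe lam K) (stereoIm lam K)
    (fun z => ‖(lam : ℂ) * (K * z ^ (K - 1))‖ ^ 2) :=
  conformalPair_re_im (fun z => (hasDerivAt_pow K z).const_mul _)
    fun z => ((hasDerivAt_pow (K - 1) z).const_mul _).const_mul _

lemma stereoDenom_eq (lam : ℝ) (K : ℕ) (z : ℂ) :
    stereoDenom (stereoRe lam K) (stereoIm lam K) z = 1 + (lam * ‖z‖ ^ K) ^ 2 := by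
  rw [stereoDenom, stereoRe, stereoIm, add_assoc, ← Complex.normSq_apply,
    Complex.normSq_eq_norm_sq, norm_mul, norm_pow, mul_pow, mul_pow, Complex.norm_real,
    Real.norm_eq_abs, sq_abs]

/-- The right-hand side depends on z alone, and so shows smoothness at the origin and across the cut
of the argument. Allowing an arbitrary angle θ, and not only the principal one, lets the boundary
values be read off along `circleMap`. -/
lemma ansatz_polar (k : ℤ) (σ ρ lam r θ : ℝ) (hr : 0 ≤ r) (z : ℂ)
    (hz : z = (r : ℂ) * Complex.exp (θ * Complex.I)) :
    profU ρ lam k.natAbs r • Fn k θ + profV σ ρ lam k.natAbs r • F3 =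
      (ρ * (2 * stereoRe lam k.natAbs z /
        stereoDenom (stereoRe lam k.natAbs) (stereoIm lam k.natAbs) z)) • tensorCos +
      (ρ * k.sign * (2 * stereoIm lam k.natAbs z /
        stereoDenom (stereoRe lam k.natAbs) (stereoIm lam k.natAbs) z)) • tensorSin +
      (σ * ρ * ((stereoDenom (stereoRe lam k.natAbs) (stereoIm lam k.natAbs) z + -2) /
        stereoDenom (stereoRe lam k.natAbs) (stereoIm lam k.natAbs) z)) • F3 := by
  have hn : ‖z‖ = r := by
    rw [hz, norm_mul, Complex.norm_exp_ofReal_mul_I, mul_one, Complex.norm_real, Real.norm_eq_abs,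
      abs_of_nonneg hr]
  obtain ⟨h1, h2⟩ := pow_mul_cos_arg k r θ
  rw [← hz] at h1 h2
  rw [stereoDenom_eq, hn, Fn_eq, smul_add, smul_smul, smul_smul, stereoRe, stereoIm,
    Complex.re_ofReal_mul, Complex.im_ofReal_mul]
  congr 2
  · rw [h1, profU]; ring_nf
  · rw [show ρ * (k.sign : ℝ) * (2 * (lam * (z ^ k.natAbs).im) / (1 + (lam * r ^ k.natAbs) ^ 2)) =
      ρ * (2 * (lam * (k.sign * (z ^ k.natAbs).im)) / (1 + (lam * r ^ k.natAbs) ^ 2)) by ring, h2,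
      profU]
    ring_nf
  · rw [profV]; ring_nf

lemma ansatz_eq (k : ℤ) (σ ρ lam : ℝ) (z : ℂ) :
    ansatz k (profU ρ lam k.natAbs) (profV σ ρ lam k.natAbs) z =
      (ρ * (2 * stereoRe lam k.natAbs z /
        stereoDenom (stereoRe lam k.natAbs) (stereoIm lam k.natAbs) z)) • tensorCos +
      (ρ * k.sign * (2 * stereoIm lam k.natAbs z /
        stereoDenom (stereoRe lam k.natAbs) (stereoIm lam k.natAbs) z)) • tensorSin +
      (σ * ρ * ((stereoDenom (stereoRe lam k.natAbs) (stereoIm lam k.natAbs) z + -2) /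
        stereoDenom (stereoRe lam k.natAbs) (stereoIm lam k.natAbs) z)) • F3 :=
  ansatz_polar k σ ρ lam ‖z‖ z.arg (norm_nonneg z) z (Complex.norm_mul_exp_arg_mul_I z).symm

/-- The potential of the harmonic map with stereographic coordinate `lam z ^ K`. -/
def powPotential (lam : ℝ) (K : ℕ) : ℂ → ℝ :=
  stereoPotential (stereoRe lam K) (stereoIm lam K) (fun z => ‖(lam : ℂ) * (K * z ^ (K - 1))‖ ^ 2)

lemma continuous_powPotential (lam : ℝ) (K : ℕ) : Continuous (powPotential lam K) := by
  have h := (conformalPair_stereo lam K).contDiff_stereoDenom.continuous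
  have h0 := fun z => (pow_pos (stereoDenom_pos (stereoRe lam K) (stereoIm lam K) z) 2).ne'
  exact Continuous.div (by fun_prop) (h.pow 2) h0

/-- Each entry is a constant linear combination of the three coordinates of one harmonic map into
the sphere, and these share a potential. -/
lemma solvesSchrodinger_ansatz (k : ℤ) (σ ρ lam : ℝ) (i j : Fin 3) :
    SolvesSchrodinger univ (powPotential lam k.natAbs)
      (fun z => ansatz k (profU ρ lam k.natAbs) (profV σ ρ lam k.natAbs) z i j) := by
  have h := conformalPair_stereo lam k.natAbs
  have e := (((h.solves_fst univ).const_mul (ρ * tensorCos i j)).add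
    ((h.solves_snd univ).const_mul (ρ * k.sign * tensorSin i j))).add
    ((h.solves_trd univ).const_mul (σ * ρ * F3 i j))
  unfold powPotential
  convert e using 2 with z
  rw [ansatz_eq]
  simp only [Matrix.add_apply, Matrix.smul_apply, smul_eq_mul]
  ring

lemma sum_sq_tensor (x y w : ℝ) :
    ∑ i, ∑ j, (x • tensorCos + y • tensorSin + w • F3) i j ^ 2 = x ^ 2 + y ^ 2 + w ^ 2 := by
  have h2 : (√2)⁻¹ ^ 2 = 1 / 2 := by rw [inv_pow, Real.sq_sqrt (by norm_num)]; norm_num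
  have h6 : (√6)⁻¹ ^ 2 = 1 / 6 := by rw [inv_pow, Real.sq_sqrt (by norm_num)]; norm_num
  rw [F3_eq, tensorCos, tensorSin]
  simp only [Fin.sum_univ_three, Matrix.add_apply, Matrix.smul_apply, smul_eq_mul]
  simp
  linear_combination (2 * x ^ 2 + 2 * y ^ 2) * h2 + 6 * w ^ 2 * h6

lemma ansatz_mem_S0 (k : ℤ) (u v : ℝ → ℝ) (z : ℂ) : ansatz k u v z ∈ S0 := by
  rw [ansatz, Fn_eq, F3_eq, tensorCos, tensorSin]
  constructor
  · ext i j
    fin_cases i <;> fin_cases j <;> simp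
  · simp [Matrix.trace, Fin.sum_univ_three]
    ring

lemma sum_sq_ansatz (k : ℤ) (hk : k ≠ 0) {σ : ℝ} (hσ : σ ^ 2 = 1) (ρ lam : ℝ) (z : ℂ) :
    ∑ i, ∑ j, ansatz k (profU ρ lam k.natAbs) (profV σ ρ lam k.natAbs) z i j ^ 2 = ρ ^ 2 := by
  rw [ansatz_eq, sum_sq_tensor]
  have hs : (k.sign : ℝ) ^ 2 = 1 := by
    rcases hk.lt_or_gt with h | h
    · rw [Int.sign_eq_neg_one_of_neg h]; norm_num
    · rw [Int.sign_eq_one_of_pos h]; norm_num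
  have h0 := (stereoDenom_pos (stereoRe lam k.natAbs) (stereoIm lam k.natAbs) z).ne'
  have e : stereoDenom (stereoRe lam k.natAbs) (stereoIm lam k.natAbs) z = 1 +
    stereoRe lam k.natAbs z * stereoRe lam k.natAbs z +
    stereoIm lam k.natAbs z * stereoIm lam k.natAbs z := rfl
  generalize stereoDenom (stereoRe lam k.natAbs) (stereoIm lam k.natAbs) z = N at *
  generalize stereoRe lam k.natAbs z = a at *
  generalize stereoIm lam k.natAbs z = b at *
  rw [mul_pow, mul_pow, mul_pow, mul_pow, mul_pow, hs, hσ]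
  field_simp
  rw [e]
  ring

lemma ansatz_circleMap {R : ℝ} (hR : 0 < R) (k : ℤ) (s σ ρ lam : ℝ)
    (hu : profU ρ lam k.natAbs R = s / √2) (hv : profV σ ρ lam k.natAbs R = -(s / √6)) (θ : ℝ) :
    ansatz k (profU ρ lam k.natAbs) (profV σ ρ lam k.natAbs) (circleMap 0 R θ) = s • Qk k θ := by
  rw [ansatz_eq, ← ansatz_polar k σ ρ lam R θ hR.le _ (by simp [circleMap]), hu, hv, Qk_eq]

lemma hasTrace_of_contDiff {R : ℝ} {f : ℂ → ℝ} (hf : ContDiff ℝ ∞ f) {γ : ℝ → ℝ}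
    (h : ∀ θ, f (circleMap 0 R θ) = γ θ) : HasTrace R f γ :=
  ⟨_, hasWeakGradient_of_contDiff hf, fun _ => f, fun _ => hf, by simp, by simp, by simp [h]⟩

lemma isAdmissible_ansatz {R s : ℝ} (hR : 0 < R) {k : ℤ} (hk : k ≠ 0) {σ : ℝ} (hσ : σ ^ 2 = 1)
    {lam : ℝ} (hu : profU (√(2 / 3) * s) lam k.natAbs R = s / √2)
    (hv : profV σ (√(2 / 3) * s) lam k.natAbs R = -(s / √6)) :
    IsAdmissible R s k
      (ansatz k (profU (√(2 / 3) * s) lam k.natAbs) (profV σ (√(2 / 3) * s) lam k.natAbs)) where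
  mem_S0 := Eventually.of_forall fun z => ansatz_mem_S0 _ _ _ z
  norm_eq := Eventually.of_forall fun z => by
    rw [normSq_eq_sum (ansatz_mem_S0 _ _ _ z), sum_sq_ansatz k hk hσ, mul_pow,
      Real.sq_sqrt (by norm_num)]
  mem_H1 i j := by
    have h := (solvesSchrodinger_ansatz k σ (√(2 / 3) * s) lam i j).contDiff
    exact ⟨h.continuous.memLp_two_ball, _, hasWeakGradient_of_contDiff h,
      fun l => (contDiff_fderiv_dir h l).continuous.memLp_two_ball⟩
  bdry i j := hasTrace_of_contDiff (solvesSchrodinger_ansatz k σ (√(2 / 3) * s) lam i j).contDiff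
    fun θ => by rw [ansatz_circleMap hR k s σ _ lam hu hv]; rfl

/-! ### A positive solution on the disk, and unique minimality -/

/-- A smooth positive function on the line which is the identity on `[1/4, ∞)`. -/
def posCutoff (x : ℝ) : ℝ := 1 + Real.smoothTransition (8 * x - 1) * (x - 1)

lemma contDiff_posCutoff : ContDiff ℝ ∞ posCutoff :=
  contDiff_const.add ((Real.smoothTransition.contDiff.comp
    ((contDiff_const.mul contDiff_id).sub contDiff_const)).mul (contDiff_id.sub contDiff_const))

lemma posCutoff_pos (x : ℝ) : 0 < posCutoff x := by
  have h0 := Real.smoothTransition.nonneg (8 * x - 1)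
  have h1 := Real.smoothTransition.le_one (8 * x - 1)
  unfold posCutoff
  -- The value is a convex combination of 1 and x, and x has positive weight only for x > 1/8.
  rcases le_or_gt (8 * x - 1) 0 with h | h
  · rw [Real.smoothTransition.zero_of_nonpos h]; norm_num
  · nlinarith [Real.smoothTransition.pos_of_pos h]

lemma posCutoff_eq {x : ℝ} (hx : 1 / 4 ≤ x) : posCutoff x = x := by
  rw [posCutoff, Real.smoothTransition.one_of_one_le (by linarith)]; ring

lemma SolvesSchrodinger.congr {Ω : Set ℂ} {V f g : ℂ → ℝ} (hf : SolvesSchrodinger Ω V f)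
    (hg : ContDiff ℝ ∞ g) (h : ∀ z ∈ Ω, g =ᶠ[𝓝 z] f) : SolvesSchrodinger Ω V g := by
  refine .of_pd hg fun z hz => ?_
  have e : ∀ l, pd l (pd l g) z = pd l (pd l f) z := fun l => by
    have h1 : pd l g =ᶠ[𝓝 z] pd l f := by
      filter_upwards [(h z hz).eventuallyEq_nhds] with w hw
      rw [pd, hw.fderiv_eq, pd]
    rw [pd, h1.fderiv_eq, pd]
  rw [e, e, (h z hz).eq_of_nhds, hf.pd_eqn hz]

/-- The negative of the third coordinate is (2 - N)/N with N = 1 + |lam z^K|². It is at least 1/2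
exactly when |lam z^K|² ≤ 1/3. Far from the disk it may become negative, so it is composed with
`posCutoff`; this changes nothing near points of the disk, where it exceeds 1/4. -/
lemma exists_pos_solvesSchrodinger {R lam : ℝ} {K : ℕ} (hlam : (lam * R ^ K) ^ 2 ≤ 1 / 3) :
    ∃ φ, SolvesSchrodinger (Metric.ball 0 R) (powPotential lam K) φ ∧ (∀ z, 0 < φ z) ∧
      ∀ z ∈ Metric.ball (0 : ℂ) R, 1 / 2 ≤ φ z ∧ φ z ≤ 1 := by
  have h := ((conformalPair_stereo lam K).solves_trd univ).const_mul (-1)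
  set N := stereoDenom (stereoRe lam K) (stereoIm lam K) with hN
  set φ₀ : ℂ → ℝ := fun z => -1 * ((N z + -2) / N z) with hφ₀
  have hb : ∀ z ∈ Metric.ball (0 : ℂ) R, 1 / 2 ≤ φ₀ z ∧ φ₀ z ≤ 1 := by
    intro z hz
    have hz' : ‖z‖ ≤ R := (mem_ball_zero_iff.1 hz).le
    have h1 : N z = 1 + (lam * ‖z‖ ^ K) ^ 2 := stereoDenom_eq lam K z
    have h2 : (lam * ‖z‖ ^ K) ^ 2 ≤ (lam * R ^ K) ^ 2 := by
      rw [mul_pow, mul_pow]; gcongr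
    have h3 : 0 < N z := stereoDenom_pos _ _ z
    have h4 : φ₀ z = (2 - N z) / N z := by rw [hφ₀]; ring
    rw [h4, le_div_iff₀ h3, div_le_iff₀ h3]
    constructor <;> nlinarith [sq_nonneg (lam * ‖z‖ ^ K)]
  refine ⟨fun z => posCutoff (φ₀ z), (h.mono (subset_univ _)).congr
    (contDiff_posCutoff.comp h.contDiff) fun z hz => ?_, fun z => posCutoff_pos _, fun z hz => ?_⟩
  · have : ∀ᶠ w in 𝓝 z, 1 / 4 < φ₀ w :=
      h.contDiff.continuous.continuousAt.eventually (lt_mem_nhds (by linarith [(hb z hz).1]))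
    filter_upwards [this] with w hw
    exact posCutoff_eq hw.le
  · simp only [posCutoff_eq (by linarith [(hb z hz).1] : 1 / 4 ≤ φ₀ z)]
    exact hb z hz

/-- The energy gap controls the squared L² distance to the ansatz with the factor 1/(8R²), so a
competitor of equal energy agrees with it almost everywhere. The bound on lam R^K is what provides
the positive solution. -/
theorem isUniqueMinimiser_ansatz {R s : ℝ} (hR : 0 < R) {k : ℤ} (hk : k ≠ 0) {σ : ℝ}
    (hσ : σ ^ 2 = 1) {lam : ℝ} (hlam : (lam * R ^ k.natAbs) ^ 2 ≤ 1 / 3)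
    (hu : profU (√(2 / 3) * s) lam k.natAbs R = s / √2)
    (hv : profV σ (√(2 / 3) * s) lam k.natAbs R = -(s / √6)) :
    IsUniqueMinimiser R s k
      (ansatz k (profU (√(2 / 3) * s) lam k.natAbs) (profV σ (√(2 / 3) * s) lam k.natAbs)) := by
  have hadm := isAdmissible_ansatz hR hk hσ hu hv
  obtain ⟨φ, hφ, hpos, hb⟩ := exists_pos_solvesSchrodinger hlam
  set Y := ansatz k (profU (√(2 / 3) * s) lam k.natAbs) (profV σ (√(2 / 3) * s) lam k.natAbs)
    with hYdef
  have key := fun Q hQ => dirichletEnergy_coercive (Q := Q) hR (continuous_powPotential lam k.natAbs)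
    hφ hpos hb (Y := Y)
    (fun i j => (solvesSchrodinger_ansatz k σ (√(2 / 3) * s) lam i j).mono (subset_univ _))
    (fun i j θ => by rw [hYdef, ansatz_circleMap hR k s σ _ lam hu hv]; rfl)
    (fun z => by rw [hYdef, sum_sq_ansatz k hk hσ, mul_pow, Real.sq_sqrt (by norm_num)]) hQ
  have hnn : ∀ Q : ℂ → Matrix (Fin 3) (Fin 3) ℝ, ∀ i j,
      0 ≤ ∫ z in Metric.ball (0 : ℂ) R, (Q z i j - Y z i j) ^ 2 := fun Q i j =>
    integral_nonneg fun z => sq_nonneg _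
  have hc : 0 < 1 / (8 * R ^ 2) := by positivity
  refine ⟨hadm, fun Q hQ => ?_, fun Q hQ he => ?_⟩
  · obtain ⟨eQ, eY, h1, h2, h3, h4, h5⟩ := key Q hQ
    rw [h3, h4]
    refine ENNReal.ofReal_le_ofReal ?_
    have := mul_nonneg hc.le (Finset.sum_nonneg fun i (_ : i ∈ Finset.univ) =>
      Finset.sum_nonneg fun j (_ : j ∈ Finset.univ) => hnn Q i j)
    linarith
  · obtain ⟨eQ, eY, h1, h2, h3, h4, h5⟩ := key Q hQ
    rw [h3, h4, ENNReal.ofReal_eq_ofReal_iff h1 h2] at he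
    rw [he, sub_self] at h5
    have h6 : ∑ i, ∑ j, ∫ z in Metric.ball (0 : ℂ) R, (Q z i j - Y z i j) ^ 2 = 0 :=
      le_antisymm (by by_contra! h; nlinarith [mul_pos hc h])
        (Finset.sum_nonneg fun i _ => Finset.sum_nonneg fun j _ => hnn Q i j)
    have h7 : ∀ i j, ∀ᵐ z ∂(volume.restrict (Metric.ball (0 : ℂ) R)), Q z i j = Y z i j := by
      intro i j
      have h8 := (Finset.sum_eq_zero_iff_of_nonneg (fun i _ =>
        Finset.sum_nonneg fun j _ => hnn Q i j)).1 h6 i (Finset.mem_univ _)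
      have h9 := (Finset.sum_eq_zero_iff_of_nonneg (fun j _ => hnn Q i j)).1 h8 j (Finset.mem_univ _)
      replace h9 := (integral_eq_zero_iff_of_nonneg (fun z => sq_nonneg _)
        ((hQ.mem_H1 i j).1.sub (hadm.mem_H1 i j).1).integrable_sq).1 h9
      filter_upwards [h9] with z hz
      exact sub_eq_zero.1 (pow_eq_zero_iff two_ne_zero |>.1 hz)
    simp only [← ae_all_iff] at h7
    filter_upwards [h7] with z hz
    ext i j
    exact hz i j

/-! ### Criticality under variations projected to the sphere -/

lemma hasDerivAt_zero_of_sq_bound {f : ℝ → ℝ} {C δ : ℝ} (hδ : 0 < δ)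
    (h : ∀ t, |t| ≤ δ → |f t - f 0| ≤ C * t ^ 2) : HasDerivAt f 0 0 := by
  have h1 : (fun t => f t - f 0) =O[𝓝 0] fun t : ℝ => ‖t - 0‖ ^ 2 := by
    refine Asymptotics.IsBigO.of_bound C ?_
    filter_upwards [Metric.closedBall_mem_nhds (0 : ℝ) hδ] with t ht
    have ht' : |t| ≤ δ := by simpa using ht
    simpa using h t ht'
  have h2 := (h1.hasFDerivAt (𝕜 := ℝ) one_lt_two).hasDerivAt
  simpa using h2.add_const (f 0)

/-- Uniform bounds for a family of functions on a disk which depends smoothly on a parameter. -/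
lemma exists_bound_pd {H : ℝ × ℂ → ℝ} {δ R : ℝ}
    (hH : ∀ t z, |t| ≤ δ → ContDiffAt ℝ ∞ H (t, z)) :
    ∃ C, ∀ t z, |t| ≤ δ → z ∈ Metric.ball (0 : ℂ) R →
      |H (t, z)| ≤ C ∧ ∀ l, |pd l (fun w => H (t, w)) z| ≤ C := by
  have hK : IsCompact (Icc (-δ) δ ×ˢ Metric.closedBall (0 : ℂ) R) :=
    isCompact_Icc.prod (isCompact_closedBall _ _)
  have hd : ∀ p ∈ Icc (-δ) δ ×ˢ Metric.closedBall (0 : ℂ) R, ContDiffAt ℝ ∞ H p := fun p hp =>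
    hH p.1 p.2 (abs_le.2 hp.1)
  obtain ⟨C₀, hC₀⟩ := hK.exists_bound_of_continuousOn (f := H)
    fun p hp => (hd p hp).continuousAt.continuousWithinAt
  have h1 : ∀ l : Fin 2, ∃ C, ∀ p ∈ Icc (-δ) δ ×ˢ Metric.closedBall (0 : ℂ) R,
      ‖fderiv ℝ H p ((0 : ℝ), dir l)‖ ≤ C := fun l =>
    hK.exists_bound_of_continuousOn fun p hp =>
      ((((hd p hp).fderiv_right (m := 0) (by simp)).continuousAt).clm_apply
        continuousAt_const).continuousWithinAt
  choose C hC using h1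
  refine ⟨max C₀ (max (C 0) (C 1)), fun t z ht hz => ?_⟩
  have hp : (t, z) ∈ Icc (-δ) δ ×ˢ Metric.closedBall (0 : ℂ) R :=
    ⟨abs_le.1 ht, Metric.ball_subset_closedBall hz⟩
  refine ⟨(hC₀ _ hp).trans (le_max_left _ _), fun l => ?_⟩
  have e : pd l (fun w => H (t, w)) z = fderiv ℝ H (t, z) ((0 : ℝ), dir l) := by
    have h2 : HasFDerivAt (fun w : ℂ => (t, w)) (ContinuousLinearMap.inr ℝ ℝ ℂ) z :=
      hasFDerivAt_prodMk_right t z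
    have h3 := ((hd _ hp).differentiableAt (by simp)).hasFDerivAt.comp z h2
    have h4 : fderiv ℝ (fun w => H (t, w)) z = _ := h3.fderiv
    rw [pd, h4]
    simp
  rw [e]
  refine (hC l _ hp).trans ?_
  fin_cases l
  · exact (le_max_left _ _).trans (le_max_right _ _)
  · exact (le_max_right _ _).trans (le_max_right _ _)

lemma add_smul_mem_S0 {A B : Matrix (Fin 3) (Fin 3) ℝ} (hA : A ∈ S0) (hB : B ∈ S0) (t : ℝ) :
    A + t • B ∈ S0 :=
  ⟨by rw [Matrix.transpose_add, Matrix.transpose_smul, hA.1, hB.1],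
    by rw [Matrix.trace_add, Matrix.trace_smul, hA.2, hB.2, smul_zero, add_zero]⟩

/-- Projecting `Y + t P` to the sphere through `Y` changes it by `t` times a smooth function. -/
lemma exists_projection_expansion {c R : ℝ} (hc : 0 < c) {Y P : ℂ → Matrix (Fin 3) (Fin 3) ℝ}
    (hYS : ∀ z, Y z ∈ S0) (hPS : ∀ z, P z ∈ S0) (hY : ∀ i j, ContDiff ℝ ∞ fun z => Y z i j)
    (hYn : ∀ z, ∑ i, ∑ j, Y z i j ^ 2 = c) (hP : ∀ i j, ContDiff ℝ ∞ fun z => P z i j)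
    (hP0 : ∀ z ∉ Metric.ball (0 : ℂ) R, P z = 0) :
    ∃ δ > 0, ∃ H : Fin 3 → Fin 3 → ℝ × ℂ → ℝ,
      (∀ i j t z, |t| ≤ δ → ContDiffAt ℝ ∞ (H i j) (t, z)) ∧
      (∀ i j t z, |t| ≤ δ → ((√c / √(normSq (Y z + t • P z))) • (Y z + t • P z)) i j =
        Y z i j + t * H i j (t, z)) ∧
      (∀ t z, |t| ≤ δ → normSq (Y z + t • P z) ≠ 0) := by
  -- a bound for the terms of order one and two of the squared norm
  obtain ⟨B, hB⟩ := (isCompact_closedBall (0 : ℂ) R).exists_bound_of_continuousOn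
    (f := fun z => ∑ i, ∑ j, (2 * |Y z i j * P z i j| + P z i j ^ 2)) (by
      have h1 := fun i j => (hY i j).continuous
      have h2 := fun i j => (hP i j).continuous
      fun_prop)
  have hB' : ∀ z, ∑ i, ∑ j, (2 * |Y z i j * P z i j| + P z i j ^ 2) ≤ |B| := by
    intro z
    by_cases hz : z ∈ Metric.ball (0 : ℂ) R
    · exact (le_abs_self _).trans ((hB z (Metric.ball_subset_closedBall hz)).trans (le_abs_self _))
    · simp [hP0 z hz]
  set m : ℝ × ℂ → ℝ := fun p => ∑ i, ∑ j, (Y p.2 i j + p.1 * P p.2 i j) ^ 2 with hm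
  -- This is the difference quotient of the squared norm: |Y + tP|² = c + t a.
  set a : ℝ × ℂ → ℝ := fun p => ∑ i, ∑ j, (2 * (Y p.2 i j * P p.2 i j) + p.1 * P p.2 i j ^ 2) with ha
  have hYp : ∀ i j, ContDiff ℝ ∞ fun p : ℝ × ℂ => Y p.2 i j := fun i j => (hY i j).comp contDiff_snd
  have hPp : ∀ i j, ContDiff ℝ ∞ fun p : ℝ × ℂ => P p.2 i j := fun i j => (hP i j).comp contDiff_snd
  have hmd : ContDiff ℝ ∞ m := ContDiff.sum fun i _ => ContDiff.sum fun j _ =>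
    ((hYp i j).add (contDiff_fst.mul (hPp i j))).pow 2
  have had : ContDiff ℝ ∞ a := ContDiff.sum fun i _ => ContDiff.sum fun j _ =>
    (contDiff_const.mul ((hYp i j).mul (hPp i j))).add (contDiff_fst.mul ((hPp i j).pow 2))
  have hma : ∀ t z, m (t, z) = c + t * a (t, z) := fun t z => by
    rw [← hYn z, hm, ha]
    simp only [Finset.mul_sum, ← Finset.sum_add_distrib]
    exact Finset.sum_congr rfl fun i _ => Finset.sum_congr rfl fun j _ => by ring
  have hmn : ∀ t z, normSq (Y z + t • P z) = m (t, z) := fun t z => by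
    rw [normSq_eq_sum (add_smul_mem_S0 (hYS z) (hPS z) t)]
    simp [hm]
  -- The bound |t| ≤ 1 makes |a| ≤ |B|, and the second bound then gives |ta| ≤ c/2, so the squared
  -- norm stays above c/2.
  have hδ : 0 < min 1 (c / (2 * (|B| + 1))) := by positivity
  have hpos : ∀ t z, |t| ≤ min 1 (c / (2 * (|B| + 1))) → 0 < m (t, z) := by
    intro t z ht
    have h1 : |t| ≤ 1 := ht.trans (min_le_left _ _)
    have h2 : |t| ≤ c / (2 * (|B| + 1)) := ht.trans (min_le_right _ _)
    have h3 : |a (t, z)| ≤ |B| := by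
      refine le_trans ?_ (hB' z)
      refine (Finset.abs_sum_le_sum_abs _ _).trans (Finset.sum_le_sum fun i _ => ?_)
      refine (Finset.abs_sum_le_sum_abs _ _).trans (Finset.sum_le_sum fun j _ => ?_)
      refine (abs_add_le _ _).trans ?_
      rw [abs_mul 2, abs_mul t, abs_two, abs_of_nonneg (sq_nonneg (P z i j))]
      nlinarith [sq_nonneg (P z i j)]
    have h4 : |t * a (t, z)| ≤ c / (2 * (|B| + 1)) * |B| := by
      rw [abs_mul]; gcongr
    have h5 : c / (2 * (|B| + 1)) * |B| ≤ c / 2 := by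
      rw [div_mul_eq_mul_div, div_le_div_iff₀ (by positivity) (by norm_num)]
      nlinarith [abs_nonneg B]
    rw [hma]
    linarith [(abs_le.1 h4).1]
  -- The factor t is extracted by rationalising: with m = c + ta, √c/√m - 1 = -ta/(√m(√c + √m)).
  refine ⟨_, hδ, fun i j p => -(a p / (√(m p) * (√c + √(m p)))) *
    (Y p.2 i j + p.1 * P p.2 i j) + P p.2 i j, fun i j t z ht => ?_, fun i j t z ht => ?_,
    fun t z ht => ?_⟩
  · have h1 : ContDiffAt ℝ ∞ (fun p => √(m p)) (t, z) := hmd.contDiffAt.sqrt (hpos t z ht).ne'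
    have h2 : √(m (t, z)) * (√c + √(m (t, z))) ≠ 0 := by
      have := hpos t z ht
      positivity
    exact ((had.contDiffAt.div (h1.mul (contDiffAt_const.add h1)) h2).neg.mul
      ((hYp i j).add (contDiff_fst.mul (hPp i j))).contDiffAt).add (hPp i j).contDiffAt
  · rw [hmn]
    have h1 := hpos t z ht
    have h2 := hma t z
    have h3 : 0 < √(m (t, z)) := Real.sqrt_pos.2 h1
    have h4 : 0 < √c := Real.sqrt_pos.2 hc
    have h5 : √(m (t, z)) ^ 2 = √c ^ 2 + t * a (t, z) := by
      rw [Real.sq_sqrt h1.le, Real.sq_sqrt hc.le, h2]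
    simp only [Matrix.smul_apply, Matrix.add_apply, smul_eq_mul]
    generalize √(m (t, z)) = x at *
    generalize √c = y at *
    generalize a (t, z) = b at *
    have h6 : y / x = 1 - t * (b / (x * (y + x))) := by
      field_simp
      linarith
    rw [h6]
    ring
  · rw [hmn]; exact (hpos t z ht).ne'

lemma toReal_dirichletEnergy_of_contDiff {R : ℝ} {Q : ℂ → Matrix (Fin 3) (Fin 3) ℝ}
    (hQ : ∀ i j, ContDiff ℝ ∞ fun z => Q z i j) :
    (dirichletEnergy R Q).toReal = 1 / 2 * ∑ i, ∑ j, ∑ l,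
      ∫ z in Metric.ball (0 : ℂ) R, pd l (fun w => Q w i j) z ^ 2 := by
  rw [dirichletEnergy_eq_ofReal (G := fun l z i j => fderiv ℝ (fun w => Q w i j) z (dir l))
    (fun i j => hasWeakGradient_of_contDiff (hQ i j))
    (fun l i j => (contDiff_fderiv_dir (hQ i j) l).continuous.memLp_two_ball), ENNReal.toReal_ofReal]
  · rfl
  · exact mul_nonneg (by norm_num) (Finset.sum_nonneg fun i _ => Finset.sum_nonneg fun j _ =>
      Finset.sum_nonneg fun l _ => integral_nonneg fun z => sq_nonneg _)

/-- A smooth map into a sphere all of whose entries solve `Δ f = - V f` is a critical point of the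
harmonic map problem. -/
theorem isCriticalHarmonic_of_solves {R s : ℝ} (hR : 0 < R) (hs : 0 < s) {k : ℤ} {V : ℂ → ℝ}
    {Y : ℂ → Matrix (Fin 3) (Fin 3) ℝ} (hV : Continuous V) (hYS : ∀ z, Y z ∈ S0)
    (hY : ∀ i j, SolvesSchrodinger (Metric.ball 0 R) V (fun z => Y z i j))
    (hYn : ∀ z, ∑ i, ∑ j, Y z i j ^ 2 = 2 / 3 * s ^ 2) (hadm : IsAdmissible R s k Y) :
    IsCriticalHarmonic R s k Y := by
  refine ⟨hadm, fun P hPS hPd _ hPs => ?_⟩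
  have hP0 : ∀ z ∉ Metric.ball (0 : ℂ) R, P z = 0 := fun z hz => by
    ext i j
    exact image_eq_zero_of_notMem_tsupport (f := fun z => P z i j) fun h => hz (hPs i j h)
  have hc : 0 < 2 / 3 * s ^ 2 := by positivity
  obtain ⟨δ, hδ, H, hH, hexp, hne⟩ := exists_projection_expansion (R := R) hc hYS hPS
    (fun i j => (hY i j).contDiff) hYn hPd hP0
  choose C hC using fun i j => exists_bound_pd (R := R) (hH i j)
  obtain ⟨CV, hCV⟩ := (isCompact_closedBall (0 : ℂ) R).exists_bound_of_continuousOn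
    hV.continuousOn
  set Q : ℝ → ℂ → Matrix (Fin 3) (Fin 3) ℝ := fun t z =>
    (√(2 / 3 * s ^ 2) / √(normSq (Y z + t • P z))) • (Y z + t • P z) with hQ
  have hQe : ∀ t, |t| ≤ δ → ∀ i j, (fun z => Q t z i j) = fun z => Y z i j + t * H i j (t, z) :=
    fun t ht i j => by ext z; exact hexp i j t z ht
  have hHt : ∀ t, |t| ≤ δ → ∀ i j, ContDiff ℝ ∞ fun z => H i j (t, z) := fun t ht i j =>
    contDiff_iff_contDiffAt.2 fun z =>
      (hH i j t z ht).comp z (contDiffAt_const.prodMk contDiffAt_id)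
  have hQd : ∀ t, |t| ≤ δ → ∀ i j, ContDiff ℝ ∞ fun z => Q t z i j := fun t ht i j => by
    rw [hQe t ht]; exact (hY i j).contDiff.add (contDiff_const.mul (hHt t ht i j))
  have hQ0 : Q 0 = Y := by
    ext z i j
    have := congr_fun (hQe 0 (by simpa using hδ.le) i j) z
    simpa using this
  -- As the variation is Y + tH with H and its first derivatives bounded uniformly in t, the
  -- quadratic energy difference is at most a constant times t².
  set vol := (volume : Measure ℂ).real (Metric.ball 0 R)
  have hfin : (volume : Measure ℂ) (Metric.ball 0 R) < ⊤ := measure_ball_lt_top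
  refine hasDerivAt_zero_of_sq_bound (C := 1 / 2 * ∑ i, ∑ j, (2 * C i j ^ 2 * vol +
    |CV| * C i j ^ 2 * vol)) hδ fun t ht => ?_
  change |(dirichletEnergy R (Q t)).toReal - (dirichletEnergy R (Q 0)).toReal| ≤ _
  rw [hQ0, toReal_dirichletEnergy_of_contDiff (hQd t ht),
    toReal_dirichletEnergy_of_contDiff fun i j => (hY i j).contDiff]
  have hpdQ : ∀ i j l z, pd l (fun w => Q t w i j) z - pd l (fun w => Y w i j) z =
      t * pd l (fun w => H i j (t, w)) z := fun i j l z => by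
    rw [hQe t ht, pd_add (hY i j).contDiff (contDiff_const.mul (hHt t ht i j)),
      pd_mul contDiff_const (hHt t ht i j), pd_const]
    ring
  -- P vanishes on the circle and Y already has the right norm, so the variation fixes the boundary
  -- values and Green's identity has no boundary term.
  have hcirc : ∀ i j θ, Q t (circleMap 0 R θ) i j - Y (circleMap 0 R θ) i j = 0 := by
    intro i j θ
    have h1 : P (circleMap 0 R θ) = 0 := hP0 _ (by simp [abs_of_pos hR])
    have h2 : normSq (Y (circleMap 0 R θ)) = 2 / 3 * s ^ 2 := by
      rw [normSq_eq_sum (hYS _), hYn]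
    simp only [hQ, h1, smul_zero, add_zero, h2]
    rw [div_self (Real.sqrt_pos.2 hc).ne', one_smul, sub_self]
  rw [energy_difference (V := V) (c := 2 / 3 * s ^ 2) (C := CV) (Y := Y) (Q := Q t)
    (y := fun i j l => pd l (fun w => Y w i j)) (p := fun i j l => pd l (fun w => Q t w i j))
    hV.aestronglyMeasurable
    ((ae_restrict_iff' Metric.isOpen_ball.measurableSet).2 (Eventually.of_forall fun z hz =>
      hCV z (Metric.ball_subset_closedBall hz)))
    (fun i j => (hY i j).contDiff.continuous.memLp_two_ball)
    (fun i j => (hQd t ht i j).continuous.memLp_two_ball)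
    (fun i j l => (contDiff_pd (hY i j).contDiff l).continuous.memLp_two_ball)
    (fun i j l => (contDiff_pd (hQd t ht i j) l).continuous.memLp_two_ball)
    (Eventually.of_forall hYn) (Eventually.of_forall fun z => ?_) fun i j => ?_]
  · rw [abs_mul, abs_of_pos (by norm_num : (0 : ℝ) < 1 / 2), mul_assoc]
    refine mul_le_mul_of_nonneg_left ?_ (by norm_num)
    rw [Finset.sum_mul]
    refine (Finset.abs_sum_le_sum_abs _ _).trans (Finset.sum_le_sum fun i _ => ?_)
    rw [Finset.sum_mul]
    refine (Finset.abs_sum_le_sum_abs _ _).trans (Finset.sum_le_sum fun j _ => ?_)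
    have hb1 : ∀ l, |∫ z in Metric.ball (0 : ℂ) R, (pd l (fun w => Q t w i j) z -
        pd l (fun w => Y w i j) z) ^ 2| ≤ t ^ 2 * C i j ^ 2 * vol := fun l => by
        rw [← Real.norm_eq_abs]
        refine norm_setIntegral_le_of_norm_le_const hfin fun z hz => ?_
        have := (hC i j t z ht hz).2 l
        rw [hpdQ, mul_pow, Real.norm_eq_abs, abs_of_nonneg (by positivity)]
        exact mul_le_mul_of_nonneg_left (sq_le_sq' (abs_le.1 this).1 (abs_le.1 this).2)
          (sq_nonneg t)
    have hb2 : |∫ z in Metric.ball (0 : ℂ) R, V z * (Q t z i j - Y z i j) ^ 2| ≤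
        |CV| * (t ^ 2 * C i j ^ 2) * vol := by
        rw [← Real.norm_eq_abs]
        refine norm_setIntegral_le_of_norm_le_const hfin fun z hz => ?_
        have h1 := (hC i j t z ht hz).1
        have h2 : Q t z i j - Y z i j = t * H i j (t, z) := by
          rw [congr_fun (hQe t ht i j) z]; ring
        rw [h2, norm_mul, mul_pow]
        have h3 : ‖t ^ 2 * H i j (t, z) ^ 2‖ ≤ t ^ 2 * C i j ^ 2 := by
          rw [Real.norm_eq_abs, abs_of_nonneg (by positivity)]
          exact mul_le_mul_of_nonneg_left (sq_le_sq' (abs_le.1 h1).1 (abs_le.1 h1).2) (sq_nonneg t)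
        exact mul_le_mul ((hCV z (Metric.ball_subset_closedBall hz)).trans (le_abs_self _)) h3
          (norm_nonneg _) (abs_nonneg _)
    refine (abs_sub _ _).trans ?_
    rw [Fin.sum_univ_two]
    have := abs_add_le (∫ z in Metric.ball (0 : ℂ) R, (pd 0 (fun w => Q t w i j) z -
        pd 0 (fun w => Y w i j) z) ^ 2) (∫ z in Metric.ball (0 : ℂ) R, (pd 1 (fun w => Q t w i j) z -
        pd 1 (fun w => Y w i j) z) ^ 2)
    linarith [hb1 0, hb1 1, hb2]
  · have h1 := hne t z ht
    have h2 := add_smul_mem_S0 (hYS z) (hPS z) t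
    have h3 : 0 ≤ normSq (Y z + t • P z) := by
      rw [normSq_eq_sum h2]
      exact Finset.sum_nonneg fun i _ => Finset.sum_nonneg fun j _ => sq_nonneg _
    simp only [hQ, Matrix.smul_apply, smul_eq_mul, mul_pow, ← Finset.mul_sum]
    rw [← normSq_eq_sum h2, div_pow, Real.sq_sqrt hc.le, Real.sq_sqrt h3]
    field_simp
  · have h1 := (hY i j).integral_fderiv_mul hR hV ((hQd t ht i j).sub (hY i j).contDiff)
    simp only [hcirc, mul_zero, intervalIntegral.integral_zero, add_zero] at h1
    rw [← h1, integral_finsetSum]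
    · refine Finset.sum_congr rfl fun l _ => integral_congr_ae (Eventually.of_forall fun z => ?_)
      have h2 : fderiv ℝ (fun x => Q t x i j - Y x i j) z (dir l) = _ := congr_arg (· (dir l))
        (((hasFDerivAt_of_contDiff (hQd t ht i j) z).fun_sub
          (hasFDerivAt_of_contDiff (hY i j).contDiff z)).fderiv)
      simp only [h2]
      rfl
    · exact fun l _ => integrableOn_ball_of_continuous
        ((contDiff_fderiv_dir (hY i j).contDiff l).continuous.mul (contDiff_fderiv_dir
          ((hQd t ht i j).sub (hY i j).contDiff) l).continuous)

/-! ## The first variation of the one-dimensional energy -/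

lemma MemLp.bdd_mul_two {α : Type*} [MeasurableSpace α] {μ : Measure α} {f g : α → ℝ} {C : ℝ}
    (hf : MemLp f 2 μ) (hg : AEMeasurable g μ) (hC : ∀ᵐ x ∂μ, |g x| ≤ C) :
    MemLp (fun x => g x * f x) 2 μ :=
  hf.of_le_mul (hg.aestronglyMeasurable.mul hf.1) (c := C) (by
    filter_upwards [hC] with z hz
    rw [norm_mul]
    exact mul_le_mul_of_nonneg_right hz (norm_nonneg _))

lemma hasDerivAt_quotients {A B m : ℝ → ℝ} {A' B' m' t : ℝ} (hA : HasDerivAt A A' t)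
    (hm : HasDerivAt m m' t) (hB : HasDerivAt B B' t) (h0 : m t ≠ 0) :
    HasDerivAt (fun t => A t ^ 2 / m t ^ 2 + B t ^ 2 / m t)
      ((2 * A t * A') / m t ^ 2 - A t ^ 2 * (2 * m') / m t ^ 3 + 2 * B t * B' / m t
        - B t ^ 2 * m' / m t ^ 2) t := by
  refine (((hA.fun_pow 2).fun_div (hm.fun_pow 2) (pow_ne_zero 2 h0)).fun_add
    ((hB.fun_pow 2).fun_div hm h0)).congr_deriv ?_
  field_simp
  ring

/-- Differentiation under the integral sign for the projected energy density. -/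
lemma hasDerivAt_integral_projected {α : Type*} [MeasurableSpace α] {μ : Measure α}
    {A₀ A₁ A₂ B₀ B₁ p q : α → ℝ} {c M : ℝ} (hc : 0 < c)
    (hA₀ : MemLp A₀ 2 μ) (hA₁ : MemLp A₁ 2 μ) (hA₂ : MemLp A₂ 2 μ) (hB₀ : MemLp B₀ 2 μ)
    (hB₁ : MemLp B₁ 2 μ) (hp : AEMeasurable p μ) (hq : AEMeasurable q μ)
    (hpM : ∀ᵐ x ∂μ, |p x| ≤ M) (hqM : ∀ᵐ x ∂μ, |q x| ≤ M) :
    Integrable (fun x => 2 * A₀ x * A₁ x / c ^ 2 - 4 * A₀ x ^ 2 * p x / c ^ 3 +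
      2 * B₀ x * B₁ x / c - 2 * B₀ x ^ 2 * p x / c ^ 2) μ ∧
    HasDerivAt (fun t : ℝ => ∫ x, ((A₀ x + t * A₁ x + t ^ 2 * A₂ x) ^ 2 /
        (c + 2 * t * p x + t ^ 2 * q x) ^ 2 + (B₀ x + t * B₁ x) ^ 2 /
        (c + 2 * t * p x + t ^ 2 * q x)) ∂μ)
      (∫ x, (2 * A₀ x * A₁ x / c ^ 2 - 4 * A₀ x ^ 2 * p x / c ^ 3 +
      2 * B₀ x * B₁ x / c - 2 * B₀ x ^ 2 * p x / c ^ 2) ∂μ) 0 := by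
  have mA₀ := hA₀.1.aemeasurable
  have mA₁ := hA₁.1.aemeasurable
  have mA₂ := hA₂.1.aemeasurable
  have mB₀ := hB₀.1.aemeasurable
  have mB₁ := hB₁.1.aemeasurable
  -- For |t| ≤ δ one has |t(2p + tq)| ≤ c/2, so the denominator stays above c/2 and its inverse
  -- below 2/c.
  set δ : ℝ := min 1 (c / (2 * (3 * |M| + 1))) with hδ
  have hδ0 : 0 < δ := by positivity
  set F' : ℝ → α → ℝ := fun t x =>
    (2 * (A₀ x + t * A₁ x + t ^ 2 * A₂ x) * (A₁ x + 2 * t * A₂ x)) /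
        (c + 2 * t * p x + t ^ 2 * q x) ^ 2
      - (A₀ x + t * A₁ x + t ^ 2 * A₂ x) ^ 2 * (2 * (2 * p x + 2 * t * q x)) /
        (c + 2 * t * p x + t ^ 2 * q x) ^ 3
      + 2 * (B₀ x + t * B₁ x) * B₁ x / (c + 2 * t * p x + t ^ 2 * q x)
      - (B₀ x + t * B₁ x) ^ 2 * (2 * p x + 2 * t * q x) /
        (c + 2 * t * p x + t ^ 2 * q x) ^ 2 with hF'
  -- For |t| ≤ 1 these dominate the numerators as well as their derivatives in t; the factor 2 comes
  -- from differentiating t².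
  set S : α → ℝ := fun x => |A₀ x| + |A₁ x| + 2 * |A₂ x| with hS
  set T : α → ℝ := fun x => |B₀ x| + |B₁ x| with hT
  have hS2 : MemLp S 2 μ := (hA₀.abs.add hA₁.abs).add (hA₂.abs.const_mul 2)
  have hT2 : MemLp T 2 μ := hB₀.abs.add hB₁.abs
  have hm : ∀ x, |p x| ≤ M → |q x| ≤ M → ∀ t ∈ Metric.closedBall (0 : ℝ) δ,
      c / 2 ≤ c + 2 * t * p x + t ^ 2 * q x ∧ |2 * p x + 2 * t * q x| ≤ 4 * |M| ∧ |t| ≤ 1 := by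
    intro x h1 h2 t ht
    have ht' : |t| ≤ δ := by simpa using ht
    have h3 : |t| ≤ 1 := ht'.trans (min_le_left _ _)
    have h4 : |t| ≤ c / (2 * (3 * |M| + 1)) := ht'.trans (min_le_right _ _)
    have h1' := h1.trans (le_abs_self M)
    have h2' := h2.trans (le_abs_self M)
    have h5 : |t * q x| ≤ |M| := by
      rw [abs_mul]
      calc |t| * |q x| ≤ 1 * |M| := by gcongr
        _ = |M| := one_mul _
    have h6 : |2 * p x + t * q x| ≤ 3 * |M| := by
      refine (abs_add_le _ _).trans ?_
      rw [abs_mul, abs_two]; linarith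
    have h7 : |t * (2 * p x + t * q x)| ≤ c / (2 * (3 * |M| + 1)) * (3 * |M|) := by
      rw [abs_mul]; gcongr
    have h8 : c / (2 * (3 * |M| + 1)) * (3 * |M|) ≤ c / 2 := by
      rw [div_mul_eq_mul_div, div_le_div_iff₀ (by positivity) (by norm_num)]
      nlinarith [abs_nonneg M]
    refine ⟨?_, ?_, h3⟩
    · have := (abs_le.1 h7).1
      linarith [show t * (2 * p x + t * q x) = 2 * t * p x + t ^ 2 * q x by ring]
    · refine (abs_add_le _ _).trans ?_
      rw [abs_mul, abs_two, mul_assoc, abs_mul, abs_two]; linarith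
  have key := hasDerivAt_integral_of_dominated_loc_of_deriv_le (μ := μ) (x₀ := (0 : ℝ))
    (F := fun t x => (A₀ x + t * A₁ x + t ^ 2 * A₂ x) ^ 2 /
        (c + 2 * t * p x + t ^ 2 * q x) ^ 2 + (B₀ x + t * B₁ x) ^ 2 /
        (c + 2 * t * p x + t ^ 2 * q x)) (F' := F')
    (bound := fun x => (2 * (2 / c) ^ 2 + 8 * |M| * (2 / c) ^ 3) * S x ^ 2 +
      (2 * (2 / c) + 4 * |M| * (2 / c) ^ 2) * T x ^ 2)
    (Metric.closedBall_mem_nhds 0 hδ0)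
    (Eventually.of_forall fun t => AEMeasurable.aestronglyMeasurable (by fun_prop))
    (by
      have := (hA₀.integrable_sq.div_const (c ^ 2)).add (hB₀.integrable_sq.div_const c)
      refine this.congr (Eventually.of_forall fun x => ?_)
      simp)
    (AEMeasurable.aestronglyMeasurable (by fun_prop))
    (by
      filter_upwards [hpM, hqM] with x h1 h2 t ht
      obtain ⟨h3, h4, h5⟩ := hm x h1 h2 t ht
      have h5' : t ^ 2 ≤ 1 := by rw [← sq_abs]; exact pow_le_one₀ (abs_nonneg _) h5
      have hA : |A₀ x + t * A₁ x + t ^ 2 * A₂ x| ≤ S x := by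
        refine (abs_add_le _ _).trans ((add_le_add_left (abs_add_le _ _) _).trans ?_)
        rw [abs_mul, abs_mul, abs_of_nonneg (sq_nonneg t)]
        have := mul_le_mul_of_nonneg_right h5 (abs_nonneg (A₁ x))
        have := mul_le_mul_of_nonneg_right h5' (abs_nonneg (A₂ x))
        simp only [hS]; linarith [abs_nonneg (A₂ x)]
      have hA' : |A₁ x + 2 * t * A₂ x| ≤ S x := by
        refine (abs_add_le _ _).trans ?_
        rw [abs_mul, abs_mul, abs_two]
        have := mul_le_mul_of_nonneg_right h5 (abs_nonneg (A₂ x))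
        simp only [hS]; linarith [abs_nonneg (A₀ x)]
      have hB : |B₀ x + t * B₁ x| ≤ T x := by
        refine (abs_add_le _ _).trans ?_
        rw [abs_mul]
        have := mul_le_mul_of_nonneg_right h5 (abs_nonneg (B₁ x))
        simp only [hT]; linarith
      have hB' : |B₁ x| ≤ T x := by simp only [hT]; linarith [abs_nonneg (B₀ x)]
      simp only [hF']
      generalize A₀ x + t * A₁ x + t ^ 2 * A₂ x = A at *
      generalize A₁ x + 2 * t * A₂ x = A' at *
      generalize B₀ x + t * B₁ x = B at *
      generalize 2 * p x + 2 * t * q x = m' at *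
      have hS0 : 0 ≤ S x := (abs_nonneg _).trans hA
      have hT0 : 0 ≤ T x := (abs_nonneg _).trans hB
      have hmi : (c + 2 * t * p x + t ^ 2 * q x)⁻¹ ≤ 2 / c := by
        rw [show 2 / c = (c / 2)⁻¹ by field_simp]
        exact inv_anti₀ (by positivity) h3
      have hm0 : 0 ≤ (c + 2 * t * p x + t ^ 2 * q x)⁻¹ := inv_nonneg.2 (by linarith)
      simp only [div_eq_mul_inv _ (c + 2 * t * p x + t ^ 2 * q x),
        div_eq_mul_inv _ ((c + 2 * t * p x + t ^ 2 * q x) ^ _), ← inv_pow]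
      generalize (c + 2 * t * p x + t ^ 2 * q x)⁻¹ = y at *
      have e1 : |2 * A * A' * y ^ 2| ≤ 2 * S x * S x * (2 / c) ^ 2 := by
        rw [abs_mul, abs_mul, abs_mul, abs_two, abs_of_nonneg (by positivity : 0 ≤ y ^ 2)]; gcongr
      have e2 : |A ^ 2 * (2 * m') * y ^ 3| ≤ S x ^ 2 * (2 * (4 * |M|)) * (2 / c) ^ 3 := by
        rw [abs_mul, abs_mul, abs_mul, abs_two, abs_pow, abs_of_nonneg (by positivity : 0 ≤ y ^ 3)]
        gcongr
      have e3 : |2 * B * B₁ x * y| ≤ 2 * T x * T x * (2 / c) := by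
        rw [abs_mul, abs_mul, abs_mul, abs_two, abs_of_nonneg hm0]; gcongr
      have e4 : |B ^ 2 * m' * y ^ 2| ≤ T x ^ 2 * (4 * |M|) * (2 / c) ^ 2 := by
        rw [abs_mul, abs_mul, abs_pow, abs_of_nonneg (by positivity : 0 ≤ y ^ 2)]; gcongr
      rw [Real.norm_eq_abs]
      have := abs_sub (2 * A * A' * y ^ 2 - A ^ 2 * (2 * m') * y ^ 3 + 2 * B * B₁ x * y)
        (B ^ 2 * m' * y ^ 2)
      have := abs_add_le (2 * A * A' * y ^ 2 - A ^ 2 * (2 * m') * y ^ 3) (2 * B * B₁ x * y)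
      have := abs_sub (2 * A * A' * y ^ 2) (A ^ 2 * (2 * m') * y ^ 3)
      linarith)
    ((hS2.integrable_sq.const_mul _).add (hT2.integrable_sq.const_mul _))
    (by
      filter_upwards [hpM, hqM] with x h1 h2 t ht
      obtain ⟨h3, -, -⟩ := hm x h1 h2 t ht
      have h0 : c + 2 * t * p x + t ^ 2 * q x ≠ 0 := by linarith
      have hid := hasDerivAt_id' t
      have dm : HasDerivAt (fun t => c + 2 * t * p x + t ^ 2 * q x) (2 * p x + 2 * t * q x) t := by
        have := (((hid.const_mul 2).mul_const (p x)).const_add c).add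
          ((hid.pow 2).mul_const (q x))
        exact this.congr_deriv (by simp)
      have dA : HasDerivAt (fun t => A₀ x + t * A₁ x + t ^ 2 * A₂ x) (A₁ x + 2 * t * A₂ x) t := by
        have := ((hid.mul_const (A₁ x)).const_add (A₀ x)).add ((hid.pow 2).mul_const (A₂ x))
        exact this.congr_deriv (by simp)
      have dB : HasDerivAt (fun t => B₀ x + t * B₁ x) (B₁ x) t := by
        simpa using (hid.mul_const (B₁ x)).const_add (B₀ x)
      exact hasDerivAt_quotients dA dm dB h0)
  have e : F' 0 = fun x => 2 * A₀ x * A₁ x / c ^ 2 - 4 * A₀ x ^ 2 * p x / c ^ 3 +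
      2 * B₀ x * B₁ x / c - 2 * B₀ x ^ 2 * p x / c ^ 2 := by
    ext x; simp only [hF']; ring_nf
  rw [e] at key
  exact key

/-- The points R/(n + 2) form a countable exhaustion of (0, R), so statements holding almost
everywhere on every [ε, R] combine. The shift by 2 keeps even the first point strictly below R. -/
lemma exists_lt_of_pos {R x : ℝ} (hR : 0 < R) (hx : 0 < x) :
    ∃ n : ℕ, R / ((n : ℝ) + 2) < x ∧ R / ((n : ℝ) + 2) ∈ Ioo 0 R := by
  obtain ⟨n, hn⟩ := exists_nat_gt (R / x)
  have hn0 : (0 : ℝ) ≤ n := n.cast_nonneg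
  refine ⟨n, ?_, by positivity, ?_⟩
  · rw [div_lt_iff₀ (by positivity)]
    rw [div_lt_iff₀ hx] at hn
    nlinarith
  · rw [div_lt_iff₀ (by positivity)]
    nlinarith

lemma ae_differentiableAt_of_ac {R : ℝ} (hR : 0 < R) {f : ℝ → ℝ}
    (hf : ∀ ε ∈ Ioo 0 R, AbsolutelyContinuousOnInterval f ε R) :
    ∀ᵐ x ∂(volume.restrict (Ioo 0 R)), DifferentiableAt ℝ f x := by
  have h1 : ∀ n : ℕ, ∀ᵐ x, x ∈ uIcc (R / ((n : ℝ) + 2)) R → DifferentiableAt ℝ f x := fun n =>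
    (hf _ (exists_lt_of_pos (R := R) (x := R / ((n : ℝ) + 1)) hR (by positivity) |>.elim
      fun _ _ => ⟨by positivity, by
        rw [div_lt_iff₀ (by positivity)]; nlinarith [n.cast_nonneg (α := ℝ)]⟩)).ae_differentiableAt
  rw [ae_restrict_iff' measurableSet_Ioo]
  filter_upwards [ae_all_iff.2 h1] with x hx hxR
  obtain ⟨n, hn, hn'⟩ := exists_lt_of_pos hR hxR.1
  refine hx n ?_
  rw [uIcc_of_le hn'.2.le]
  exact ⟨hn.le, hxR.2.le⟩

lemma continuousOn_Ioc_of_ac {R : ℝ} {f : ℝ → ℝ}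
    (hf : ∀ ε ∈ Ioo 0 R, AbsolutelyContinuousOnInterval f ε R) : ContinuousOn f (Ioc 0 R) := by
  intro x hx
  have hε : x / 2 ∈ Ioo 0 R := ⟨by linarith [hx.1], by linarith [hx.1, hx.2]⟩
  have h1 := (hf _ hε).continuousOn
  rw [uIcc_of_le hε.2.le] at h1
  have h2 := h1 x ⟨by linarith [hx.1], hx.2⟩
  refine h2.mono_of_mem_nhdsWithin ?_
  rw [mem_nhdsWithin]
  exact ⟨Ioi (x / 2), isOpen_Ioi, by simpa using hx.1, fun y hy => ⟨le_of_lt hy.1, hy.2.2⟩⟩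

/-- A curve of constant norm ρ moves only tangentially: its speed is ρ times the angular velocity of
p, which is the cross product of p and p' divided by |p|². The radial part of p' drops out. -/
lemma deriv_sq_projected {ρ q₁ q₂ r : ℝ} {p₁ p₂ : ℝ → ℝ} (h₁ : HasDerivAt p₁ q₁ r)
    (h₂ : HasDerivAt p₂ q₂ r) (h0 : 0 < p₁ r ^ 2 + p₂ r ^ 2) :
    deriv (fun x => scale ρ (p₁ x) (p₂ x) * p₁ x) r ^ 2 +
      deriv (fun x => scale ρ (p₁ x) (p₂ x) * p₂ x) r ^ 2 =
      ρ ^ 2 * ((p₁ r * q₂ - p₂ r * q₁) ^ 2 / (p₁ r ^ 2 + p₂ r ^ 2) ^ 2) := by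
  have hs : 0 < √(p₁ r ^ 2 + p₂ r ^ 2) := Real.sqrt_pos.2 h0
  have hN : HasDerivAt (fun x => √(p₁ x ^ 2 + p₂ x ^ 2))
      ((p₁ r * q₁ + p₂ r * q₂) / √(p₁ r ^ 2 + p₂ r ^ 2)) r := by
    refine (((h₁.fun_pow 2).fun_add (h₂.fun_pow 2)).sqrt h0.ne').congr_deriv ?_
    field_simp
    ring
  have hsc : HasDerivAt (fun x => scale ρ (p₁ x) (p₂ x))
      (-(ρ * ((p₁ r * q₁ + p₂ r * q₂) / √(p₁ r ^ 2 + p₂ r ^ 2))) / √(p₁ r ^ 2 + p₂ r ^ 2) ^ 2) r := by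
    refine ((hasDerivAt_const r ρ).fun_div hN hs.ne').congr_deriv ?_
    simp
  rw [(hsc.fun_mul h₁).deriv, (hsc.fun_mul h₂).deriv]
  have e : √(p₁ r ^ 2 + p₂ r ^ 2) ^ 2 = p₁ r ^ 2 + p₂ r ^ 2 := Real.sq_sqrt h0.le
  simp only [scale]
  generalize √(p₁ r ^ 2 + p₂ r ^ 2) = N at *
  have e2 : p₂ r ^ 2 = N ^ 2 - p₁ r ^ 2 := by linarith
  rw [← e]
  field_simp
  linear_combination ρ ^ 2 * ((p₁ r * q₁ + p₂ r * q₂) ^ 2 - N ^ 2 * (q₁ ^ 2 + q₂ ^ 2)) * e2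

lemma scale_mul_sq_add {ρ x y : ℝ} (h0 : 0 < x ^ 2 + y ^ 2) :
    (scale ρ x y * x) ^ 2 + (scale ρ x y * y) ^ 2 = ρ ^ 2 := by
  have hs : √(x ^ 2 + y ^ 2) ^ 2 = x ^ 2 + y ^ 2 := Real.sq_sqrt h0.le
  rw [scale, mul_pow, mul_pow, div_pow, hs]
  field_simp

lemma E0_eq_lintegral {a c R : ℝ} {k : ℤ} {u v : ℝ → ℝ}
    (h : ∀ r ∈ Ioo 0 R, u r ^ 2 + v r ^ 2 = a ^ 2 / c ^ 2) :
    E0 a c R k u v = ∫⁻ r in Ioo 0 R, ENNReal.ofReal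
      (1 / 2 * (deriv u r ^ 2 + deriv v r ^ 2 + (k : ℝ) ^ 2 / r ^ 2 * u r ^ 2) * r) := if_pos h

lemma constraint_of_E0_ne_top {a c R : ℝ} {k : ℤ} {u v : ℝ → ℝ} (h : E0 a c R k u v ≠ ⊤) :
    ∀ r ∈ Ioo 0 R, u r ^ 2 + v r ^ 2 = a ^ 2 / c ^ 2 := by
  by_contra hn
  exact h (if_neg hn)

lemma mul_deriv_add_mul_deriv_eq_zero {R C r : ℝ} {u v : ℝ → ℝ}
    (hcon : ∀ r ∈ Ioo 0 R, u r ^ 2 + v r ^ 2 = C) (hr : r ∈ Ioo 0 R)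
    (hu : DifferentiableAt ℝ u r) (hv : DifferentiableAt ℝ v r) :
    u r * deriv u r + v r * deriv v r = 0 := by
  have h1 := (hu.hasDerivAt.fun_pow 2).fun_add (hv.hasDerivAt.fun_pow 2)
  have h2 : (fun x => u x ^ 2 + v x ^ 2) =ᶠ[𝓝 r] fun _ => C := by
    filter_upwards [isOpen_Ioo.mem_nhds hr] with x hx using hcon x hx
  have h3 := h1.unique ((hasDerivAt_const r C).congr_of_eventuallyEq h2)
  norm_num at h3
  linarith

/-- The angular momentum `u v' - v u'`. -/
def angMom (u v : ℝ → ℝ) (r : ℝ) : ℝ := u r * deriv v r - v r * deriv u r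

/-- The density of the first variation of `E0` in the direction `(ξ, η)`. -/
def firstVarDensity (k : ℤ) (u v ξ η : ℝ → ℝ) (r : ℝ) : ℝ :=
  -(r * angMom u v r * (deriv ξ r * v r + ξ r * deriv v r - deriv η r * u r - η r * deriv u r))
    + (k : ℝ) ^ 2 / r * (u r * v r * (ξ r * v r - η r * u r))

/-- Here x stands for √r and W for the angular momentum. The hypotheses on U' and V' say that the
derivative of the pair is tangential; only the component ξv - ηu of the variation survives. -/
lemma firstVar_algebra {C x k U V U' V' X Y X' Y' W : ℝ} (hC : C ≠ 0) (hx : x ≠ 0)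
    (hc : U ^ 2 + V ^ 2 = C) (e1 : C * U' = -(V * W)) (e2 : C * V' = U * W) :
    C / 2 * (2 * (x * W) * (x * (U * Y' + X * V' - V * X' - Y * U')) / C ^ 2 -
      4 * (x * W) ^ 2 * (U * X + V * Y) / C ^ 3 + 2 * (k * (U / x)) * (k * (X / x)) / C -
      2 * (k * (U / x)) ^ 2 * (U * X + V * Y) / C ^ 2) =
    C⁻¹ * (-(x ^ 2 * W * (X' * V + X * V' - Y' * U - Y * U')) +
      k ^ 2 / x ^ 2 * (U * V * (X * V - Y * U))) := by
  have e1' : U' = -(V * W) / C := by field_simp; linarith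
  have e2' : V' = U * W / C := by field_simp; linarith
  rw [e1', e2']
  field_simp
  rw [← hc]
  ring

/-- The first variation of the one-dimensional energy. -/
theorem hasDerivAt_E0 {a c R s : ℝ} (hR : 0 < R) {k : ℤ} {u v : ℝ → ℝ} (ha : 0 < a ^ 2 / c ^ 2)
    (huv : MemS R s u v) (hcon : ∀ r ∈ Ioo 0 R, u r ^ 2 + v r ^ 2 = a ^ 2 / c ^ 2)
    {ξ η : ℝ → ℝ} (hξ : ContDiff ℝ ∞ ξ) (hη : ContDiff ℝ ∞ η) (hξ0 : ξ 0 = 0) :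
    Integrable (firstVarDensity k u v ξ η) (volume.restrict (Ioo 0 R)) ∧
    HasDerivAt (fun t : ℝ => (E0 a c R k
      (fun r => scale √(a ^ 2 / c ^ 2) (u r + t * ξ r) (v r + t * η r) * (u r + t * ξ r))
      (fun r => scale √(a ^ 2 / c ^ 2) (u r + t * ξ r) (v r + t * η r) * (v r + t * η r))).toReal)
      ((a ^ 2 / c ^ 2)⁻¹ * ∫ r in Ioo 0 R, firstVarDensity k u v ξ η r) 0 := by
  have hρ2 : √(a ^ 2 / c ^ 2) ^ 2 = a ^ 2 / c ^ 2 := Real.sq_sqrt ha.le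
  generalize √(a ^ 2 / c ^ 2) = ρ at *
  set C := a ^ 2 / c ^ 2 with hC
  set μ := volume.restrict (Ioo 0 R) with hμ
  have hae : ∀ {p : ℝ → Prop}, (∀ r ∈ Ioo 0 R, p r) → ∀ᵐ r ∂μ, p r := fun h =>
    (ae_restrict_iff' measurableSet_Ioo).2 (Eventually.of_forall h)
  -- regularity and bounds
  have mu : AEMeasurable u μ := ((continuousOn_Ioc_of_ac huv.ac_u).mono
    Ioo_subset_Ioc_self).aemeasurable measurableSet_Ioo
  have mv : AEMeasurable v μ := ((continuousOn_Ioc_of_ac huv.ac_v).mono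
    Ioo_subset_Ioc_self).aemeasurable measurableSet_Ioo
  have hξd := hξ.continuous_deriv (by simp)
  have hηd := hη.continuous_deriv (by simp)
  obtain ⟨M₁, hM₁⟩ := (isCompact_Icc (a := 0) (b := R)).exists_bound_of_continuousOn
    hξ.continuous.continuousOn
  obtain ⟨M₂, hM₂⟩ := (isCompact_Icc (a := 0) (b := R)).exists_bound_of_continuousOn
    hη.continuous.continuousOn
  obtain ⟨M₃, hM₃⟩ := (isCompact_Icc (a := 0) (b := R)).exists_bound_of_continuousOn
    hξd.continuousOn
  obtain ⟨M₄, hM₄⟩ := (isCompact_Icc (a := 0) (b := R)).exists_bound_of_continuousOn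
    hηd.continuousOn
  have bξ := hae fun r hr => hM₁ r (Ioo_subset_Icc_self hr)
  have bη := hae fun r hr => hM₂ r (Ioo_subset_Icc_self hr)
  have bξ' := hae fun r hr => hM₃ r (Ioo_subset_Icc_self hr)
  have bη' := hae fun r hr => hM₄ r (Ioo_subset_Icc_self hr)
  have mξ : AEMeasurable ξ μ := hξ.continuous.aemeasurable
  have mη : AEMeasurable η μ := hη.continuous.aemeasurable
  have mξ' : AEMeasurable (deriv ξ) μ := hξd.aemeasurable
  have mη' : AEMeasurable (deriv η) μ := hηd.aemeasurable
  have bu : ∀ᵐ r ∂μ, |u r| ≤ √C := hae fun r hr =>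
    Real.abs_le_sqrt (by nlinarith [hcon r hr, sq_nonneg (v r)])
  have bv : ∀ᵐ r ∂μ, |v r| ≤ √C := hae fun r hr =>
    Real.abs_le_sqrt (by nlinarith [hcon r hr, sq_nonneg (u r)])
  have hfinμ : IsFiniteMeasure μ := ⟨by rw [hμ, Measure.restrict_apply_univ]; simp⟩
  have msqrt : AEMeasurable (fun r : ℝ => √r) μ := Real.continuous_sqrt.aemeasurable
  have hsqrt : MemLp (fun r : ℝ => √r) 2 μ := by
    refine MemLp.of_bound msqrt.aestronglyMeasurable √R (hae fun r hr => ?_)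
    rw [Real.norm_eq_abs, abs_of_nonneg (Real.sqrt_nonneg _)]
    exact Real.sqrt_le_sqrt hr.2.le
  -- the quadratic forms
  have hA₀ : MemLp (fun r => √r * angMom u v r) 2 μ := by
    refine ((MemLp.bdd_mul_two huv.deriv_v mu bu).sub
      (MemLp.bdd_mul_two huv.deriv_u mv bv)).ae_eq (Eventually.of_forall fun r => ?_)
    simp only [Pi.sub_apply, angMom]; ring
  have hA₁ : MemLp (fun r => √r * (u r * deriv η r + ξ r * deriv v r - v r * deriv ξ r
      - η r * deriv u r)) 2 μ := by
    refine ((((MemLp.bdd_mul_two (MemLp.bdd_mul_two hsqrt mη' bη') mu bu).add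
      (MemLp.bdd_mul_two huv.deriv_v mξ bξ)).sub
      (MemLp.bdd_mul_two (MemLp.bdd_mul_two hsqrt mξ' bξ') mv bv)).sub
      (MemLp.bdd_mul_two huv.deriv_u mη bη)).ae_eq (Eventually.of_forall fun r => ?_)
    simp only [Pi.sub_apply, Pi.add_apply]; ring
  have hA₂ : MemLp (fun r => √r * (ξ r * deriv η r - η r * deriv ξ r)) 2 μ := by
    refine ((MemLp.bdd_mul_two (MemLp.bdd_mul_two hsqrt mη' bη') mξ bξ).sub
      (MemLp.bdd_mul_two (MemLp.bdd_mul_two hsqrt mξ' bξ') mη bη)).ae_eq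
      (Eventually.of_forall fun r => ?_)
    simp only [Pi.sub_apply]; ring
  have hB₀ : MemLp (fun r => (k : ℝ) * (u r / √r)) 2 μ := huv.val_u.const_mul _
  -- Because ξ(0) = 0 and |ξ'| ≤ M₃, one has |ξ| ≤ M₃ r, so ξ/√r is bounded by M₃√r.
  have hB₁ : MemLp (fun r => (k : ℝ) * (ξ r / √r)) 2 μ := by
    refine MemLp.const_mul ?_ _
    refine hsqrt.of_le_mul (mξ.div msqrt).aestronglyMeasurable (c := M₃) (hae fun r hr => ?_)
    have h1 : ‖ξ r - ξ 0‖ ≤ M₃ * ‖r - 0‖ :=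
      (convex_Icc (0 : ℝ) R).norm_image_sub_le_of_norm_deriv_le
        (fun x _ => hξ.differentiable (by simp) x) (fun x hx => hM₃ x hx)
        ⟨le_rfl, hR.le⟩ (Ioo_subset_Icc_self hr)
    rw [hξ0, sub_zero, sub_zero, Real.norm_eq_abs r, abs_of_pos hr.1] at h1
    have h2 : 0 < √r := Real.sqrt_pos.2 hr.1
    rw [norm_div, Real.norm_eq_abs (√r), abs_of_pos h2, div_le_iff₀ h2, mul_assoc,
      Real.mul_self_sqrt hr.1.le]
    exact h1
  have hp : AEMeasurable (fun r => u r * ξ r + v r * η r) μ := by fun_prop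
  have hq : AEMeasurable (fun r => ξ r ^ 2 + η r ^ 2) μ := by fun_prop
  have bp : ∀ᵐ r ∂μ, |u r * ξ r + v r * η r| ≤ max (√C * M₁ + √C * M₂) (M₁ ^ 2 + M₂ ^ 2) := by
    filter_upwards [bu, bv, bξ, bη] with r h1 h2 h3 h4
    refine le_trans ((abs_add_le _ _).trans ?_) (le_max_left _ _)
    rw [abs_mul, abs_mul]
    rw [Real.norm_eq_abs] at h3 h4
    gcongr
  have bq : ∀ᵐ r ∂μ, |ξ r ^ 2 + η r ^ 2| ≤ max (√C * M₁ + √C * M₂) (M₁ ^ 2 + M₂ ^ 2) := by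
    filter_upwards [bξ, bη] with r h3 h4
    refine le_trans ((abs_add_le _ _).trans ?_) (le_max_right _ _)
    rw [abs_pow, abs_pow]
    rw [Real.norm_eq_abs] at h3 h4
    gcongr
  -- Let A be √r times the angular momentum of the perturbed pair, a quadratic polynomial in t, let
  -- B = k(u + tξ)/√r, and let m be the squared norm of the perturbed pair. The projected energy
  -- density is (C/2)(A²/m² + B²/m).
  obtain ⟨hint, hder⟩ := hasDerivAt_integral_projected ha hA₀ hA₁ hA₂ hB₀ hB₁ hp hq bp bq
  -- the density
  have hdiff : ∀ᵐ r ∂μ, DifferentiableAt ℝ u r ∧ DifferentiableAt ℝ v r := by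
    filter_upwards [ae_differentiableAt_of_ac hR huv.ac_u, ae_differentiableAt_of_ac hR huv.ac_v]
      with r h1 h2 using ⟨h1, h2⟩
  have hdens : (fun r => C / 2 * (2 * (√r * angMom u v r) * (√r * (u r * deriv η r + ξ r * deriv v r
      - v r * deriv ξ r - η r * deriv u r)) / C ^ 2 - 4 * (√r * angMom u v r) ^ 2 *
      (u r * ξ r + v r * η r) / C ^ 3 + 2 * (k * (u r / √r)) * (k * (ξ r / √r)) / C -
      2 * (k * (u r / √r)) ^ 2 * (u r * ξ r + v r * η r) / C ^ 2)) =ᵐ[μ]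
      fun r => C⁻¹ * firstVarDensity k u v ξ η r := by
    filter_upwards [hdiff, hae fun r hr => hr] with r ⟨h1, h2⟩ hr
    have horth := mul_deriv_add_mul_deriv_eq_zero hcon hr h1 h2
    have hc' := hcon r hr
    have e1 : C * deriv u r = -(v r * angMom u v r) := by
      rw [← hc', angMom]; linear_combination u r * horth
    have e2 : C * deriv v r = u r * angMom u v r := by
      rw [← hc', angMom]; linear_combination v r * horth
    have hs : 0 < √r := Real.sqrt_pos.2 hr.1
    have hs2 : √r ^ 2 = r := Real.sq_sqrt hr.1.le
    have := firstVar_algebra (k := (k : ℝ)) (X := ξ r) (Y := η r) (X' := deriv ξ r)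
      (Y' := deriv η r) ha.ne' hs.ne' hc' e1 e2
    rw [hs2] at this
    exact this
  have hint' : Integrable (firstVarDensity k u v ξ η) μ := by
    have := ((hint.const_mul (C / 2)).congr hdens).const_mul C
    refine this.congr (Eventually.of_forall fun r => ?_)
    simp only
    field_simp
  refine ⟨hint', ?_⟩
  have hval : (C / 2 * ∫ r, (2 * (√r * angMom u v r) * (√r * (u r * deriv η r + ξ r * deriv v r
      - v r * deriv ξ r - η r * deriv u r)) / C ^ 2 - 4 * (√r * angMom u v r) ^ 2 *
      (u r * ξ r + v r * η r) / C ^ 3 + 2 * (k * (u r / √r)) * (k * (ξ r / √r)) / C -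
      2 * (k * (u r / √r)) ^ 2 * (u r * ξ r + v r * η r) / C ^ 2) ∂μ) =
      C⁻¹ * ∫ r in Ioo 0 R, firstVarDensity k u v ξ η r := by
    rw [← integral_const_mul, integral_congr_ae hdens, integral_const_mul]
  rw [← hval]
  refine (hder.const_mul (C / 2)).congr_of_eventuallyEq ?_
  -- If the perturbed pair vanished at some r, then C = t²(ξ² + η²) ≤ t²(M₁² + M₂²) there. For small
  -- t this is impossible, and the projection is defined on all of (0, R).
  have hev : ∀ᶠ t : ℝ in 𝓝 0, t ^ 2 * (M₁ ^ 2 + M₂ ^ 2) < C := by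
    have : Continuous fun t : ℝ => t ^ 2 * (M₁ ^ 2 + M₂ ^ 2) := by fun_prop
    exact this.continuousAt.eventually (gt_mem_nhds (by simpa using ha))
  filter_upwards [hev] with t ht
  have hpos : ∀ r ∈ Ioo 0 R, 0 < (u r + t * ξ r) ^ 2 + (v r + t * η r) ^ 2 := by
    intro r hr
    by_contra hn
    have h1 : (u r + t * ξ r) ^ 2 = 0 := by nlinarith [sq_nonneg (u r + t * ξ r), sq_nonneg (v r + t * η r)]
    have h2 : (v r + t * η r) ^ 2 = 0 := by nlinarith [sq_nonneg (u r + t * ξ r), sq_nonneg (v r + t * η r)]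
    have h1' : u r = -(t * ξ r) := by linarith [pow_eq_zero_iff two_ne_zero |>.1 h1]
    have h2' : v r = -(t * η r) := by linarith [pow_eq_zero_iff two_ne_zero |>.1 h2]
    have h3 := hcon r hr
    rw [h1', h2'] at h3
    have h4 := hM₁ r (Ioo_subset_Icc_self hr)
    have h5 := hM₂ r (Ioo_subset_Icc_self hr)
    rw [Real.norm_eq_abs] at h4 h5
    have h6 : ξ r ^ 2 ≤ M₁ ^ 2 := sq_le_sq' (abs_le.1 h4).1 (abs_le.1 h4).2
    have h7 : η r ^ 2 ≤ M₂ ^ 2 := sq_le_sq' (abs_le.1 h5).1 (abs_le.1 h5).2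
    nlinarith [mul_le_mul_of_nonneg_left (add_le_add h6 h7) (sq_nonneg t)]
  rw [E0_eq_lintegral fun r hr => by rw [scale_mul_sq_add (hpos r hr), hρ2]]
  rw [← integral_const_mul, integral_eq_lintegral_of_nonneg_ae]
  · congr 1
    refine lintegral_congr_ae ?_
    filter_upwards [hdiff, hae fun r hr => hr] with r ⟨h1, h2⟩ hr
    congr 1
    have hs : 0 < √r := Real.sqrt_pos.2 hr.1
    have hs2 : √r ^ 2 = r := Real.sq_sqrt hr.1.le
    rw [deriv_sq_projected (h1.hasDerivAt.fun_add
      ((hξ.differentiable (by simp) r).hasDerivAt.const_mul t)) (h2.hasDerivAt.fun_add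
      ((hη.differentiable (by simp) r).hasDerivAt.const_mul t)) (hpos r hr), hρ2]
    have hn : (u r + t * ξ r) ^ 2 + (v r + t * η r) ^ 2 = C + 2 * t * (u r * ξ r + v r * η r) +
        t ^ 2 * (ξ r ^ 2 + η r ^ 2) := by rw [← hcon r hr]; ring
    have hsc : (scale ρ (u r + t * ξ r) (v r + t * η r) * (u r + t * ξ r)) ^ 2 =
        C * ((u r + t * ξ r) ^ 2 / ((u r + t * ξ r) ^ 2 + (v r + t * η r) ^ 2)) := by
      rw [scale, mul_pow, div_pow, Real.sq_sqrt (hpos r hr).le, hρ2]; ring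
    rw [hsc, hn]
    have hn0 := hpos r hr
    rw [hn] at hn0
    generalize C + 2 * t * (u r * ξ r + v r * η r) + t ^ 2 * (ξ r ^ 2 + η r ^ 2) = m at *
    have hr0 := hr.1
    have e1 : √r * angMom u v r + t * (√r * (u r * deriv η r + ξ r * deriv v r - v r * deriv ξ r -
        η r * deriv u r)) + t ^ 2 * (√r * (ξ r * deriv η r - η r * deriv ξ r)) =
        √r * ((u r + t * ξ r) * (deriv v r + t * deriv η r) -
          (v r + t * η r) * (deriv u r + t * deriv ξ r)) := by rw [angMom]; ring
    have e2 : (k : ℝ) * (u r / √r) + t * (k * (ξ r / √r)) = k * (u r + t * ξ r) / √r := by ring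
    rw [e1, e2, mul_pow, div_pow, hs2]
    field_simp
  · refine hae fun r hr => ?_
    have := hpos r hr
    have hn : (u r + t * ξ r) ^ 2 + (v r + t * η r) ^ 2 = C + 2 * t * (u r * ξ r + v r * η r) +
        t ^ 2 * (ξ r ^ 2 + η r ^ 2) := by rw [← hcon r hr]; ring
    rw [hn] at this
    simp only [Pi.zero_apply]
    positivity
  · have m1 := hA₀.1.aemeasurable
    have m2 := hA₁.1.aemeasurable
    have m3 := hA₂.1.aemeasurable
    have m4 := hB₀.1.aemeasurable
    have m5 := hB₁.1.aemeasurable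
    exact AEMeasurable.aestronglyMeasurable (((((m1.add (m2.const_mul t)).add
      (m3.const_mul (t ^ 2))).pow_const 2).div (((aemeasurable_const.add (hp.const_mul (2 * t))).add
      (hq.const_mul (t ^ 2))).pow_const 2) |>.add (((m4.add (m5.const_mul t)).pow_const 2).div
      ((aemeasurable_const.add (hp.const_mul (2 * t))).add (hq.const_mul (t ^ 2))))).const_mul _)

/-! ### Regularity from weak equations: the lemma of du Bois-Reymond -/

lemma deriv_eq_zero_of_notMem_Icc {ξ : ℝ → ℝ} {α β x : ℝ} (h : ∀ x ∉ Icc α β, ξ x = 0)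
    (hx : x ∉ Icc α β) : deriv ξ x = 0 := by
  have h1 : ξ =ᶠ[𝓝 x] fun _ => 0 := by
    filter_upwards [isClosed_Icc.isOpen_compl.mem_nhds hx] with y hy using h y hy
  rw [h1.deriv_eq, deriv_const]

lemma setIntegral_Ioo_eq_intervalIntegral {R α : ℝ} {φ : ℝ → ℝ} (hα : α ∈ Ioo 0 R)
    (h : ∀ r < α, φ r = 0) : ∫ r in Ioo 0 R, φ r = ∫ r in α..R, φ r := by
  rw [intervalIntegral.integral_of_le hα.2.le, integral_Ioc_eq_integral_Ioo,
    ← integral_Ico_eq_integral_Ioo (x := α)]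
  refine setIntegral_eq_of_subset_of_forall_sdiff_eq_zero measurableSet_Ioo
    (fun r hr => ⟨hα.1.trans_le hr.1, hr.2⟩) fun r hr => h r ?_
  by_contra hn
  exact hr.2 ⟨not_lt.1 hn, hr.1.2⟩

lemma exists_Icc_of_tsupport_subset {R : ℝ} (hR : 0 < R) {θ : ℝ → ℝ} (hθ : HasCompactSupport θ)
    (hs : tsupport θ ⊆ Ioo 0 R) :
    ∃ α β, 0 < α ∧ α ≤ β ∧ β < R ∧ ∀ x ∉ Icc α β, θ x = 0 := by
  by_cases hne : (tsupport θ).Nonempty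
  · obtain ⟨α, hα⟩ := hθ.exists_isLeast hne
    obtain ⟨β, hβ⟩ := hθ.exists_isGreatest hne
    refine ⟨α, β, (hs hα.1).1, hα.2 hβ.1, (hs hβ.1).2, fun x hx => ?_⟩
    by_contra hn
    have := subset_tsupport θ hn
    exact hx ⟨hα.2 this, hβ.2 this⟩
  · refine ⟨R / 2, R / 2, by linarith, le_rfl, by linarith, fun x _ => ?_⟩
    by_contra hn
    exact hne ⟨x, subset_tsupport θ hn⟩

/-- The lemma of du Bois-Reymond: if `f' = -g` weakly on `(0, R)`, then `f` has a locally absolutely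
continuous representative with derivative `-g` almost everywhere. -/
theorem exists_ac_of_forall_integral_eq {R : ℝ} (hR : 0 < R) {f g : ℝ → ℝ}
    (hf : ∀ ε ∈ Ioo 0 R, IntervalIntegrable f volume ε R)
    (hg : ∀ ε ∈ Ioo 0 R, IntervalIntegrable g volume ε R)
    (h : ∀ ξ : ℝ → ℝ, ContDiff ℝ ∞ ξ → ∀ α β, 0 < α → α ≤ β → β < R →
      (∀ x ∉ Icc α β, ξ x = 0) →
      ∫ r in Ioo 0 R, f r * deriv ξ r = ∫ r in Ioo 0 R, g r * ξ r) :
    ∃ F : ℝ → ℝ, (∀ ε ∈ Ioo 0 R, AbsolutelyContinuousOnInterval F ε R) ∧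
      (∀ᵐ x ∂(volume.restrict (Ioo 0 R)), f x = F x) ∧
      ∀ᵐ x ∂(volume.restrict (Ioo 0 R)), HasDerivAt F (-g x) x := by
  set G : ℝ → ℝ := fun x => ∫ t in R..x, g t with hG
  have hGac : ∀ ε ∈ Ioo 0 R, AbsolutelyContinuousOnInterval G ε R := fun ε hε =>
    (hg ε hε).absolutelyContinuousOnInterval_intervalIntegral (by simp)
  have hGd : ∀ᵐ x ∂(volume.restrict (Ioo 0 R)), HasDerivAt G (g x) x := by
    have h1 : ∀ n : ℕ, ∀ᵐ x, R / ((n : ℝ) + 2) ∈ Ioo 0 R → x ∈ uIcc (R / ((n : ℝ) + 2)) R →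
        HasDerivAt G (g x) x := fun n => by
      by_cases hn : R / ((n : ℝ) + 2) ∈ Ioo 0 R
      · filter_upwards [(hg _ hn).ae_hasDerivAt_integral] with x hx _ hx2
        exact hx hx2 R (by simp)
      · exact Eventually.of_forall fun x h => absurd h hn
    rw [ae_restrict_iff' measurableSet_Ioo]
    filter_upwards [ae_all_iff.2 h1] with x hx hxR
    obtain ⟨n, hn, hn'⟩ := exists_lt_of_pos hR hxR.1
    refine hx n hn' ?_
    rw [uIcc_of_le hn'.2.le]
    exact ⟨hn.le, hxR.2.le⟩
  -- Integration by parts gives ∫ G ξ' = -∫ g ξ, so f + G has zero weak derivative. It will be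
  -- almost everywhere a constant κ, and the representative is κ - G.
  have hsum : ∀ ξ : ℝ → ℝ, ContDiff ℝ ∞ ξ → ∀ α β, 0 < α → α ≤ β → β < R →
      (∀ x ∉ Icc α β, ξ x = 0) → ∫ r in α..R, (f r + G r) * deriv ξ r = 0 := by
    intro ξ hξ α β hα hαβ hβ hs
    have hαR : α ∈ Ioo 0 R := ⟨hα, hαβ.trans_lt hβ⟩
    -- Integrating by parts from α/2, strictly to the left of [α, β], puts the endpoint where ξ
    -- vanishes by hypothesis.
    have hα2 : α / 2 ∈ Ioo 0 R := ⟨by linarith, by linarith⟩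
    have hlt : ∀ r < α, r ∉ Icc α β := fun r hr hm => absurd hm.1 (not_le.2 hr)
    have hξd := hξ.continuous_deriv (by simp)
    have hξac : AbsolutelyContinuousOnInterval ξ (α / 2) R :=
      (hξ.of_le (by exact_mod_cast le_top)).contDiffOn.absolutelyContinuousOnInterval
    have h1 := (hGac _ hα2).integral_mul_deriv_eq_deriv_mul hξac
    rw [hs R fun hm => absurd hm.2 (not_le.2 hβ), hs (α / 2) (hlt _ (by linarith))] at h1
    have e1 : ∀ φ : ℝ → ℝ, (∀ r < α, φ r = 0) → ∫ r in α / 2..R, φ r = ∫ r in α..R, φ r :=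
      fun φ hφ => by
        rw [← setIntegral_Ioo_eq_intervalIntegral hα2 fun r hr => hφ r (by linarith),
          setIntegral_Ioo_eq_intervalIntegral hαR hφ]
    have h2 := h ξ hξ α β hα hαβ hβ hs
    rw [setIntegral_Ioo_eq_intervalIntegral hαR fun r hr => by
        rw [deriv_eq_zero_of_notMem_Icc hs (hlt r hr), mul_zero],
      setIntegral_Ioo_eq_intervalIntegral hαR fun r hr => by
        rw [hs r (hlt r hr), mul_zero]] at h2
    rw [e1 _ fun r hr => by rw [deriv_eq_zero_of_notMem_Icc hs (hlt r hr), mul_zero],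
      e1 _ fun r hr => by rw [hs r (hlt r hr), mul_zero]] at h1
    have h3 : ∫ r in α..R, deriv G r * ξ r = ∫ r in α..R, g r * ξ r := by
      refine intervalIntegral.integral_congr_ae ?_
      rw [ae_restrict_iff' measurableSet_Ioo] at hGd
      have hne : ∀ᵐ r : ℝ, r ≠ R := by simp [ae_iff, measure_singleton]
      filter_upwards [hGd, hne] with r hr hrR hm
      rw [uIoc_of_le hαR.2.le] at hm
      rw [(hr ⟨hα.trans hm.1, lt_of_le_of_ne hm.2 hrR⟩).deriv]
    simp only [add_mul]
    have iG : IntervalIntegrable (fun r => G r * deriv ξ r) volume α R :=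
      ((hGac α hαR).continuousOn.mul hξd.continuousOn).intervalIntegrable
    rw [intervalIntegral.integral_add ((hf α hαR).mul_continuousOn hξd.continuousOn) iG, h1, h2, h3]
    ring
  have hHint : ∀ ε ∈ Ioo 0 R, IntervalIntegrable (fun r => f r + G r) volume ε R := fun ε hε =>
    (hf ε hε).add (hGac ε hε).continuousOn.intervalIntegrable
  -- a normalized bump
  obtain ⟨χ, hχ, hχc, hχ0, hχ1⟩ : ∃ χ : ℝ → ℝ, ContDiff ℝ ∞ χ ∧ Continuous χ ∧
      (∀ x ∉ Icc (R / 4) (3 * R / 4), χ x = 0) ∧ ∫ x, χ x = 1 := by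
    let b : ContDiffBump (R / 2) := ⟨R / 8, R / 4, by linarith, by linarith⟩
    refine ⟨b.normed volume, b.contDiff_normed, b.continuous_normed, fun x hx => ?_,
      b.integral_normed⟩
    by_contra hn
    have h1 : x ∈ Function.support (b.normed volume) := hn
    rw [b.support_normed_eq, Metric.mem_ball, Real.dist_eq] at h1
    have h2 := abs_lt.1 h1
    simp only [b] at h2
    exact hx ⟨by linarith, by linarith⟩
  set κ : ℝ := ∫ r in R / 4..R, (f r + G r) * χ r with hκ
  have hconst : ∀ᵐ x, x ∈ Ioo 0 R → f x + G x - κ = 0 := by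
    refine isOpen_Ioo.ae_eq_zero_of_integral_contDiff_smul_eq_zero ?_ ?_
    · rw [locallyIntegrableOn_iff isOpen_Ioo.isLocallyClosed]
      intro K hK hKc
      obtain ⟨n, hn⟩ : ∃ ε ∈ Ioo 0 R, K ⊆ Icc ε R := by
        by_cases hne : K.Nonempty
        · obtain ⟨α, hα⟩ := hKc.exists_isLeast hne
          exact ⟨α, hK hα.1, fun x hx => ⟨hα.2 hx, (hK hx).2.le⟩⟩
        · exact ⟨R / 2, ⟨by linarith, by linarith⟩, fun x hx => absurd ⟨x, hx⟩ hne⟩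
      have h1 := (hHint n hn.1).sub (intervalIntegrable_const (c := κ))
      rw [intervalIntegrable_iff_integrableOn_Icc_of_le hn.1.2.le] at h1
      exact h1.mono_set hn.2
    · intro θ hθ hθc hθs
      obtain ⟨α', β', hα', hαβ', hβ', hθ0'⟩ := exists_Icc_of_tsupport_subset hR hθc hθs
      -- One interval containing the supports of both θ and the bump χ.
      obtain ⟨α, β, hα, hαβ, hβ, hαR, hβR, hθ0, hχ0'⟩ : ∃ α β, 0 < α ∧ α ≤ β ∧ β < R ∧ α ≤ R / 4 ∧
          3 * R / 4 ≤ β ∧ (∀ x ∉ Icc α β, θ x = 0) ∧ ∀ x ∉ Icc α β, χ x = 0 := by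
        refine ⟨min α' (R / 4), max β' (3 * R / 4), lt_min hα' (by linarith),
          (min_le_left _ _).trans (hαβ'.trans (le_max_left _ _)), max_lt hβ' (by linarith),
          min_le_right _ _, le_max_right _ _, fun x hx => hθ0' x fun hm => hx ?_,
          fun x hx => hχ0 x fun hm => hx ?_⟩
        · exact ⟨(min_le_left _ _).trans hm.1, hm.2.trans (le_max_left _ _)⟩
        · exact ⟨(min_le_right _ _).trans hm.1, hm.2.trans (le_max_right _ _)⟩
      have hαR' : α ∈ Ioo 0 R := ⟨hα, hαβ.trans_lt hβ⟩
      have whole : ∀ φ : ℝ → ℝ, (∀ x ∉ Icc α β, φ x = 0) → ∫ x, φ x = ∫ x in α..β, φ x := by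
        intro φ hφ
        rw [intervalIntegral.integral_of_le hαβ, ← integral_Icc_eq_integral_Ioc,
          setIntegral_eq_integral_of_forall_compl_eq_zero hφ]
      have whole' : ∀ φ : ℝ → ℝ, (∀ x ∉ Icc α β, φ x = 0) → ∫ x, φ x = ∫ x in α..R, φ x := by
        intro φ hφ
        rw [intervalIntegral.integral_of_le hαR'.2.le, ← integral_Icc_eq_integral_Ioc,
          setIntegral_eq_integral_of_forall_compl_eq_zero]
        exact fun x hx => hφ x fun hm => hx ⟨hm.1, hm.2.trans hβ.le⟩
      set m := ∫ x, θ x with hm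
      -- Subtracting the mean times the normalised bump leaves integral zero, so the primitive of ψ
      -- again vanishes outside [α, β] and is an admissible test function with derivative ψ.
      set ψ : ℝ → ℝ := fun x => θ x - m * χ x with hψ
      have hψs : ContDiff ℝ ∞ ψ := hθ.sub (contDiff_const.mul hχ)
      have hψ0 : ∀ x ∉ Icc α β, ψ x = 0 := fun x hx => by simp [hψ, hθ0 x hx, hχ0' x hx]
      have hψi : ∫ x in α..β, ψ x = 0 := by
        rw [← whole ψ hψ0]
        simp only [hψ]
        have iχ0 : HasCompactSupport χ := .intro isCompact_Icc hχ0
        rw [integral_sub (hθ.continuous.integrable_of_hasCompactSupport hθc)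
          ((hχc.integrable_of_hasCompactSupport iχ0).const_mul m),
          integral_const_mul, hχ1, mul_one, ← hm, sub_self]
      have hd : ∀ x, HasDerivAt (fun x => ∫ t in α..x, ψ t) (ψ x) x := fun x =>
        hψs.continuous.integral_hasStrictDerivAt α x |>.hasDerivAt
      have hd' : deriv (fun x => ∫ t in α..x, ψ t) = ψ := funext fun x => (hd x).deriv
      have h1 := hsum (fun x => ∫ t in α..x, ψ t)
        (contDiff_infty_iff_deriv.2 ⟨fun x => (hd x).differentiableAt, by rw [hd']; exact hψs⟩) α β hα hαβ hβ
        fun x hx => by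
          rcases lt_or_ge x α with hxα | hxα
          · rw [intervalIntegral.integral_congr (g := fun _ => 0), intervalIntegral.integral_zero]
            intro t ht
            rw [uIcc_of_ge hxα.le] at ht
            rcases ht.2.lt_or_eq with h | h
            · exact hψ0 t fun hm => absurd hm.1 (not_le.2 h)
            · subst h
              have hc : Tendsto ψ (𝓝[<] t) (𝓝 (ψ t)) :=
                hψs.continuous.continuousAt.mono_left nhdsWithin_le_nhds
              refine tendsto_nhds_unique hc (tendsto_const_nhds.congr' ?_)
              filter_upwards [self_mem_nhdsWithin] with y hy
              exact (hψ0 y fun hm => absurd hm.1 (not_le.2 hy)).symm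
          · have hxβ : β < x := not_le.1 fun hn => hx ⟨hxα, hn⟩
            rw [← intervalIntegral.integral_add_adjacent_intervals
              (hψs.continuous.intervalIntegrable α β) (hψs.continuous.intervalIntegrable β x),
              hψi, zero_add, intervalIntegral.integral_of_le hxβ.le]
            exact setIntegral_eq_zero_of_forall_eq_zero fun t ht =>
              hψ0 t fun hm => absurd hm.2 (not_le.2 ht.1)
      rw [hd'] at h1
      have iθ : IntervalIntegrable (fun r => (f r + G r) * θ r) volume α R :=
        (hHint α hαR').mul_continuousOn hθ.continuous.continuousOn
      have iχ : IntervalIntegrable (fun r => (f r + G r) * χ r) volume α R :=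
        (hHint α hαR').mul_continuousOn hχc.continuousOn
      have e1 : ∫ r in α..R, (f r + G r) * ψ r =
          (∫ r in α..R, (f r + G r) * θ r) - m * ∫ r in α..R, (f r + G r) * χ r := by
        rw [← intervalIntegral.integral_const_mul, ← intervalIntegral.integral_sub iθ
          (iχ.const_mul m)]
        refine intervalIntegral.integral_congr fun r _ => ?_
        simp only [hψ]; ring
      have e2 : ∫ r in α..R, (f r + G r) * χ r = κ := by
        have hR4 : R / 4 ∈ Ioo 0 R := ⟨by linarith, by linarith⟩
        rw [hκ, ← setIntegral_Ioo_eq_intervalIntegral hαR' fun r hr => by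
            rw [hχ0' r fun hm => absurd hm.1 (not_le.2 hr), mul_zero],
          setIntegral_Ioo_eq_intervalIntegral hR4 fun r hr => by
            rw [hχ0 r fun hm => absurd hm.1 (not_le.2 hr), mul_zero]]
      have e3 : m = ∫ r in α..R, θ r := by rw [hm, whole' θ hθ0]
      rw [whole' _ fun x hx => by rw [hθ0 x hx, zero_smul]]
      have e4 : ∫ r in α..R, θ r • (f r + G r - κ) =
          (∫ r in α..R, (f r + G r) * θ r) - κ * ∫ r in α..R, θ r := by
        rw [← intervalIntegral.integral_const_mul, ← intervalIntegral.integral_sub iθ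
          ((hθ.continuous.intervalIntegrable α R).const_mul κ)]
        refine intervalIntegral.integral_congr fun r _ => ?_
        simp only [smul_eq_mul]; ring
      rw [e4, ← e3]
      rw [e1, e2] at h1
      linarith
  refine ⟨fun x => κ - G x, fun ε hε => ?_, ?_, ?_⟩
  · have : AbsolutelyContinuousOnInterval (fun _ : ℝ => κ) ε R :=
      contDiffOn_const.absolutelyContinuousOnInterval
    exact this.sub (hGac ε hε)
  · rw [ae_restrict_iff' measurableSet_Ioo]
    filter_upwards [hconst] with x hx hxR
    linarith [hx hxR]
  · filter_upwards [hGd] with x hx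
    exact hx.const_sub κ

/-! ### From stationarity to the explicit profiles -/

/-- An absolutely continuous function is the integral of its derivative. Replacing the derivative by
the continuous p under the integral, the fundamental theorem of calculus holds at every point. -/
lemma hasDerivAt_of_ac_of_ae {R : ℝ} {F p : ℝ → ℝ}
    (hF : ∀ ε ∈ Ioo 0 R, AbsolutelyContinuousOnInterval F ε R) (hp : ContinuousOn p (Ioo 0 R))
    (h : ∀ᵐ x ∂(volume.restrict (Ioo 0 R)), HasDerivAt F (p x) x) :
    ∀ x ∈ Ioo 0 R, HasDerivAt F (p x) x := by
  intro x hx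
  have hε : x / 2 ∈ Ioo 0 R := ⟨by linarith [hx.1], by linarith [hx.1, hx.2]⟩
  rw [ae_restrict_iff' measurableSet_Ioo] at h
  have hsub : ∀ y ∈ Ioo (x / 2) R, uIcc (x / 2) y ⊆ Ioo 0 R := fun y hy => by
    rw [uIcc_of_le hy.1.le]
    exact fun z hz => ⟨hε.1.trans_le hz.1, hz.2.trans_lt hy.2⟩
  have hxm : x ∈ Ioo (x / 2) R := ⟨by linarith [hx.1], hx.2⟩
  have h1 : F =ᶠ[𝓝 x] fun y => F (x / 2) + ∫ t in x / 2..y, p t := by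
    filter_upwards [isOpen_Ioo.mem_nhds hxm] with y hy
    have h2 := ((hF _ hε).mono (c := x / 2) (d := y) (by
      rw [uIcc_of_le hy.1.le, uIcc_of_le hε.2.le]
      exact Icc_subset_Icc_right hy.2.le)).integral_deriv_eq_sub
    rw [intervalIntegral.integral_congr_ae (g := p)] at h2
    · rw [h2]; ring
    · filter_upwards [h] with t ht hm
      exact (ht (hsub y hy (uIoc_subset_uIcc hm))).deriv
  refine HasDerivAt.congr_of_eventuallyEq ?_ h1
  exact (intervalIntegral.integral_hasDerivAt_right
    (hp.mono (hsub x hxm)).intervalIntegrable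
    (hp.stronglyMeasurableAtFilter isOpen_Ioo x hx)
    (hp.continuousAt (isOpen_Ioo.mem_nhds hx))).const_add _

lemma eq_right_of_hasDerivAt_zero {R : ℝ} {y : ℝ → ℝ} (hy : ContinuousOn y (Ioc 0 R))
    (h : ∀ x ∈ Ioo 0 R, HasDerivAt y 0 x) {x : ℝ} (hx : x ∈ Ioc 0 R) : y x = y R :=
  (constant_of_has_deriv_right_zero (hy.mono fun _ hz => ⟨hx.1.trans_le hz.1, hz.2⟩)
    (fun z hz => (h z ⟨hx.1.trans_le hz.1, hz.2⟩).hasDerivWithinAt) R ⟨hx.2, le_rfl⟩).symm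

/-- Solutions of the linear equation `y' = p y` on `(0, R]`. -/
lemma exists_eq_mul_exp {R : ℝ} {y p : ℝ → ℝ} (hy : ContinuousOn y (Ioc 0 R))
    (hp : ContinuousOn p (Ioc 0 R)) (h : ∀ x ∈ Ioo 0 R, HasDerivAt y (p x * y x) x) :
    ∃ P : ℝ → ℝ, ∀ x ∈ Ioc 0 R, y x = y R * Real.exp (P x) := by
  set P : ℝ → ℝ := fun x => ∫ t in R..x, p t with hP
  have hint : ∀ x ∈ Ioc 0 R, IntervalIntegrable p volume R x := fun x hx =>
    ContinuousOn.intervalIntegrable (hp.mono (by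
      rw [uIcc_of_ge hx.2]; exact fun z hz => ⟨hx.1.trans_le hz.1, hz.2⟩))
  have hPc : ContinuousOn P (Ioc 0 R) := by
    intro x hx
    have hx2 : x / 2 ∈ Ioc 0 R := ⟨by linarith [hx.1], by linarith [hx.1, hx.2]⟩
    have h1 := intervalIntegral.continuousOn_primitive_interval' (hint _ hx2) (a := R) (by simp)
    rw [uIcc_of_ge hx2.2] at h1
    refine (h1 x ⟨by linarith [hx.1], hx.2⟩).mono_of_mem_nhdsWithin ?_
    rw [mem_nhdsWithin]
    exact ⟨Ioi (x / 2), isOpen_Ioi, by simpa using hx.1, fun z hz => ⟨le_of_lt hz.1, hz.2.2⟩⟩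
  have hPd : ∀ x ∈ Ioo 0 R, HasDerivAt P (p x) x := fun x hx =>
    intervalIntegral.integral_hasDerivAt_right (hint x (Ioo_subset_Ioc_self hx))
      ((hp.mono Ioo_subset_Ioc_self).stronglyMeasurableAtFilter isOpen_Ioo x hx)
      ((hp.mono Ioo_subset_Ioc_self).continuousAt (isOpen_Ioo.mem_nhds hx))
  have hzero : ∀ x ∈ Ioo 0 R, HasDerivAt (fun x => y x * Real.exp (-P x)) 0 x := fun x hx =>
    ((h x hx).fun_mul (hPd x hx).fun_neg.exp).congr_deriv (by ring)
  refine ⟨P, fun x hx => ?_⟩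
  have h1 := eq_right_of_hasDerivAt_zero (hy.mul (hPc.neg.rexp)) hzero hx
  have h2 : P R = 0 := by simp [hP]
  simp only [Pi.mul_apply, Pi.neg_apply, h2, neg_zero, Real.exp_zero, mul_one] at h1
  rw [← h1, mul_assoc, ← Real.exp_add]
  simp

/-- The Euler-Lagrange system in Hamiltonian form: the weighted angular momentum `W` of a critical
point is absolutely continuous, and `(u, v, W)` solves a regular system on `(0, R)`. -/
theorem exists_momentum {R s C : ℝ} (hR : 0 < R) (hC : 0 < C) {k : ℤ} {u v : ℝ → ℝ}
    (huv : MemS R s u v) (hcon : ∀ r ∈ Ioo 0 R, u r ^ 2 + v r ^ 2 = C)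
    (hst : ∀ ξ η : ℝ → ℝ, ContDiff ℝ ∞ ξ → ContDiff ℝ ∞ η → ξ 0 = 0 → ξ R = 0 → η R = 0 →
      ∫ r in Ioo 0 R, firstVarDensity k u v ξ η r = 0) :
    ∃ W : ℝ → ℝ, ContinuousOn W (Ioc 0 R) ∧
      (∀ r ∈ Ioo 0 R, HasDerivAt W (-((k : ℝ) ^ 2 * (u r * v r) / r)) r) ∧
      (∀ r ∈ Ioo 0 R, HasDerivAt u (-(v r * W r / (r * C))) r) ∧
      (∀ r ∈ Ioo 0 R, HasDerivAt v (u r * W r / (r * C)) r) ∧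
      IntegrableOn (fun r => (W r ^ 2 - (k : ℝ) ^ 2 * C * u r ^ 2) / r) (Ioo 0 R) := by
  set μ := volume.restrict (Ioo 0 R) with hμ
  have hae : ∀ {p : ℝ → Prop}, (∀ r ∈ Ioo 0 R, p r) → ∀ᵐ r ∂μ, p r := fun h =>
    (ae_restrict_iff' measurableSet_Ioo).2 (Eventually.of_forall h)
  have cu := continuousOn_Ioc_of_ac huv.ac_u
  have cv := continuousOn_Ioc_of_ac huv.ac_v
  have mu : AEMeasurable u μ := (cu.mono Ioo_subset_Ioc_self).aemeasurable measurableSet_Ioo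
  have mv : AEMeasurable v μ := (cv.mono Ioo_subset_Ioc_self).aemeasurable measurableSet_Ioo
  have bu : ∀ᵐ r ∂μ, |u r| ≤ √C := hae fun r hr =>
    Real.abs_le_sqrt (by nlinarith [hcon r hr, sq_nonneg (v r)])
  have bv : ∀ᵐ r ∂μ, |v r| ≤ √C := hae fun r hr =>
    Real.abs_le_sqrt (by nlinarith [hcon r hr, sq_nonneg (u r)])
  have hL : MemLp (fun r => √r * angMom u v r) 2 μ := by
    refine ((MemLp.bdd_mul_two huv.deriv_v mu bu).sub
      (MemLp.bdd_mul_two huv.deriv_u mv bv)).ae_eq (Eventually.of_forall fun r => ?_)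
    simp only [Pi.sub_apply, angMom]; ring
  have hsq : ∀ r ∈ Ioo 0 R, √r * √r = r := fun r hr => Real.mul_self_sqrt hr.1.le
  have toInt : ∀ {f : ℝ → ℝ}, Integrable f μ → ∀ ε ∈ Ioo 0 R, IntervalIntegrable f volume ε R :=
    fun hf ε hε => by
      rw [intervalIntegrable_iff_integrableOn_Ioo_of_le hε.2.le]
      exact IntegrableOn.mono_set hf (Ioo_subset_Ioo_left hε.1.le)
  have hsub : ∀ ε ∈ Ioo 0 R, uIcc ε R ⊆ Ioc 0 R := fun ε hε => by
    rw [uIcc_of_le hε.2.le]; exact fun z hz => ⟨hε.1.trans_le hz.1, hz.2⟩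
  have iW : ∀ ε ∈ Ioo 0 R, IntervalIntegrable (fun r => r * angMom u v r) volume ε R := by
    intro ε hε
    have h1 := (((huv.ac_v ε hε).intervalIntegrable_deriv.continuousOn_mul
      (cu.mono (hsub ε hε))).sub ((huv.ac_u ε hε).intervalIntegrable_deriv.continuousOn_mul
      (cv.mono (hsub ε hε)))).continuousOn_mul (continuousOn_id (s := uIcc ε R))
    exact h1
  have iWd : ∀ {q : ℝ → ℝ}, MemLp (fun r => √r * q r) 2 μ → ∀ ε ∈ Ioo 0 R,
      IntervalIntegrable (fun r => r * angMom u v r * q r) volume ε R := fun {q} hq => by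
    refine toInt ((hL.integrable_mul hq).congr (hae fun r hr => ?_))
    simp only [Pi.mul_apply]
    linear_combination (angMom u v r * q r) * hsq r hr
  have ipot : ∀ {q : ℝ → ℝ}, ContinuousOn q (Ioc 0 R) → ∀ ε ∈ Ioo 0 R,
      IntervalIntegrable (fun r => (k : ℝ) ^ 2 / r * q r) volume ε R := fun {q} hq ε hε => by
    refine ContinuousOn.intervalIntegrable (ContinuousOn.mono ?_ (hsub ε hε))
    exact (continuousOn_const.div continuousOn_id fun r hr => hr.1.ne').mul hq
  -- Testing with a tangential direction θ(v, -u) would give the momentum at once, but such a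
  -- direction need not be smooth. Testing each component separately shows instead that r(uv' -
  -- vu')v and r(uv' - vu')u are absolutely continuous up to null sets. By u² + v² = C the momentum
  -- is recovered as a combination of the two.
  obtain ⟨A, hA, hAe, hAd⟩ := exists_ac_of_forall_integral_eq hR
    (f := fun r => r * angMom u v r * v r)
    (g := fun r => (k : ℝ) ^ 2 / r * (u r * v r ^ 2) - r * angMom u v r * deriv v r)
    (fun ε hε => (iW ε hε).mul_continuousOn (cv.mono (hsub ε hε)))
    (fun ε hε => (ipot (cu.mul (cv.pow 2)) ε hε).sub (iWd huv.deriv_v ε hε)) (by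
      intro ξ hξ α β hα hαβ hβ hs
      have hαR : α ∈ Ioo 0 R := ⟨hα, hαβ.trans_lt hβ⟩
      have hlt : ∀ r < α, r ∉ Icc α β := fun r hr hm => absurd hm.1 (not_le.2 hr)
      have hξd := hξ.continuous_deriv (by simp)
      have h1 := hst ξ (fun _ => 0) hξ contDiff_const (hs 0 (hlt 0 hα))
        (hs R fun hm => absurd hm.2 (not_le.2 hβ)) rfl
      have e1 : ∀ r, firstVarDensity k u v ξ (fun _ => 0) r =
          ((k : ℝ) ^ 2 / r * (u r * v r ^ 2) - r * angMom u v r * deriv v r) * ξ r -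
            r * angMom u v r * v r * deriv ξ r := fun r => by
        simp only [firstVarDensity, deriv_const]; ring
      simp only [e1] at h1
      rw [setIntegral_Ioo_eq_intervalIntegral hαR fun r hr => by
          rw [deriv_eq_zero_of_notMem_Icc hs (hlt r hr), hs r (hlt r hr)]; ring,
        intervalIntegral.integral_sub] at h1
      · rw [setIntegral_Ioo_eq_intervalIntegral hαR fun r hr => by
            rw [deriv_eq_zero_of_notMem_Icc hs (hlt r hr), mul_zero],
          setIntegral_Ioo_eq_intervalIntegral hαR fun r hr => by
            rw [hs r (hlt r hr), mul_zero]]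
        linarith
      · exact ((ipot (cu.mul (cv.pow 2)) α hαR).sub (iWd huv.deriv_v α hαR)).mul_continuousOn
          hξ.continuous.continuousOn
      · exact ((iW α hαR).mul_continuousOn (cv.mono (hsub α hαR))).mul_continuousOn
          hξd.continuousOn)
  obtain ⟨B, hB, hBe, hBd⟩ := exists_ac_of_forall_integral_eq hR
    (f := fun r => r * angMom u v r * u r)
    (g := fun r => (k : ℝ) ^ 2 / r * (u r ^ 2 * v r) - r * angMom u v r * deriv u r)
    (fun ε hε => (iW ε hε).mul_continuousOn (cu.mono (hsub ε hε)))
    (fun ε hε => (ipot ((cu.pow 2).mul cv) ε hε).sub (iWd huv.deriv_u ε hε)) (by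
      intro ξ hξ α β hα hαβ hβ hs
      have hαR : α ∈ Ioo 0 R := ⟨hα, hαβ.trans_lt hβ⟩
      have hlt : ∀ r < α, r ∉ Icc α β := fun r hr hm => absurd hm.1 (not_le.2 hr)
      have hξd := hξ.continuous_deriv (by simp)
      have h1 := hst (fun _ => 0) ξ contDiff_const hξ rfl rfl
        (hs R fun hm => absurd hm.2 (not_le.2 hβ))
      have e1 : ∀ r, firstVarDensity k u v (fun _ => 0) ξ r =
          r * angMom u v r * u r * deriv ξ r -
          ((k : ℝ) ^ 2 / r * (u r ^ 2 * v r) - r * angMom u v r * deriv u r) * ξ r := fun r => by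
        simp only [firstVarDensity, deriv_const]; ring
      simp only [e1] at h1
      rw [setIntegral_Ioo_eq_intervalIntegral hαR fun r hr => by
          rw [deriv_eq_zero_of_notMem_Icc hs (hlt r hr), hs r (hlt r hr)]; ring,
        intervalIntegral.integral_sub] at h1
      · rw [setIntegral_Ioo_eq_intervalIntegral hαR fun r hr => by
            rw [deriv_eq_zero_of_notMem_Icc hs (hlt r hr), mul_zero],
          setIntegral_Ioo_eq_intervalIntegral hαR fun r hr => by
            rw [hs r (hlt r hr), mul_zero]]
        linarith
      · exact ((iW α hαR).mul_continuousOn (cu.mono (hsub α hαR))).mul_continuousOn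
          hξd.continuousOn
      · exact ((ipot ((cu.pow 2).mul cv) α hαR).sub (iWd huv.deriv_u α hαR)).mul_continuousOn
          hξ.continuous.continuousOn)
  -- the momentum
  set W : ℝ → ℝ := fun r => C⁻¹ * (A r * v r + B r * u r) with hW
  have hWac : ∀ ε ∈ Ioo 0 R, AbsolutelyContinuousOnInterval W ε R := fun ε hε =>
    (((hA ε hε).mul (huv.ac_v ε hε)).add ((hB ε hε).mul (huv.ac_u ε hε))).const_mul C⁻¹
  have cW := continuousOn_Ioc_of_ac hWac
  have hall : ∀ᵐ r ∂μ, r ∈ Ioo 0 R ∧ W r = r * angMom u v r ∧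
      HasDerivAt W (-((k : ℝ) ^ 2 * (u r * v r) / r)) r ∧
      HasDerivAt u (-(v r * W r / (r * C))) r ∧ HasDerivAt v (u r * W r / (r * C)) r := by
    filter_upwards [hae fun r hr => hr, hAe, hAd, hBe, hBd, ae_differentiableAt_of_ac hR huv.ac_u,
      ae_differentiableAt_of_ac hR huv.ac_v] with r hr hA1 hA2 hB1 hB2 hu1 hv1
    have hr0 := hr.1.ne'
    have hc := hcon r hr
    have horth := mul_deriv_add_mul_deriv_eq_zero hcon hr hu1 hv1
    have hWr : W r = r * angMom u v r := by
      simp only [hW]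
      rw [← hA1, ← hB1, inv_mul_eq_iff_eq_mul₀ hC.ne']
      linear_combination (r * angMom u v r) * hc
    refine ⟨hr, hWr, ?_, ?_, ?_⟩
    · refine (((hA2.fun_mul hv1.hasDerivAt).fun_add (hB2.fun_mul hu1.hasDerivAt)).const_mul
        C⁻¹).congr_deriv ?_
      rw [← hA1, ← hB1, inv_mul_eq_iff_eq_mul₀ hC.ne']
      have e : (k : ℝ) ^ 2 * (u r * v r) / r = (k : ℝ) ^ 2 / r * (u r * v r) := by ring
      rw [e]
      linear_combination (2 * (r * angMom u v r)) * horth - (k : ℝ) ^ 2 / r * (u r * v r) * hc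
    · refine hu1.hasDerivAt.congr_deriv ?_
      rw [hWr]
      field_simp
      rw [angMom]
      linear_combination (-deriv u r) * hc + u r * horth
    · refine hv1.hasDerivAt.congr_deriv ?_
      rw [hWr]
      field_simp
      rw [angMom]
      linear_combination (-deriv v r) * hc + v r * horth
  have cu' := cu.mono Ioo_subset_Ioc_self
  have cv' := cv.mono Ioo_subset_Ioc_self
  have cW' := cW.mono Ioo_subset_Ioc_self
  have cC : ContinuousOn (fun r : ℝ => r * C) (Ioo 0 R) := by fun_prop
  have hne : ∀ r ∈ Ioo 0 R, r * C ≠ 0 := fun r hr => (mul_pos hr.1 hC).ne'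
  refine ⟨W, cW, hasDerivAt_of_ac_of_ae hWac ?_ (hall.mono fun r h => h.2.2.1),
    hasDerivAt_of_ac_of_ae huv.ac_u ?_ (hall.mono fun r h => h.2.2.2.1),
    hasDerivAt_of_ac_of_ae huv.ac_v ?_ (hall.mono fun r h => h.2.2.2.2), ?_⟩
  · exact ((continuousOn_const.mul (cu'.mul cv')).div continuousOn_id fun r hr => hr.1.ne').neg
  · exact ((cv'.mul cW').div cC hne).neg
  · exact (cu'.mul cW').div cC hne
  -- W²/r and u²/r are the squares of √r(uv' - vu') and u/√r, both in L² by membership in S and the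
  -- constraint.
  · refine (hL.integrable_sq.sub (huv.val_u.integrable_sq.const_mul ((k : ℝ) ^ 2 * C))).congr ?_
    filter_upwards [hall] with r hr
    have hr0 := hr.1.1.ne'
    simp only [Pi.sub_apply, mul_pow, div_pow, Real.sq_sqrt hr.1.1.le, hr.2.1]
    field_simp

lemma hasDerivAt_const_mul_pow (lam : ℝ) (K : ℕ) {r : ℝ} (hr : r ≠ 0) :
    HasDerivAt (fun x : ℝ => lam * x ^ K) (lam * (K * r ^ K / r)) r := by
  refine ((hasDerivAt_pow K r).const_mul lam).congr_deriv ?_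
  rcases K with _ | K
  · simp
  · rw [Nat.add_sub_cancel, pow_succ]
    field_simp

/-- The profile is determined by the first-order system that it solves and by its values at `R`. -/
theorem eqOn_prof_of_system {R ρ lam σ : ℝ} {K : ℕ} (hR : 0 < R) (hρ : 0 < ρ)
    (hσ : σ ^ 2 = 1) {u v : ℝ → ℝ} (cu : ContinuousOn u (Ioc 0 R)) (cv : ContinuousOn v (Ioc 0 R))
    (hcon : ∀ r ∈ Ioc 0 R, u r ^ 2 + v r ^ 2 = ρ ^ 2)
    (hu : ∀ r ∈ Ioo 0 R, HasDerivAt u (-(σ * K * (u r * v r) / (r * ρ))) r)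
    (hv : ∀ r ∈ Ioo 0 R, HasDerivAt v (σ * K * u r ^ 2 / (r * ρ)) r)
    (huR : profU ρ lam K R = u R) (hvR : profV σ ρ lam K R = v R) (hpos : 0 < u R) :
    EqOn u (profU ρ lam K) (Ioc 0 R) ∧ EqOn v (profV σ ρ lam K) (Ioc 0 R) := by
  -- The equation for u is linear in u with this coefficient, hence positivity at R propagates to
  -- all of (0, R].
  set p : ℝ → ℝ := fun r => -(σ * K * v r / (r * ρ)) with hp
  have cp : ContinuousOn p (Ioc 0 R) :=
    ((continuousOn_const.mul cv).div (by fun_prop) fun r hr => (mul_pos hr.1 hρ).ne').neg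
  obtain ⟨P, hP⟩ := exists_eq_mul_exp cu cp fun r hr => (hu r hr).congr_deriv (by simp only [hp]; ring)
  have hu0 : ∀ r ∈ Ioc 0 R, u r ≠ 0 := fun r hr => by
    rw [hP r hr]; exact (mul_pos hpos (Real.exp_pos _)).ne'
  -- X = 0 says that the stereographic coordinate u/(ρ - σv) equals lam r^K, written without
  -- division. X solves the same linear equation as u and vanishes at R, so it vanishes identically.
  set X : ℝ → ℝ := fun r => u r - lam * r ^ K * (ρ - σ * v r) with hX
  have cX : ContinuousOn X (Ioc 0 R) := by
    simp only [hX]; fun_prop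
  obtain ⟨T, hT⟩ := exists_eq_mul_exp cX cp fun r hr => by
    have hr0 := hr.1.ne'
    have h1 := hasDerivAt_const_mul_pow lam K hr0
    refine ((hu r hr).fun_sub (h1.fun_mul (((hv r hr).const_mul σ).const_sub ρ))).congr_deriv ?_
    have hc := hcon r (Ioo_subset_Ioc_self hr)
    simp only [hp, hX]
    field_simp
    linear_combination (K * (lam * r ^ K) * σ ^ 2) * hc + (K * (lam * r ^ K) * ρ ^ 2) * hσ
  have hXR : X R = 0 := by
    simp only [hX, ← huR, ← hvR, profU, profV]
    have : 0 < 1 + (lam * R ^ K) ^ 2 := by positivity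
    field_simp
    linear_combination (ρ * lam * R ^ K * ((lam * R ^ K) ^ 2 - 1)) * hσ
  have hX0 : ∀ r ∈ Ioc 0 R, u r = lam * r ^ K * (ρ - σ * v r) := fun r hr => by
    have := hT r hr
    rw [hXR, zero_mul] at this
    simp only [hX] at this
    linarith
  have hval : ∀ r ∈ Ioc 0 R, u r = profU ρ lam K r ∧ v r = profV σ ρ lam K r := fun r hr => by
    have h1 := hX0 r hr
    have h2 : ρ - σ * v r ≠ 0 := fun h => hu0 r hr (by rw [h1, h, mul_zero])
    have h3 := hcon r hr
    -- From (ρ - σv)(ρ + σv) = u² = (lam r^K)²(ρ - σv)², one factor ρ - σv is cancelled; it is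
    -- nonzero because u is.
    have h4 : ρ + σ * v r = (lam * r ^ K) ^ 2 * (ρ - σ * v r) := by
      apply mul_left_cancel₀ h2
      rw [h1] at h3
      linear_combination -h3 - v r ^ 2 * hσ
    have h5 : 0 < 1 + (lam * r ^ K) ^ 2 := by positivity
    have h6 : v r = profV σ ρ lam K r := by
      rw [profV]
      field_simp
      linear_combination σ * h4 - (1 + (lam * r ^ K) ^ 2) * v r * hσ
    refine ⟨?_, h6⟩
    rw [h1, h6, profU, profV]
    field_simp
    linear_combination (lam * r ^ K * (1 - (lam * r ^ K) ^ 2)) * hσ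
  exact ⟨fun r hr => (hval r hr).1, fun r hr => (hval r hr).2⟩

/-- The logarithmic divergence of ∫ dr/r at 0 is how finite energy selects the solutions. -/
lemma eq_zero_of_integrableOn_const_div {R c : ℝ} (hR : 0 < R)
    (h : IntegrableOn (fun r : ℝ => c / r) (Ioo 0 R)) : c = 0 := by
  by_contra hc
  have h1 : IntegrableOn (fun r : ℝ => r⁻¹) (Ioo 0 R) := by
    refine (Integrable.const_mul h c⁻¹).congr (Eventually.of_forall fun r => ?_)
    simp only
    field_simp
  rw [← intervalIntegrable_iff_integrableOn_Ioo_of_le hR.le, intervalIntegrable_inv_iff] at h1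
  rcases h1 with h1 | h1
  · exact hR.ne h1
  · exact h1 (by simp)

/-- A finite-energy solution of the stationarity equations solves one of two first-order systems. -/
theorem hasDerivAt_of_stationary {R s ρ : ℝ} (hR : 0 < R) (hρ : 0 < ρ) {k : ℤ} {u v : ℝ → ℝ}
    (huv : MemS R s u v) (hcon : ∀ r ∈ Ioo 0 R, u r ^ 2 + v r ^ 2 = ρ ^ 2)
    (hst : ∀ ξ η : ℝ → ℝ, ContDiff ℝ ∞ ξ → ContDiff ℝ ∞ η → ξ 0 = 0 → ξ R = 0 → η R = 0 →
      ∫ r in Ioo 0 R, firstVarDensity k u v ξ η r = 0) :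
    ∃ σ : ℝ, (σ = 1 ∨ σ = -1) ∧
      (∀ r ∈ Ioo 0 R, HasDerivAt u (-(σ * k.natAbs * (u r * v r) / (r * ρ))) r) ∧
      (∀ r ∈ Ioo 0 R, HasDerivAt v (σ * k.natAbs * u r ^ 2 / (r * ρ)) r) := by
  obtain ⟨W, cW, hW, hu, hv, hint⟩ := exists_momentum hR (pow_pos hρ 2) huv hcon hst
  have cu := continuousOn_Ioc_of_ac huv.ac_u
  have cv := continuousOn_Ioc_of_ac huv.ac_v
  have hK : (k : ℝ) ^ 2 = (k.natAbs : ℝ) ^ 2 := by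
    rw [Nat.cast_natAbs, Int.cast_abs, sq_abs]
  rw [hK] at hint
  simp only [hK] at hW
  set K : ℝ := (k.natAbs : ℝ)
  -- The first integral of the system, in the role of a Hamiltonian with time log r.
  set E : ℝ → ℝ := fun r => W r ^ 2 - K ^ 2 * ρ ^ 2 * u r ^ 2 with hE
  have cE : ContinuousOn E (Ioc 0 R) := by simp only [hE]; fun_prop
  have hEd : ∀ r ∈ Ioo 0 R, HasDerivAt E 0 r := fun r hr => by
    refine (((hW r hr).fun_pow 2).fun_sub (((hu r hr).fun_pow 2).const_mul _)).congr_deriv ?_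
    have hr0 := hr.1.ne'
    push_cast
    field_simp
    ring
  have hEc : ∀ r ∈ Ioc 0 R, E r = E R := fun r hr => eq_right_of_hasDerivAt_zero cE hEd hr
  have hER : E R = 0 := by
    refine eq_zero_of_integrableOn_const_div hR (hint.congr_fun (fun r hr => ?_) measurableSet_Ioo)
    change E r / r = E R / r
    rw [hEc r (Ioo_subset_Ioc_self hr)]
  -- Both factors of E = (W - Kρu)(W + Kρu) solve homogeneous linear equations. A factor that
  -- vanishes at R therefore vanishes on all of (0, R], and the sign σ cannot change with r.
  have key : ∀ τ : ℝ, τ ^ 2 = 1 → ∃ P : ℝ → ℝ, ∀ r ∈ Ioc 0 R,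
      W r - τ * K * ρ * u r = (W R - τ * K * ρ * u R) * Real.exp (P r) := fun τ hτ => by
    refine exists_eq_mul_exp (y := fun r => W r - τ * K * ρ * u r)
      (p := fun r => τ * K * v r / (r * ρ)) (by fun_prop)
      ((continuousOn_const.mul cv).div (by fun_prop) fun r hr => (mul_pos hr.1 hρ).ne')
      fun r hr => ?_
    refine ((hW r hr).fun_sub ((hu r hr).const_mul _)).congr_deriv ?_
    have hr0 := hr.1.ne'
    field_simp
    linear_combination (K ^ 2 * u r * v r * ρ) * hτ
  have hzero : (W R - 1 * K * ρ * u R) * (W R - -1 * K * ρ * u R) = 0 := by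
    rw [← hER, hE]; ring
  obtain ⟨σ, hσ, h0⟩ : ∃ σ : ℝ, (σ = 1 ∨ σ = -1) ∧ W R - σ * K * ρ * u R = 0 := by
    rcases mul_eq_zero.1 hzero with h | h
    · exact ⟨1, Or.inl rfl, h⟩
    · exact ⟨-1, Or.inr rfl, h⟩
  obtain ⟨P, hP⟩ := key σ (by rcases hσ with rfl | rfl <;> norm_num)
  have hWe : ∀ r ∈ Ioo 0 R, W r = σ * K * ρ * u r := fun r hr => by
    have := hP r (Ioo_subset_Ioc_self hr)
    rw [h0, zero_mul] at this
    linarith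
  refine ⟨σ, hσ, fun r hr => (hu r hr).congr_deriv ?_, fun r hr => (hv r hr).congr_deriv ?_⟩
  · have hr0 := hr.1.ne'
    rw [hWe r hr]; field_simp
  · have hr0 := hr.1.ne'
    rw [hWe r hr]; field_simp

/-! ### The explicit profiles are critical points -/

lemma contDiff_profU (ρ lam : ℝ) (K : ℕ) : ContDiff ℝ ∞ (profU ρ lam K) := by
  refine contDiff_const.mul (ContDiff.div (by fun_prop) (by fun_prop) fun r => ?_)
  positivity

lemma contDiff_profV (σ ρ lam : ℝ) (K : ℕ) : ContDiff ℝ ∞ (profV σ ρ lam K) := by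
  refine contDiff_const.mul (ContDiff.div (by fun_prop) (by fun_prop) fun r => ?_)
  positivity

lemma prof_sq_add {σ : ℝ} (hσ : σ ^ 2 = 1) (ρ lam : ℝ) (K : ℕ) (r : ℝ) :
    profU ρ lam K r ^ 2 + profV σ ρ lam K r ^ 2 = ρ ^ 2 := by
  have : 0 < 1 + (lam * r ^ K) ^ 2 := by positivity
  rw [profU, profV]
  field_simp
  linear_combination (ρ ^ 2 * ((lam * r ^ K) ^ 2 - 1) ^ 2) * hσ

lemma hasDerivAt_profU {σ ρ : ℝ} (hσ : σ ^ 2 = 1) (hρ : ρ ≠ 0) (lam : ℝ) (K : ℕ) {r : ℝ}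
    (hr : r ≠ 0) : HasDerivAt (profU ρ lam K)
      (-(σ * K * (profU ρ lam K r * profV σ ρ lam K r) / (r * ρ))) r := by
  have h1 := hasDerivAt_const_mul_pow lam K hr
  have h0 : 0 < 1 + (lam * r ^ K) ^ 2 := by positivity
  refine (((h1.const_mul 2).fun_div ((h1.fun_pow 2).const_add 1) h0.ne').const_mul ρ).congr_deriv ?_
  rw [profU, profV]
  push_cast
  field_simp
  linear_combination (lam * K * ((lam * r ^ K) ^ 2 - 1)) * hσ

lemma hasDerivAt_profV {σ ρ : ℝ} (hρ : ρ ≠ 0) (lam : ℝ) (K : ℕ) {r : ℝ}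
    (hr : r ≠ 0) : HasDerivAt (profV σ ρ lam K) (σ * K * profU ρ lam K r ^ 2 / (r * ρ)) r := by
  have h1 := hasDerivAt_const_mul_pow lam K hr
  have h0 : 0 < 1 + (lam * r ^ K) ^ 2 := by positivity
  refine ((((h1.fun_pow 2).sub_const 1).fun_div ((h1.fun_pow 2).const_add 1)
    h0.ne').const_mul (σ * ρ)).congr_deriv ?_
  rw [profU]
  push_cast
  field_simp
  ring

/-- Since K ≥ 1, the profile u vanishes at the origin to first order at least. This gives u/√r ∈ L²
and a bounded quotient u/r in the energy. -/
lemma exists_profU_eq_mul (ρ lam : ℝ) {K : ℕ} (hK : K ≠ 0) :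
    ∃ q : ℝ → ℝ, Continuous q ∧ ∀ r, profU ρ lam K r = r * q r := by
  obtain ⟨m, rfl⟩ := Nat.exists_eq_succ_of_ne_zero hK
  refine ⟨fun r => ρ * (2 * (lam * r ^ m) / (1 + (lam * r ^ (m + 1)) ^ 2)), ?_, fun r => ?_⟩
  · refine continuous_const.mul (Continuous.div (by fun_prop) (by fun_prop) fun r => ?_)
    positivity
  · rw [profU, Nat.succ_eq_add_one]
    ring

lemma memS_prof {R s σ ρ lam : ℝ} {K : ℕ} (hK : K ≠ 0)
    (hu : profU ρ lam K R = s / √2) (hv : profV σ ρ lam K R = -(s / √6)) :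
    MemS R s (profU ρ lam K) (profV σ ρ lam K) where
  ac_u _ _ := ((contDiff_profU ρ lam K).of_le
    (by exact_mod_cast le_top)).contDiffOn.absolutelyContinuousOnInterval
  ac_v _ _ := ((contDiff_profV σ ρ lam K).of_le
    (by exact_mod_cast le_top)).contDiffOn.absolutelyContinuousOnInterval
  deriv_u := (Real.continuous_sqrt.mul
    ((contDiff_profU ρ lam K).continuous_deriv (by simp))).memLp_two_Ioo
  deriv_v := (Real.continuous_sqrt.mul
    ((contDiff_profV σ ρ lam K).continuous_deriv (by simp))).memLp_two_Ioo
  val_u := by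
    obtain ⟨q, hq, hqu⟩ := exists_profU_eq_mul ρ lam hK
    refine ((Real.continuous_sqrt.mul hq).memLp_two_Ioo (a := 0) (b := R)).ae_eq ?_
    refine (ae_restrict_iff' measurableSet_Ioo).2 (Eventually.of_forall fun r hr => ?_)
    have h1 : 0 < √r := Real.sqrt_pos.2 hr.1
    change √r * q r = profU ρ lam K r / √r
    rw [hqu, eq_div_iff h1.ne', mul_right_comm, Real.mul_self_sqrt hr.1.le]
  val_v := (Real.continuous_sqrt.mul (contDiff_profV σ ρ lam K).continuous).memLp_two_Ioo
  bdry_u := hu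
  bdry_v := hv

/-- Along the profiles r(uv' - vu') = σKρu, and with the equation for u' the density of the first
variation becomes the derivative of -σKρ u(ξv - ηu). This vanishes at 0 because u does, and at R
because ξ and η do. -/
theorem isCriticalE0_prof {a c R σ ρ lam : ℝ} (hR : 0 < R) {k : ℤ} (hk : k ≠ 0)
    (hσ : σ ^ 2 = 1) (hρ : 0 < ρ) (hρ2 : ρ ^ 2 = a ^ 2 / c ^ 2)
    (hu : profU ρ lam k.natAbs R = sPlus a 0 c / √2)
    (hv : profV σ ρ lam k.natAbs R = -(sPlus a 0 c / √6)) :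
    IsCriticalE0 a c R k (profU ρ lam k.natAbs) (profV σ ρ lam k.natAbs) := by
  have hK0 : k.natAbs ≠ 0 := Int.natAbs_ne_zero.2 hk
  have hK : (k : ℝ) ^ 2 = (k.natAbs : ℝ) ^ 2 := by rw [Nat.cast_natAbs, Int.cast_abs, sq_abs]
  have hmem := memS_prof hK0 hu hv
  obtain ⟨q, hq, hqu⟩ := exists_profU_eq_mul ρ lam hK0
  have dU := fun (r : ℝ) (hr : r ∈ Ioo 0 R) =>
    hasDerivAt_profU hσ hρ.ne' lam k.natAbs (r := r) hr.1.ne'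
  have dV := fun (r : ℝ) (hr : r ∈ Ioo 0 R) =>
    hasDerivAt_profV (σ := σ) hρ.ne' lam k.natAbs (r := r) hr.1.ne'
  have sU := contDiff_profU ρ lam k.natAbs
  have sV := contDiff_profV σ ρ lam k.natAbs
  have hcon : ∀ r, profU ρ lam k.natAbs r ^ 2 + profV σ ρ lam k.natAbs r ^ 2 = ρ ^ 2 :=
    prof_sq_add hσ ρ lam k.natAbs
  have hU0 : profU ρ lam k.natAbs 0 = 0 := by rw [hqu, zero_mul]
  generalize profU ρ lam k.natAbs = U at *
  generalize profV σ ρ lam k.natAbs = V at *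
  have hcon' : ∀ r ∈ Ioo 0 R, U r ^ 2 + V r ^ 2 = a ^ 2 / c ^ 2 := fun r _ => by rw [hcon, hρ2]
  refine ⟨hmem, ?_, fun ξ η hξ hη hξ0 hξR hηR => ?_⟩
  · rw [E0_eq_lintegral hcon']
    have hcont : Continuous fun r => 1 / 2 * (deriv U r ^ 2 + deriv V r ^ 2 +
        (k : ℝ) ^ 2 * q r ^ 2) * r := by
      have h1 := sU.continuous_deriv (by simp)
      have h2 := sV.continuous_deriv (by simp)
      fun_prop
    have h2 : IntegrableOn (fun r => 1 / 2 * (deriv U r ^ 2 + deriv V r ^ 2 +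
        (k : ℝ) ^ 2 * q r ^ 2) * r) (Ioo 0 R) :=
      (hcont.integrableOn_Icc (a := 0) (b := R)).mono_set Ioo_subset_Icc_self
    rw [setLIntegral_congr_fun measurableSet_Ioo fun r hr => ?_]
    · exact h2.lintegral_lt_top.ne
    · have hr0 := hr.1.ne'
      rw [hqu]
      congr 1
      field_simp
  · obtain ⟨hi, hd⟩ := hasDerivAt_E0 (k := k) hR (by rw [← hρ2]; positivity) hmem hcon' hξ hη hξ0
    refine hd.congr_deriv ?_
    rw [← integral_Ioc_eq_integral_Ioo, ← intervalIntegral.integral_of_le hR.le,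
      intervalIntegral.integral_eq_sub_of_hasDerivAt_of_le (f := fun r => -(σ * k.natAbs * ρ *
        (U r * (ξ r * V r - η r * U r)))) hR.le ?_ (fun r hr => ?_)
        ((intervalIntegrable_iff_integrableOn_Ioo_of_le hR.le).2 hi)]
    · simp [hU0, hξR, hηR]
    · have h1 := sU.continuous
      have h2 := sV.continuous
      have h3 := hξ.continuous
      have h4 := hη.continuous
      fun_prop
    · have h1 := (hξ.differentiable (by simp) r).hasDerivAt
      have h2 := (hη.differentiable (by simp) r).hasDerivAt
      have hr0 := hr.1.ne'
      have hL : r * angMom U V r = σ * k.natAbs * ρ * U r := by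
        rw [angMom, (dU r hr).deriv, (dV r hr).deriv]
        field_simp
        linear_combination (σ * U r) * hcon r
      refine (((dU r hr).fun_mul ((h1.fun_mul (dV r hr)).fun_sub
        (h2.fun_mul (dU r hr)))).const_mul (σ * k.natAbs * ρ)).fun_neg.congr_deriv ?_
      rw [firstVarDensity, hL, (dU r hr).deriv, (dV r hr).deriv, hK]
      field_simp
      linear_combination (k.natAbs * U r * V r * (ξ r * V r - η r * U r)) * hσ

/-! ### Constants, boundary values and the classification -/

lemma sqrt_mul_sPlus_sq {a c : ℝ} (hc : 0 < c ^ 2) :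
    (√(2 / 3) * sPlus a 0 c) ^ 2 = a ^ 2 / c ^ 2 := by
  have hc0 : c ≠ 0 := by rintro rfl; simp at hc
  rw [mul_pow, Real.sq_sqrt (by norm_num), sPlus, div_pow, zero_pow two_ne_zero, zero_add,
    zero_pow four_ne_zero, zero_add, Real.sq_sqrt (by positivity)]
  field_simp
  ring

lemma sPlus_pos {a c : ℝ} (ha : 0 < a ^ 2) (hc : 0 < c ^ 2) : 0 < sPlus a 0 c := by
  rw [sPlus]
  have : 0 < √((0 : ℝ) ^ 4 + 24 * a ^ 2 * c ^ 2) := Real.sqrt_pos.2 (by positivity)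
  positivity

lemma sqrt_two_thirds : √(2 / 3) = √2 / √3 := Real.sqrt_div (by norm_num) 3

lemma sqrt_six : √6 = √2 * √3 := by
  rw [← Real.sqrt_mul (by norm_num)]; norm_num

/-- The function 2x/(1 + x²) is invariant under x ↦ 1/x, so 1/√3 and √3 both give √3/2. The quotient
(x² - 1)/(1 + x²) changes sign instead, which the sign σ compensates in `profV_bdry_one` and
`profV_bdry_neg_one`. -/
lemma profU_bdry {R lam : ℝ} {K : ℕ} (s : ℝ)
    (h : lam * R ^ K = 1 / √3 ∨ lam * R ^ K = √3) :
    profU (√(2 / 3) * s) lam K R = s / √2 := by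
  have h3 : √3 ^ 2 = 3 := Real.sq_sqrt (by norm_num)
  have h2 : √2 ^ 2 = 2 := Real.sq_sqrt (by norm_num)
  have p2 : 0 < √2 := by positivity
  have p3 : 0 < √3 := by positivity
  rcases h with h | h
  · rw [profU, h, sqrt_two_thirds, div_pow, h3]
    field_simp
    rw [h2, h3]; ring
  · rw [profU, h, sqrt_two_thirds, h3]
    field_simp
    rw [h2]; ring

lemma profV_bdry_one {R lam : ℝ} {K : ℕ} (s : ℝ) (h : lam * R ^ K = 1 / √3) :
    profV 1 (√(2 / 3) * s) lam K R = -(s / √6) := by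
  have h3 : √3 ^ 2 = 3 := Real.sq_sqrt (by norm_num)
  have h2 : √2 ^ 2 = 2 := Real.sq_sqrt (by norm_num)
  have p2 : 0 < √2 := by positivity
  have p3 : 0 < √3 := by positivity
  rw [profV, h, sqrt_two_thirds, sqrt_six, div_pow, h3]
  field_simp
  rw [h2]; ring

lemma profV_bdry_neg_one {R lam : ℝ} {K : ℕ} (s : ℝ) (h : lam * R ^ K = √3) :
    profV (-1) (√(2 / 3) * s) lam K R = -(s / √6) := by
  have h3 : √3 ^ 2 = 3 := Real.sq_sqrt (by norm_num)
  have h2 : √2 ^ 2 = 2 := Real.sq_sqrt (by norm_num)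
  have p2 : 0 < √2 := by positivity
  have p3 : 0 < √3 := by positivity
  rw [profV, h, sqrt_two_thirds, sqrt_six, h3]
  field_simp
  rw [h2]; ring

/-- Separates the two critical points. At R/2 one has r^(2K) ≤ R^(2K)/4 because K ≥ 1, so the
numerator of the minus profile is negative and that of the plus profile is positive. -/
lemma vMinus_lt_vPlus {R s : ℝ} (hR : 0 < R) (hs : 0 < s) {k : ℤ} (hk : k ≠ 0) :
    vMinus R s k (R / 2) < vPlus R s k (R / 2) := by
  have hK : k.natAbs ≠ 0 := Int.natAbs_ne_zero.2 hk
  have h0 : 0 < R ^ (2 * k.natAbs) := by positivity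
  have h0' : 0 < (R / 2) ^ (2 * k.natAbs) := by positivity
  have h1 : (R / 2) ^ (2 * k.natAbs) ≤ R ^ (2 * k.natAbs) / 4 := by
    have h2 : ((1 : ℝ) / 4) ^ k.natAbs ≤ 1 / 4 := pow_le_of_le_one (by norm_num) (by norm_num) hK
    have h3 : (R / 2) ^ (2 * k.natAbs) = R ^ (2 * k.natAbs) * (1 / 4) ^ k.natAbs := by
      rw [pow_mul, pow_mul, ← mul_pow]
      congr 1
      ring
    rw [h3]
    nlinarith
  refine mul_lt_mul_of_pos_left ?_ (by positivity)
  exact (div_neg_of_neg_of_pos (by linarith) (by linarith)).trans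
    (div_pos (by linarith) (by linarith))

/-- Every critical point of `E0` is one of the two explicit ones. -/
theorem eqOn_prof_of_isCriticalE0 {a c R ρ lam₁ lam₂ : ℝ} (hR : 0 < R) {k : ℤ} (hρ : 0 < ρ)
    (hρ2 : ρ ^ 2 = a ^ 2 / c ^ 2) (hs : 0 < sPlus a 0 c)
    (hs2 : 2 / 3 * sPlus a 0 c ^ 2 = ρ ^ 2)
    (hu₁ : profU ρ lam₁ k.natAbs R = sPlus a 0 c / √2)
    (hv₁ : profV 1 ρ lam₁ k.natAbs R = -(sPlus a 0 c / √6))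
    (hu₂ : profU ρ lam₂ k.natAbs R = sPlus a 0 c / √2)
    (hv₂ : profV (-1) ρ lam₂ k.natAbs R = -(sPlus a 0 c / √6))
    {u v : ℝ → ℝ} (h : IsCriticalE0 a c R k u v) :
    (EqOn u (profU ρ lam₁ k.natAbs) (Ioc 0 R) ∧ EqOn v (profV 1 ρ lam₁ k.natAbs) (Ioc 0 R)) ∨
    (EqOn u (profU ρ lam₂ k.natAbs) (Ioc 0 R) ∧ EqOn v (profV (-1) ρ lam₂ k.natAbs) (Ioc 0 R)) := by
  have hcon := constraint_of_E0_ne_top h.finite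
  have hC : 0 < a ^ 2 / c ^ 2 := by rw [← hρ2]; positivity
  have hst : ∀ ξ η : ℝ → ℝ, ContDiff ℝ ∞ ξ → ContDiff ℝ ∞ η → ξ 0 = 0 → ξ R = 0 → η R = 0 →
      ∫ r in Ioo 0 R, firstVarDensity k u v ξ η r = 0 := fun ξ η hξ hη h0 h1 h2 => by
    have h3 := (hasDerivAt_E0 (k := k) hR hC h.mem hcon hξ hη h0).2.unique
      (h.stationary ξ η hξ hη h0 h1 h2)
    exact (mul_eq_zero.1 h3).resolve_left (inv_ne_zero hC.ne')
  simp only [← hρ2] at hcon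
  have hpos : 0 < u R := by rw [h.mem.bdry_u]; positivity
  -- Finite energy gives the constraint only on the open interval. At R it follows from the boundary
  -- data, as s²/2 + s²/6 = 2s²/3.
  have hcon' : ∀ r ∈ Ioc 0 R, u r ^ 2 + v r ^ 2 = ρ ^ 2 := fun r hr => by
    rcases hr.2.lt_or_eq with h1 | rfl
    · exact hcon r ⟨hr.1, h1⟩
    · rw [h.mem.bdry_u, h.mem.bdry_v, neg_sq, div_pow, div_pow, Real.sq_sqrt (by norm_num),
        Real.sq_sqrt (by norm_num), ← hs2]
      ring
  have cu := continuousOn_Ioc_of_ac h.mem.ac_u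
  have cv := continuousOn_Ioc_of_ac h.mem.ac_v
  obtain ⟨σ, rfl | rfl, hu, hv⟩ := hasDerivAt_of_stationary hR hρ h.mem hcon hst
  · exact Or.inl (eqOn_prof_of_system hR hρ (by norm_num) cu cv hcon' hu hv
      (hu₁.trans h.mem.bdry_u.symm) (hv₁.trans h.mem.bdry_v.symm) hpos)
  · exact Or.inr (eqOn_prof_of_system hR hρ (by norm_num) cu cv hcon' hu hv
      (hu₂.trans h.mem.bdry_u.symm) (hv₂.trans h.mem.bdry_v.symm) hpos)

end QDefect

end

open QDefect in
theorem theorem4p5 (a c R : ℝ) (ha : 0 < a ^ 2) (hc : 0 < c ^ 2) (hR : 0 < R) (k : ℤ) (hk : k ≠ 0) :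
    -- exactly two critical points, up to the irrelevant values outside `(0, R]`
    (IsCriticalE0 a c R k (uMinus R (sPlus a 0 c) k) (vMinus R (sPlus a 0 c) k) ∧
      IsCriticalE0 a c R k (uPlus R (sPlus a 0 c) k) (vPlus R (sPlus a 0 c) k) ∧
      ¬ (Set.EqOn (uMinus R (sPlus a 0 c) k) (uPlus R (sPlus a 0 c) k) (Set.Ioc 0 R) ∧
          Set.EqOn (vMinus R (sPlus a 0 c) k) (vPlus R (sPlus a 0 c) k) (Set.Ioc 0 R)) ∧
      ∀ u v : ℝ → ℝ, IsCriticalE0 a c R k u v →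
        (Set.EqOn u (uMinus R (sPlus a 0 c) k) (Set.Ioc 0 R) ∧
          Set.EqOn v (vMinus R (sPlus a 0 c) k) (Set.Ioc 0 R)) ∨
        (Set.EqOn u (uPlus R (sPlus a 0 c) k) (Set.Ioc 0 R) ∧
          Set.EqOn v (vPlus R (sPlus a 0 c) k) (Set.Ioc 0 R))) ∧
    IsCriticalHarmonic R (sPlus a 0 c) k
      (ansatz k (uMinus R (sPlus a 0 c) k) (vMinus R (sPlus a 0 c) k)) ∧
    IsCriticalHarmonic R (sPlus a 0 c) k
      (ansatz k (uPlus R (sPlus a 0 c) k) (vPlus R (sPlus a 0 c) k)) ∧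
    IsUniqueMinimiser R (sPlus a 0 c) k
      (ansatz k (uMinus R (sPlus a 0 c) k) (vMinus R (sPlus a 0 c) k)) := by
  have hs := sPlus_pos ha hc
  have hρ2 := sqrt_mul_sPlus_sq (a := a) hc
  have hs2 : 2 / 3 * sPlus a 0 c ^ 2 = (√(2 / 3) * sPlus a 0 c) ^ 2 := by
    rw [mul_pow, Real.sq_sqrt (by norm_num)]
  have hρ : 0 < √(2 / 3) * sPlus a 0 c := by positivity
  have hRk : 0 < R ^ k.natAbs := by positivity
  have h3 : 0 < √3 := by positivity
  have hl₁ : 1 / (√3 * R ^ k.natAbs) * R ^ k.natAbs = 1 / √3 := by field_simp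
  have hl₂ : √3 / R ^ k.natAbs * R ^ k.natAbs = √3 := by field_simp
  have hu₁ := profU_bdry (sPlus a 0 c) (Or.inl hl₁)
  have hu₂ := profU_bdry (sPlus a 0 c) (Or.inr hl₂)
  have hv₁ := profV_bdry_one (sPlus a 0 c) hl₁
  have hv₂ := profV_bdry_neg_one (sPlus a 0 c) hl₂
  have hne := vMinus_lt_vPlus hR hs hk
  rw [vMinus_eq hR, vPlus_eq hR] at hne
  rw [uMinus_eq hR, vMinus_eq hR, uPlus_eq hR, vPlus_eq hR]
  have harm := fun {σ lam : ℝ} (hσ : σ ^ 2 = 1)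
      (hu : profU (√(2 / 3) * sPlus a 0 c) lam k.natAbs R = sPlus a 0 c / √2)
      (hv : profV σ (√(2 / 3) * sPlus a 0 c) lam k.natAbs R = -(sPlus a 0 c / √6)) =>
    isCriticalHarmonic_of_solves hR hs (continuous_powPotential lam k.natAbs)
      (fun z => ansatz_mem_S0 _ _ _ z)
      (fun i j => (solvesSchrodinger_ansatz k σ (√(2 / 3) * sPlus a 0 c) lam i j).mono
        (Set.subset_univ _))
      (fun z => (sum_sq_ansatz k hk hσ _ lam z).trans hs2.symm)
      (isAdmissible_ansatz hR hk hσ hu hv)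
  refine ⟨⟨isCriticalE0_prof hR hk (by norm_num) hρ hρ2 hu₁ hv₁,
    isCriticalE0_prof hR hk (by norm_num) hρ hρ2 hu₂ hv₂, fun h => ?_,
    fun u v h => eqOn_prof_of_isCriticalE0 hR hρ hρ2 hs hs2 hu₁ hv₁ hu₂ hv₂ h⟩,
    harm (by norm_num) hu₁ hv₁, harm (by norm_num) hu₂ hv₂,
    isUniqueMinimiser_ansatz hR hk (by norm_num) ?_ hu₁ hv₁⟩
  · have hR2 : R / 2 ∈ Set.Ioc 0 R := ⟨by linarith, by linarith⟩
    exact hne.ne ((h.2 hR2))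
  -- For the minus map (lam R^K)² is exactly 1/3, the largest value for which the positive solution
  -- stays above 1/2. For the plus map it is 3, and the argument does not apply.
  · rw [hl₁, div_pow, Real.sq_sqrt (by norm_num)]
    norm_num
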